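/- **Setting.** Let $\Theta\subset\mathbb R^p$ be a rectangle (a product of intervals) and $\theta$ an interior point of $\Theta$. For every $n$ let $(X_1,\dots,X_n)$ have a joint density $f_n(x_1,\dots,x_n\mid\vartheta)$, $\vartheta\in\Theta$, with respect to some reference measure, positive for $\vartheta$ in the interior of $\Theta$; write $\ell_n=\log f_n$. Probabilities, expectations, $O_p$ and $o_p$ refer to $\vartheta=\theta$. For a (possibly improper) prior density $\pi\ge 0$ on $\Theta$ with $\pi(\theta)>0$ let $$\hat\theta^{B}=\frac{\int_\Theta \vartheta\,\pi(\vartheta)f_n(X\mid\vartheta)\,d\vartheta}{\int_\Theta \pi(\vartheta)f_n(X\mid\vartheta)\,d\vartheta}$$ be the posterior mean, and put $H_n=-n^{-1}\partial^2\ell_n/\partial\vartheta\partial\vartheta^{T}$, and, with $\partial_r=\partial/\partial\vartheta_r$, $$I_{n,rs}=n^{-1}\,\partial_r\ell_n\,\partial_s\ell_n,\qquad J_{n,rs,t}=n^{-1}\,\partial_r\partial_s\ell_n\,\partial_t\ell_n,\qquad K_{n,rst}=n^{-1}\,\partial_r\partial_s\partial_t\ell_n .$$ $M^{rs}$ denotes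 the entries of $M^{-1}$. **Assumption 1.** (i) $\hat\theta^{ML}-\theta=O_p(n^{-1/2})$, where, with probability tending to one, $\hat\theta^{ML}$ is an interior solution of the likelihood equation $\partial\ell_n/\partial\vartheta=0$; (ii) $\ell_n(\theta)=O_p(n)$; (iii) $\ell_n$ is three times continuously differentiable in the interior of $\Theta$; (iv) $\pi$ is differentiable there; (v) with probability tending to one $H_n(\theta)$ is invertible and $H_n(\hat\theta^{ML})$ is positive definite. **Assumption 2.** There are a non-singular matrix $H$ and constants $K_{rst}$, $I_{rs}$, $J_{rs,t}$ such that (i) $H_n(\theta)=H+O_p(n^{-1/2})$; (ii) $K_{n,rst}(\theta)=K_{rst}+o_p(1)$; (iii) $E\{I_{n,rs}(\theta)\}=I_{rs}+o(1)$; (iv) $E\{J_{n,rs,t}(\theta)\}=J_{rs,t}+o(1)$ (the expectations existing for large $n$). **Regularity.** (a) For all large $n$ the posterior is almost surely proper with a finite mean; (b) for all large $n$, $\int \partial_r f_n(x\mid\theta)\,dx=\partial_r\int f_n(x\mid\vartheta)\,dx\,\big|_{\vartheta=\theta}$ for each $r$ ($dx$ being the reference measure); (c) $K_n$ is asymptotically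 equicontinuous at $\theta$: for every $\varepsilon>0$ there is $\delta>0$ such that, for all large $n$, the event that $|K_{n,rst}(\vartheta)-K_{n,rst}(\theta)|>\varepsilon$ for some $\|\vartheta-\theta\|<\delta$ and some $r,s,t$ has probability at most $\varepsilon$; (d) for every $\delta>0$, $$\int_{\Theta\cap\{\|\vartheta-\theta\|\ge\delta\}}\|\vartheta-\theta\|\,\pi(\vartheta)\,e^{\ell_n(\vartheta)-\ell_n(\theta)}\,d\vartheta=o_p(n^{-p/2-1}).$$ **Remainder.** Let $$R_n=\hat\theta^{B}-\theta-n^{-1}H^{-1}\Big[\frac{\partial}{\partial\theta}\{\log\pi(\theta)+2\ell_n(\theta)\}+\frac12\sum_{r,s}H^{rs}A_{n,rs}\Big],$$ $$A_{n,rsv}=K_{vrs}+2J_{n,vr,s}(\theta)+\sum_{t,u}H^{tu}I_{n,su}(\theta)K_{rtv}.$$ It is assumed that if $R_n=o_p(n^{-1})$ then $E(R_n)$ exists for large $n$ and is $o(n^{-1})$. **Corollary.** Under these assumptions $E(\hat\theta^{B})$ exists for all large $n$, and $$E(\hat\theta^{B})-\theta=n^{-1}H^{-1}\Big\{\frac{\partial\log\pi(\theta)}{\partial\theta}+\frac12\sum_{r,s=1}^{p}H^{rs}A_{rs}\Big\}+o(n^{-1}),$$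 where the vector $A_{rs}$ has the components $$A_{rsv}=K_{vrs}+2J_{vr,s}+\sum_{t,u=1}^{p}H^{tu}I_{su}K_{rtv}\qquad(v=1,\dots,p).$$ Hence, if $\partial\log\pi(\theta)/\partial\theta=\phi(\theta):=-\frac12\sum_{r,s}H^{rs}A_{rs}$, then $E(\hat\theta^{B})-\theta=o(n^{-1})$, that is, the posterior mean is second-order unbiased at $\theta$. -/

import Mathlib

open MeasureTheory Filter Topology Asymptotics

noncomputable section

namespace BayesBias

section StochasticOrder

variable {Ω : ℕ → Type*} [∀ n, MeasurableSpace (Ω n)] {E : Type*} [NormedAddCommGroup E]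

/-- `Y n = O_p(a n)` under the sequence of laws `P n`. -/
def IsBigOp (P : ∀ n, Measure (Ω n)) (Y : ∀ n, Ω n → E) (a : ℕ → ℝ) : Prop :=
  ∀ ε : ℝ, 0 < ε → ∃ M : ℝ, ∀ᶠ n in atTop, P n {x | M * a n < ‖Y n x‖} ≤ ENNReal.ofReal ε

/-- `Y n = o_p(a n)` under the sequence of laws `P n`. -/
def IsLittleOp (P : ∀ n, Measure (Ω n)) (Y : ∀ n, Ω n → E) (a : ℕ → ℝ) : Prop :=
  ∀ ε : ℝ, 0 < ε → Tendsto (fun n => P n {x | ε * a n < ‖Y n x‖}) atTop (𝓝 0)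

/-- The events `A n` have probability tending to one. -/
def WithHighProb (P : ∀ n, Measure (Ω n)) (A : ∀ n, Ω n → Prop) : Prop :=
  Tendsto (fun n => P n {x | ¬ A n x}) atTop (𝓝 0)

end StochasticOrder

/-- The values of `(X_1, …, X_n)`, where the `i`-th observation lives in the space `X i`. -/
abbrev Sample (X : ℕ → Type*) (n : ℕ) : Type _ := (i : Fin n) → X i

/-- The parameter space `ℝ^p` (its norm is used only for orders of magnitude and for
neighbourhoods, so that the choice of a norm is immaterial). -/
abbrev Param (p : ℕ) : Type := Fin p → ℝ

/-- A parametric model: for every `n`, a family `f_n(x_1, …, x_n ∣ ϑ)` of joint densities of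
`X_1, …, X_n` with respect to a reference measure, where `ϑ` runs through a rectangle (a product of
intervals). On the interior of the rectangle the densities are positive: the sample space is their
common support. -/
structure Model (p : ℕ) (X : ℕ → Type*) [∀ i, MeasurableSpace (X i)] where
  /-- the sides of the parameter rectangle -/
  side : Fin p → Set ℝ
  side_ordConnected : ∀ r, (side r).OrdConnected
  /-- the reference measures, for instance Lebesgue measure -/
  ref : ∀ n, Measure (Sample X n)
  /-- the joint densities -/
  f : ∀ n, Sample X n → Param p → ℝ
  measurable_f : ∀ n, ∀ ϑ ∈ Set.univ.pi side, Measurable fun x => f n x ϑ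
  f_nonneg : ∀ n x, ∀ ϑ ∈ Set.univ.pi side, 0 ≤ f n x ϑ
  f_pos : ∀ n x, ∀ ϑ ∈ interior (Set.univ.pi side), 0 < f n x ϑ
  lintegral_f : ∀ n, ∀ ϑ ∈ Set.univ.pi side, ∫⁻ x, ENNReal.ofReal (f n x ϑ) ∂(ref n) = 1

/-- The partial derivative `∂g/∂ϑ_r`. -/
def pderiv {p : ℕ} (r : Fin p) (g : Param p → ℝ) (ϑ : Param p) : ℝ :=
  fderiv ℝ g ϑ (Pi.single r 1)

section Model

variable {p : ℕ} {X : ℕ → Type*} [∀ i, MeasurableSpace (X i)]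

namespace Model

variable (M : Model p X)

/-- The parameter space, a rectangle in `ℝ^p`. -/
def Θ : Set (Param p) := Set.univ.pi M.side

/-- The joint law of `X_1, …, X_n` under the parameter value `ϑ`. -/
def law (ϑ : Param p) (n : ℕ) : Measure (Sample X n) :=
  (M.ref n).withDensity fun x => ENNReal.ofReal (M.f n x ϑ)

/-- The log-likelihood `ℓ_n`. -/
def ell (n : ℕ) (x : Sample X n) (ϑ : Param p) : ℝ := Real.log (M.f n x ϑ)

/-- `H_n = - n⁻¹ ∂²ℓ_n/∂ϑ∂ϑᵀ`. -/
def Hn (n : ℕ) (x : Sample X n) (ϑ : Param p) : Matrix (Fin p) (Fin p) ℝ :=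
  Matrix.of fun r s => -((n : ℝ)⁻¹ * pderiv r (pderiv s (M.ell n x)) ϑ)

/-- `I_{n,rs} = n⁻¹ (∂ℓ_n/∂ϑ_r) (∂ℓ_n/∂ϑ_s)`. -/
def In (n : ℕ) (x : Sample X n) (ϑ : Param p) (r s : Fin p) : ℝ :=
  (n : ℝ)⁻¹ * (pderiv r (M.ell n x) ϑ * pderiv s (M.ell n x) ϑ)

/-- `J_{n,rs,t} = n⁻¹ (∂²ℓ_n/∂ϑ_r∂ϑ_s) (∂ℓ_n/∂ϑ_t)`. -/
def Jn (n : ℕ) (x : Sample X n) (ϑ : Param p) (r s t : Fin p) : ℝ :=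
  (n : ℝ)⁻¹ * (pderiv r (pderiv s (M.ell n x)) ϑ * pderiv t (M.ell n x) ϑ)

/-- `K_{n,rst} = n⁻¹ ∂³ℓ_n/∂ϑ_r∂ϑ_s∂ϑ_t`. -/
def Kn (n : ℕ) (x : Sample X n) (ϑ : Param p) (r s t : Fin p) : ℝ :=
  (n : ℝ)⁻¹ * pderiv r (pderiv s (pderiv t (M.ell n x))) ϑ

/-- The (generalized) Bayes estimator: the posterior mean for the prior density `π`, which may be
improper. -/
def bayes (π : Param p → ℝ) (n : ℕ) (x : Sample X n) : Param p :=
  (∫ ϑ in M.Θ, π ϑ * M.f n x ϑ)⁻¹ • ∫ ϑ in M.Θ, (π ϑ * M.f n x ϑ) • ϑ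

end Model

/-- `A_{rsv} = K_{vrs} + 2 J_{vr,s} + ∑_{t,u} H^{tu} I_{su} K_{rtv}`, with `H^{tu}` the entries of
the inverse of `H`. -/
def biasA (H : Matrix (Fin p) (Fin p) ℝ) (I : Fin p → Fin p → ℝ)
    (J K : Fin p → Fin p → Fin p → ℝ) (r s v : Fin p) : ℝ :=
  K v r s + 2 * J v r s + ∑ t, ∑ u, H⁻¹ t u * I s u * K r t v

/-- The vector `½ ∑_{r,s} H^{rs} A_{rs}`. -/
def halfSum (H : Matrix (Fin p) (Fin p) ℝ) (I : Fin p → Fin p → ℝ)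
    (J K : Fin p → Fin p → Fin p → ℝ) : Fin p → ℝ :=
  fun v => (1 / 2) * ∑ r, ∑ s, H⁻¹ r s * biasA H I J K r s v

/-- The gradient `∂ log π / ∂ϑ`. -/
def gradLog (π : Param p → ℝ) (ϑ : Param p) : Fin p → ℝ :=
  fun v => pderiv v (fun ϑ' => Real.log (π ϑ')) ϑ

/-- The first set of conditions, at the true parameter `θ`: (i) root-`n` consistency of the solution
`θML` of the likelihood equation; (ii) order of the log-likelihood; (iii) smoothness of the
log-likelihood; (iv) differentiability of the prior density; (v) invertibility of `H_n(θ)` and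
positive definiteness of `H_n(θML)`. -/
structure FirstConditions (M : Model p X) (π : Param p → ℝ) (θ : Param p)
    (θML : ∀ n, Sample X n → Param p) : Prop where
  likelihood_equation : WithHighProb (M.law θ) fun n x =>
    θML n x ∈ interior M.Θ ∧ ∀ r, pderiv r (M.ell n x) (θML n x) = 0
  rate : IsBigOp (M.law θ) (fun n x => θML n x - θ) fun n => (Real.sqrt n)⁻¹
  ell_order : IsBigOp (M.law θ) (fun n x => M.ell n x θ) fun n => (n : ℝ)
  ell_smooth : ∀ n x, ContDiffOn ℝ 3 (M.ell n x) (interior M.Θ)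
  prior_differentiable : DifferentiableOn ℝ π (interior M.Θ)
  invertible : WithHighProb (M.law θ) fun n x => IsUnit (M.Hn n x θ)
  posDef : WithHighProb (M.law θ) fun n x => (M.Hn n x (θML n x)).PosDef

/-- The second set of conditions, at the true parameter `θ`: limits `H`, `K` of `H_n(θ)`, `K_n(θ)`
in probability, with rate `n^{-1/2}` for the former, and limits `I`, `J` of `E I_n(θ)`,
`E J_n(θ)`. -/
structure SecondConditions (M : Model p X) (θ : Param p) (H : Matrix (Fin p) (Fin p) ℝ)
    (I : Fin p → Fin p → ℝ) (J K : Fin p → Fin p → Fin p → ℝ) : Prop where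
  nonsingular : IsUnit H
  H_limit : ∀ r s, IsBigOp (M.law θ) (fun n x => M.Hn n x θ r s - H r s)
    fun n => (Real.sqrt n)⁻¹
  K_limit : ∀ r s t, IsLittleOp (M.law θ) (fun n x => M.Kn n x θ r s t - K r s t) fun _ => 1
  I_integrable : ∀ r s, ∀ᶠ n in atTop, Integrable (fun x => M.In n x θ r s) (M.law θ n)
  I_limit : ∀ r s, Tendsto (fun n => ∫ x, M.In n x θ r s ∂(M.law θ n)) atTop (𝓝 (I r s))
  J_integrable : ∀ r s t, ∀ᶠ n in atTop, Integrable (fun x => M.Jn n x θ r s t) (M.law θ n)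
  J_limit : ∀ r s t,
    Tendsto (fun n => ∫ x, M.Jn n x θ r s t ∂(M.law θ n)) atTop (𝓝 (J r s t))

/-- The regularity that the use of Taylor's and Laplace's expansions takes for granted. -/
structure Regularity (M : Model p X) (π : Param p → ℝ) (θ : Param p) : Prop where
  prior_nonneg : ∀ ϑ ∈ M.Θ, 0 ≤ π ϑ
  prior_pos : 0 < π θ
  /-- The posterior is proper and has a mean. -/
  posterior_proper : ∀ᶠ n in atTop, ∀ᵐ x ∂(M.law θ n),
    IntegrableOn (fun ϑ => π ϑ * M.f n x ϑ) M.Θ ∧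
    IntegrableOn (fun ϑ => ‖ϑ‖ * (π ϑ * M.f n x ϑ)) M.Θ
  /-- `∂/∂ϑ_r ∫ f_n = ∫ ∂f_n/∂ϑ_r` at `θ`. -/
  interchange : ∀ᶠ n in atTop, ∀ r : Fin p,
    ∫ x, pderiv r (M.f n x) θ ∂(M.ref n) =
      pderiv r (fun ϑ => ∫ x, M.f n x ϑ ∂(M.ref n)) θ
  /-- The third derivatives `K_n` are asymptotically equicontinuous at `θ`, in probability. -/
  equicontinuous : ∀ ε : ℝ, 0 < ε → ∃ δ : ℝ, 0 < δ ∧ ∀ᶠ n in atTop,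
    M.law θ n {x | ∃ ϑ ∈ Metric.ball θ δ, ∃ r s t,
      ε < |M.Kn n x ϑ r s t - M.Kn n x θ r s t|} ≤ ENNReal.ofReal ε
  /-- Parameter values away from `θ` do not contribute to the Laplace expansion. -/
  localized : ∀ δ : ℝ, 0 < δ → IsLittleOp (M.law θ)
    (fun n x => ∫ ϑ in M.Θ \ Metric.ball θ δ, ‖ϑ - θ‖ * (π ϑ * (M.f n x ϑ / M.f n x θ)))
    fun n => (n : ℝ) ^ (-((p : ℝ) / 2 + 1))

/-- The remainder of the stochastic second-order expansion of the Bayes estimator,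
`θB - θ - n⁻¹ H⁻¹ (∂{log π + 2 ℓ_n}/∂θ + ½ ∑_{r,s} H^{rs} A_{n,rs})`, where `A_{n,rs}` is `A_{rs}` with
`I_n(θ)` and `J_n(θ)` in place of `I` and `J`. -/
def remainder (M : Model p X) (π : Param p → ℝ) (θ : Param p) (H : Matrix (Fin p) (Fin p) ℝ)
    (K : Fin p → Fin p → Fin p → ℝ) (n : ℕ) (x : Sample X n) : Param p :=
  M.bayes π n x - θ - (n : ℝ)⁻¹ • H⁻¹.mulVec
    (gradLog π θ + (fun v => 2 * pderiv v (M.ell n x) θ) +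
      halfSum H (M.In n x θ) (M.Jn n x θ) K)

/-- If the remainder is `o_p(n⁻¹)`, then its expectation (exists and) is `o(n⁻¹)`. -/
def RemainderExpectation (M : Model p X) (π : Param p → ℝ) (θ : Param p)
    (H : Matrix (Fin p) (Fin p) ℝ) (K : Fin p → Fin p → Fin p → ℝ) : Prop :=
  IsLittleOp (M.law θ) (fun n x => remainder M π θ H K n x) (fun n => (n : ℝ)⁻¹) →
    (∀ᶠ n in atTop, Integrable (remainder M π θ H K n) (M.law θ n)) ∧
    (fun n => ∫ x, remainder M π θ H K n x ∂(M.law θ n)) =o[atTop] fun n : ℕ => (n : ℝ)⁻¹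

/-- The bias `E(θB) - θ` of the Bayes estimator. -/
def bias (M : Model p X) (π : Param p → ℝ) (θ : Param p) (n : ℕ) : Param p :=
  (∫ x, M.bayes π n x ∂(M.law θ n)) - θ

end Model

end BayesBias

end

/-! The hypothesis on the remainder reduces the theorem to two facts: $R_n=o_p(n^{-1})$
(`isLittleOp_remainder`), and an evaluation of the expectation of the bracket. The second is short:
the score has mean zero by interchange of derivative and integral (`Model.integral_pderiv_ell`), and
`halfSum` is affine in $(I,J)$, so that $E I_n$ and $E J_n$ may be replaced by their limits.

For the first fact put $s=n^{-1/2}$, $\vartheta=\theta+su$, $z=s\,\partial\ell_n(\theta)$,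
$B=H_n(\theta)$, $\rho=\partial\log\pi(\theta)$. Near $\theta$ Taylor's formula gives the posterior
weight, relative to its value at $\theta$, as $\varphi(u)\{1+sQ(u)\}$ up to $o(s)$, with
$\varphi(u)=\exp(z\cdot u-\frac12u^TBu)$ and $Q(u)=K[u,u,u]/6+\rho\cdot u$ (`weight_expansion`,
`laplace_scaled`). The posterior mean is $\theta+sb$, where $b=N/D$ is a ratio of two such
integrals.

The ratio is found without computing Gaussian integrals (`ratio_expansion`). Integration by parts
against $\varphi$ gives $BN=Dz+s\int\nabla Q\,\varphi+o(s)$, hence $Bb=z+sg+o(s)$, where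
$g=\rho+\frac12K[mm^T+H^{-1}]$ and $m=H^{-1}z$. Since $b-m$ and $B-H$ are both $O(s)$, $(B-H)(b-m)$
is negligible, and $Hb=2z-Bm+sg+o(s)$. These terms are exactly the bracket: $2z$ is the term
$2\ell_n$, $-Bm$ is the $J_n$ term, and $g$ carries the prior, $K$ and $I_n$ (`bracket_eq`).

Boundedness of $z$ and positive definiteness of $H$ come from the likelihood equation and the
condition at $\hat\theta^{ML}$ (`score_isBigO`, `posDef_H`).

Stochastic orders are turned into deterministic asymptotics along filters. Here $o_p$ is `=o` along
`hpFilter`, whereas $O_p$ is `=O` only after restriction to events of probability at least $1-\eta$;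
`Tight` records this, and `Tight.eventually` removes the restriction at the end. -/

namespace BayesBias

/-! ### Stochastic orders as asymptotics along filters. -/

section HighProbability

variable {Ω : ℕ → Type*} [∀ n, MeasurableSpace (Ω n)] {E : Type*} [NormedAddCommGroup E]

/-- The filter of the events (one for each `n`) whose probability tends to one. -/
def hpFilter (P : ∀ n, Measure (Ω n)) : Filter (Σ n, Ω n) where
  sets := {A | Tendsto (fun n => P n {x | (⟨n, x⟩ : Σ n, Ω n) ∉ A}) atTop (𝓝 0)}
  univ_sets := by simp
  sets_of_superset := by
    intro A B hA hAB
    refine tendsto_of_tendsto_of_tendsto_of_le_of_le tendsto_const_nhds hA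
      (fun _ => zero_le) (fun n => measure_mono fun x hx hxA => hx (hAB hxA))
  inter_sets := by
    intro A B hA hB
    have hAB := Tendsto.add hA hB
    rw [add_zero] at hAB
    refine tendsto_of_tendsto_of_tendsto_of_le_of_le tendsto_const_nhds hAB
      (fun _ => zero_le) (fun n => (measure_mono ?_).trans (measure_union_le _ _))
    intro x hx
    by_contra h
    simp only [Set.mem_union, Set.mem_ofPred_eq, not_or, not_not] at h
    exact hx ⟨h.1, h.2⟩

lemma eventually_hpFilter {P : ∀ n, Measure (Ω n)} {p : (Σ n, Ω n) → Prop} :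
    (∀ᶠ i in hpFilter P, p i) ↔ Tendsto (fun n => P n {x | ¬ p ⟨n, x⟩}) atTop (𝓝 0) :=
  Iff.rfl

lemma WithHighProb.eventually {P : ∀ n, Measure (Ω n)} {A : ∀ n, Ω n → Prop}
    (h : WithHighProb P A) : ∀ᶠ i in hpFilter P, A i.1 i.2 := h

lemma eventually_hpFilter_of_ae {P : ∀ n, Measure (Ω n)} {A : ∀ n, Ω n → Prop}
    (h : ∀ᶠ n in atTop, ∀ᵐ x ∂(P n), A n x) : ∀ᶠ i in hpFilter P, A i.1 i.2 := by
  rw [eventually_hpFilter]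
  refine tendsto_const_nhds.congr' ?_
  filter_upwards [h] with n hn
  exact (ae_iff.1 hn).symm

lemma tendsto_fst_hpFilter (P : ∀ n, Measure (Ω n)) : Tendsto Sigma.fst (hpFilter P) atTop := by
  intro s hs
  refine eventually_hpFilter_of_ae (A := fun n _ => n ∈ s) ?_
  filter_upwards [hs] with n hn
  exact Eventually.of_forall fun _ => hn

lemma IsLittleOp.isLittleO {P : ∀ n, Measure (Ω n)} {Y : ∀ n, Ω n → E} {a : ℕ → ℝ}
    (h : IsLittleOp P Y a) :
    (fun i : Σ n, Ω n => Y i.1 i.2) =o[hpFilter P] fun i => a i.1 := by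
  rw [isLittleO_iff]
  intro c hc
  have h' : ∀ᶠ i : Σ n, Ω n in hpFilter P, ¬ c * a i.1 < ‖Y i.1 i.2‖ :=
    WithHighProb.eventually (A := fun n x => ¬ c * a n < ‖Y n x‖) (by
      simpa [WithHighProb] using h c hc)
  filter_upwards [h'] with i hi
  exact (not_lt.1 hi).trans (mul_le_mul_of_nonneg_left (le_abs_self _) hc.le)

/-- The sign condition is needed because `=o` compares with $|a_n|$ and `IsLittleOp` with $a_n$
itself. -/
lemma isLittleOp_of_isLittleO {P : ∀ n, Measure (Ω n)} {Y : ∀ n, Ω n → E} {a : ℕ → ℝ}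
    (ha : ∀ n, 0 ≤ a n)
    (h : (fun i : Σ n, Ω n => Y i.1 i.2) =o[hpFilter P] fun i => a i.1) :
    IsLittleOp P Y a := by
  intro ε hε
  have h' := eventually_hpFilter.1 (isLittleO_iff.1 h hε)
  simpa [abs_of_nonneg (ha _)] using h'

/-- `Φ` holds along the events of probability tending to one, up to events of arbitrarily small
probability. -/
def Tight (P : ∀ n, Measure (Ω n)) (Φ : Filter (Σ n, Ω n) → Prop) : Prop :=
  ∀ η : ℝ, 0 < η → ∃ G : Set (Σ n, Ω n),
    (∀ᶠ n in atTop, P n {x | (⟨n, x⟩ : Σ n, Ω n) ∉ G} ≤ ENNReal.ofReal η) ∧ Φ (hpFilter P ⊓ 𝓟 G)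

lemma Tight.mono {P : ∀ n, Measure (Ω n)} {Φ Ψ : Filter (Σ n, Ω n) → Prop} (h : Tight P Φ)
    (hΦ : ∀ l ≤ hpFilter P, Φ l → Ψ l) : Tight P Ψ := fun η hη =>
  let ⟨G, hG, hl⟩ := h η hη
  ⟨G, hG, hΦ _ inf_le_left hl⟩

/-- A union bound, with $\eta$ split into a summable family $\varepsilon_k$. The bound for index $k$
holds only from some $N_k$ on, so the common event imposes the $k$-th condition only when $n\ge
N_k$; since $n\to\infty$ along the filter, nothing is lost. -/
lemma Tight.forall {P : ∀ n, Measure (Ω n)} {κ : Type*} [Countable κ]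
    {Φ : κ → Filter (Σ n, Ω n) → Prop} (hanti : ∀ k l l', l ≤ l' → Φ k l' → Φ k l)
    (h : ∀ k, Tight P (Φ k)) : Tight P fun l => ∀ k, Φ k l := by
  intro η hη
  obtain ⟨ε, hε, hsum⟩ := ENNReal.exists_pos_sum_of_countable
    (ENNReal.ofReal_pos.2 hη).ne' κ
  have h1 : ∀ k, ∃ G : Set (Σ n, Ω n), (∃ N : ℕ, ∀ n ≥ N,
      P n {x | (⟨n, x⟩ : Σ n, Ω n) ∉ G} ≤ ε k) ∧ Φ k (hpFilter P ⊓ 𝓟 G) := by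
    intro k
    obtain ⟨G, hG, hl⟩ := h k (ε k) (hε k)
    exact ⟨G, by simpa [eventually_atTop] using hG, hl⟩
  choose G hG hl using h1
  choose N hN using hG
  refine ⟨{i | ∀ k, N k ≤ i.1 → i ∈ G k}, Eventually.of_forall fun n => ?_, fun k => ?_⟩
  · calc P n {x | (⟨n, x⟩ : Σ n, Ω n) ∉ {i : Σ n, Ω n | ∀ k, N k ≤ i.1 → i ∈ G k}}
        ≤ P n (⋃ k, {x | N k ≤ n ∧ (⟨n, x⟩ : Σ n, Ω n) ∉ G k}) := by
          refine measure_mono fun x hx => ?_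
          simp only [Set.mem_ofPred_eq, not_forall] at hx
          obtain ⟨k, h1, h2⟩ := hx
          exact Set.mem_iUnion.2 ⟨k, h1, h2⟩
      _ ≤ ∑' k, P n {x | N k ≤ n ∧ (⟨n, x⟩ : Σ n, Ω n) ∉ G k} := measure_iUnion_le _
      _ ≤ ∑' k, (ε k : ENNReal) := by
          refine ENNReal.tsum_le_tsum fun k => ?_
          by_cases hk : N k ≤ n
          · exact (measure_mono fun x hx => hx.2).trans (hN k n hk)
          · simp [hk]
      _ ≤ ENNReal.ofReal η := hsum.le
  · refine hanti k _ _ (le_inf inf_le_left ?_) (hl k)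
    rw [le_principal_iff]
    have h2 : ∀ᶠ i in hpFilter P, N k ≤ i.1 :=
      (tendsto_fst_hpFilter P).eventually (eventually_ge_atTop (N k))
    filter_upwards [mem_inf_of_left h2, mem_inf_of_right (mem_principal_self _)] with i h3 h4
    exact h4 k h3

lemma Tight.and {P : ∀ n, Measure (Ω n)} {Φ Ψ : Filter (Σ n, Ω n) → Prop}
    (hΦ : ∀ l l', l ≤ l' → Φ l' → Φ l) (hΨ : ∀ l l', l ≤ l' → Ψ l' → Ψ l)
    (h : Tight P Φ) (h' : Tight P Ψ) : Tight P fun l => Φ l ∧ Ψ l :=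
  (Tight.forall (Φ := fun b : Bool => if b then Φ else Ψ)
    (by rintro (_ | _) <;> simpa) (by rintro (_ | _) <;> simpa)).mono
    fun _ _ hl => ⟨by simpa using hl true, by simpa using hl false⟩

/-- The failure of `p` is contained in the complement of `G` together with the failure of `p` inside
`G`. Each has probability at most $\eta$ for large $n$, and $\eta$ is arbitrary. -/
lemma Tight.eventually {P : ∀ n, Measure (Ω n)} {p : (Σ n, Ω n) → Prop}
    (h : Tight P fun l => ∀ᶠ i in l, p i) : ∀ᶠ i in hpFilter P, p i := by
  rw [eventually_hpFilter, ENNReal.tendsto_nhds_zero]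
  intro ε hε
  obtain ⟨η, hη, hηε⟩ : ∃ η : ℝ, 0 < η ∧ ENNReal.ofReal η + ENNReal.ofReal η ≤ ε := by
    rcases eq_or_ne ε ⊤ with rfl | hε'
    · exact ⟨1, one_pos, le_top⟩
    · have := ENNReal.toReal_pos hε.ne' hε'
      refine ⟨ε.toReal / 2, by positivity, ?_⟩
      rw [← ENNReal.ofReal_add (by positivity) (by positivity), add_halves,
        ENNReal.ofReal_toReal hε']
  obtain ⟨G, hG, hp⟩ := h η hη
  rw [eventually_inf_principal] at hp
  have hp' := ENNReal.tendsto_nhds_zero.1 (eventually_hpFilter.1 hp) _ (ENNReal.ofReal_pos.2 hη)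
  filter_upwards [hG, hp'] with n h1 h2
  refine ((measure_mono ?_).trans (measure_union_le _ _)).trans ((add_le_add h1 h2).trans hηε)
  intro x hx
  by_cases hxG : (⟨n, x⟩ : Σ n, Ω n) ∈ G
  · exact Or.inr fun h => hx (h hxG)
  · exact Or.inl hxG

/-- The event is the one on which the bound with constant $M$ holds. As $M$ depends on $\eta$, no
single constant need serve along the whole of `hpFilter`. -/
lemma IsBigOp.tight {P : ∀ n, Measure (Ω n)} {Y : ∀ n, Ω n → E} {a : ℕ → ℝ}
    (h : IsBigOp P Y a) :
    Tight P fun l => (fun i : Σ n, Ω n => Y i.1 i.2) =O[l] fun i => a i.1 := by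
  intro η hη
  obtain ⟨M, hM⟩ := h η hη
  refine ⟨{i | ‖Y i.1 i.2‖ ≤ M * a i.1}, by simpa using hM, ?_⟩
  refine IsBigO.of_bound |M| ?_
  filter_upwards [mem_inf_of_right (mem_principal_self _)] with i hi
  refine le_trans hi ((le_abs_self _).trans ?_)
  rw [abs_mul, Real.norm_eq_abs]

/-- Asymptotic equicontinuity in probability. -/
lemma tight_of_equicontinuous {P : ∀ n, Measure (Ω n)} {A : ℝ → ℝ → ∀ n, Ω n → Prop}
    (hA : ∀ ε ε' δ n x, ε ≤ ε' → A ε δ n x → A ε' δ n x)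
    (h : ∀ ε : ℝ, 0 < ε → ∃ δ : ℝ, 0 < δ ∧ ∀ᶠ n in atTop,
      P n {x | ¬ A ε δ n x} ≤ ENNReal.ofReal ε) :
    Tight P fun l => ∀ ε : ℝ, 0 < ε → ∃ δ : ℝ, 0 < δ ∧ ∀ᶠ i in l, A ε δ i.1 i.2 := by
  -- Only countably many tolerances $1/(k+1)$ are used, so that `Tight.forall` applies.
  have h1 : Tight P fun l => ∀ k : ℕ, ∃ δ : ℝ, 0 < δ ∧ ∀ᶠ i in l,
      A (1 / ((k : ℝ) + 1)) δ i.1 i.2 := by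
    refine Tight.forall (fun k l l' hl ⟨δ, hδ, h⟩ => ⟨δ, hδ, hl h⟩) fun k η hη => ?_
    -- The hypothesis uses one number both as tolerance and as probability; the minimum serves both
    -- purposes.
    obtain ⟨δ, hδ, hP⟩ := h (min (1 / ((k : ℝ) + 1)) η) (lt_min (by positivity) hη)
    refine ⟨{i | A (1 / ((k : ℝ) + 1)) δ i.1 i.2}, ?_, δ, hδ,
      mem_inf_of_right (mem_principal_self _)⟩
    filter_upwards [hP] with n hn
    refine le_trans (measure_mono ?_) (hn.trans (ENNReal.ofReal_le_ofReal (min_le_right _ _)))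
    exact fun x hx hx' => hx (hA _ _ _ _ _ (min_le_left _ _) hx')
  refine h1.mono fun l _ hl ε hε => ?_
  obtain ⟨k, hk⟩ := exists_nat_one_div_lt hε
  obtain ⟨δ, hδ, h2⟩ := hl k
  exact ⟨δ, hδ, h2.mono fun i hi => hA _ _ _ _ _ hk.le hi⟩

end HighProbability

/-! ### Gaussian kernels: envelopes and integration by parts. -/

section Gaussian

variable {p : ℕ}

/-- Completing the square bounds the exponent by $-(1+t)$ plus a constant, and $(1+t)^k
e^{-(1+t)}\le k!$. -/
lemma exists_bound_pow_mul_exp (M : ℝ) {c : ℝ} (hc : 0 < c) (k : ℕ) :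
    ∃ C : ℝ, ∀ t : ℝ, 0 ≤ t → (1 + t) ^ k * Real.exp (M * t - c * t ^ 2) ≤ C := by
  obtain ⟨C, hC⟩ : ∃ C : ℝ, ∀ t : ℝ, 0 ≤ t → (1 + t) ^ k * Real.exp (-(1 + t)) ≤ C := by
    refine ⟨k.factorial, fun t ht => ?_⟩
    have h := Real.pow_div_factorial_le_exp (1 + t) (by positivity) k
    rw [div_le_iff₀ (by positivity)] at h
    rw [Real.exp_neg, ← div_eq_mul_inv, div_le_iff₀ (Real.exp_pos _), mul_comm]
    exact h
  refine ⟨C * Real.exp ((M + 1) ^ 2 / (4 * c) + 1), fun t ht => ?_⟩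
  have h1 : M * t - c * t ^ 2 ≤ -(1 + t) + ((M + 1) ^ 2 / (4 * c) + 1) := by
    have : (M + 1) ^ 2 / (4 * c) - (M + 1) * t + c * t ^ 2 =
        (2 * c * t - (M + 1)) ^ 2 / (4 * c) := by
      field_simp
      ring
    have h2 : 0 ≤ (2 * c * t - (M + 1)) ^ 2 / (4 * c) := by positivity
    linarith
  calc (1 + t) ^ k * Real.exp (M * t - c * t ^ 2)
      ≤ (1 + t) ^ k * (Real.exp (-(1 + t)) * Real.exp ((M + 1) ^ 2 / (4 * c) + 1)) := by
        rw [← Real.exp_add]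
        gcongr
    _ = (1 + t) ^ k * Real.exp (-(1 + t)) * Real.exp ((M + 1) ^ 2 / (4 * c) + 1) := by ring
    _ ≤ _ := by
        gcongr
        exact hC t ht

/-- With $p+1$ additional powers of $1+\|u\|$ the function is still bounded, so it is dominated by a
multiple of $(1+\|u\|)^{-(p+1)}$, which is integrable in dimension $p$. -/
lemma integrable_envelope (M : ℝ) {c : ℝ} (hc : 0 < c) (k : ℕ) :
    Integrable fun u : Param p => (1 + ‖u‖) ^ k * Real.exp (M * ‖u‖ - c * ‖u‖ ^ 2) := by
  obtain ⟨C, hC⟩ := exists_bound_pow_mul_exp M hc (k + (p + 1))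
  have h := (integrable_one_add_norm (E := Param p) (μ := volume) (r := (p + 1 : ℕ))
    (by simp)).const_mul C
  refine h.mono' (Continuous.aestronglyMeasurable (by fun_prop)) (Eventually.of_forall fun u => ?_)
  have h0 : 0 < 1 + ‖u‖ := by positivity
  rw [Real.rpow_neg h0.le, Real.rpow_natCast, ← div_eq_mul_inv, le_div_iff₀ (by positivity),
    Real.norm_of_nonneg (by positivity)]
  calc _ = (1 + ‖u‖) ^ (k + (p + 1)) * Real.exp (M * ‖u‖ - c * ‖u‖ ^ 2) := by ring
    _ ≤ C := hC _ (norm_nonneg _)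

/-- Continuous functions of polynomial growth. -/
def PolyGrowth (q : Param p → ℝ) : Prop :=
  Continuous q ∧ ∃ (C : ℝ) (k : ℕ), ∀ u, |q u| ≤ C * (1 + ‖u‖) ^ k

lemma PolyGrowth.const (a : ℝ) : PolyGrowth fun _ : Param p => a :=
  ⟨continuous_const, |a|, 0, by simp⟩

lemma PolyGrowth.coord (r : Fin p) : PolyGrowth fun u : Param p => u r :=
  ⟨continuous_apply r, 1, 1, fun u => by
    have := norm_le_pi_norm u r
    rw [Real.norm_eq_abs] at this
    linarith⟩

lemma PolyGrowth.mul {q q' : Param p → ℝ} (h : PolyGrowth q) (h' : PolyGrowth q') :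
    PolyGrowth fun u => q u * q' u := by
  obtain ⟨hc, C, k, hq⟩ := h
  obtain ⟨hc', C', k', hq'⟩ := h'
  refine ⟨hc.mul hc', C * C', k + k', fun u => ?_⟩
  rw [abs_mul]
  calc |q u| * |q' u| ≤ (C * (1 + ‖u‖) ^ k) * (C' * (1 + ‖u‖) ^ k') :=
        mul_le_mul (hq u) (hq' u) (abs_nonneg _) ((abs_nonneg _).trans (hq u))
    _ = _ := by ring

lemma PolyGrowth.add {q q' : Param p → ℝ} (h : PolyGrowth q) (h' : PolyGrowth q') :
    PolyGrowth fun u => q u + q' u := by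
  obtain ⟨hc, C, k, hq⟩ := h
  obtain ⟨hc', C', k', hq'⟩ := h'
  refine ⟨hc.add hc', |C| + |C'|, k + k', fun u => (abs_add_le _ _).trans ?_⟩
  rw [add_mul]
  have h1 : (1 : ℝ) ≤ 1 + ‖u‖ := by linarith [norm_nonneg u]
  gcongr ?_ + ?_
  · exact (hq u).trans (mul_le_mul (le_abs_self _) (pow_le_pow_right₀ h1 (by omega))
      (by positivity) (abs_nonneg _))
  · exact (hq' u).trans (mul_le_mul (le_abs_self _) (pow_le_pow_right₀ h1 (by omega))
      (by positivity) (abs_nonneg _))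

lemma PolyGrowth.sum {κ : Type*} (s : Finset κ) {q : κ → Param p → ℝ}
    (h : ∀ k, PolyGrowth (q k)) : PolyGrowth fun u => ∑ k ∈ s, q k u := by
  classical
  induction s using Finset.induction_on with
  | empty => simpa using PolyGrowth.const 0
  | insert a s ha ih => simpa [Finset.sum_insert ha] using (h a).add ih

/-- The unnormalized Gaussian density `exp(z·u - ½ uᵀBu)`. -/
noncomputable def gaussKernel (z : Param p) (B : Matrix (Fin p) (Fin p) ℝ) (u : Param p) : ℝ :=
  Real.exp (z ⬝ᵥ u - 1 / 2 * (u ⬝ᵥ B.mulVec u))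

lemma continuous_gaussKernel (z : Param p) (B : Matrix (Fin p) (Fin p) ℝ) :
    Continuous (gaussKernel z B) := by
  unfold gaussKernel
  refine Real.continuous_exp.comp (Continuous.sub ?_ (continuous_const.mul ?_))
  · exact continuous_const.dotProduct continuous_id
  · exact continuous_id.dotProduct (continuous_const.matrix_mulVec continuous_id)

lemma gaussKernel_pos (z : Param p) (B : Matrix (Fin p) (Fin p) ℝ) (u : Param p) :
    0 < gaussKernel z B u := Real.exp_pos _

lemma abs_dotProduct_le (z u : Param p) : |z ⬝ᵥ u| ≤ p * ‖z‖ * ‖u‖ := by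
  calc |z ⬝ᵥ u| ≤ ∑ r, |z r * u r| := Finset.abs_sum_le_sum_abs _ _
    _ ≤ ∑ _r : Fin p, ‖z‖ * ‖u‖ := by
        refine Finset.sum_le_sum fun r _ => ?_
        rw [abs_mul]
        exact mul_le_mul (norm_le_pi_norm z r) (norm_le_pi_norm u r) (abs_nonneg _) (norm_nonneg _)
    _ = _ := by simp [mul_assoc]

/-- The $2$ in the coercivity bound offsets the $\frac12$ in the exponent; the factor $p$ is the
cost of bounding a dot product by sup norms. -/
lemma gaussKernel_le {z : Param p} {B : Matrix (Fin p) (Fin p) ℝ} {M c : ℝ}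
    (hz : p * ‖z‖ ≤ M) (hB : ∀ u, 2 * c * ‖u‖ ^ 2 ≤ u ⬝ᵥ B.mulVec u) (u : Param p) :
    gaussKernel z B u ≤ Real.exp (M * ‖u‖ - c * ‖u‖ ^ 2) := by
  refine Real.exp_le_exp.2 ?_
  have h1 := (le_abs_self _).trans (abs_dotProduct_le z u)
  have h2 := mul_le_mul_of_nonneg_right hz (norm_nonneg u)
  have h3 := hB u
  linarith

lemma PolyGrowth.integrable {q : Param p → ℝ} (hq : PolyGrowth q) {z : Param p}
    {B : Matrix (Fin p) (Fin p) ℝ} {c : ℝ} (hc : 0 < c)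
    (hB : ∀ u, 2 * c * ‖u‖ ^ 2 ≤ u ⬝ᵥ B.mulVec u) :
    Integrable fun u => q u * gaussKernel z B u := by
  obtain ⟨hcont, C, k, hC⟩ := hq
  refine ((integrable_envelope (p * ‖z‖) hc k).const_mul C).mono'
    (hcont.mul (continuous_gaussKernel z B)).aestronglyMeasurable (Eventually.of_forall fun u => ?_)
  rw [norm_mul, Real.norm_eq_abs, Real.norm_of_nonneg (gaussKernel_pos z B u).le, ← mul_assoc]
  exact mul_le_mul (hC u) (gaussKernel_le le_rfl hB u) (gaussKernel_pos z B u).le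
    ((abs_nonneg _).trans (hC u))

/-- Along a coordinate line the exponent is a quadratic polynomial in $t$. Symmetry of $B$ makes the
two cross terms equal, which cancels the $\frac12$. -/
lemma hasLineDerivAt_gaussKernel (z : Param p) {B : Matrix (Fin p) (Fin p) ℝ} (hB : B.IsSymm)
    (u : Param p) (v : Fin p) :
    HasLineDerivAt ℝ (gaussKernel z B) (gaussKernel z B u * (z v - B.mulVec u v)) u
      (Pi.single v 1) := by
  have h : ∀ t : ℝ, z ⬝ᵥ (u + t • Pi.single v 1) -
      1 / 2 * ((u + t • Pi.single v 1) ⬝ᵥ B.mulVec (u + t • Pi.single v 1)) =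
      (z ⬝ᵥ u - 1 / 2 * (u ⬝ᵥ B.mulVec u)) + t * (z v - B.mulVec u v) - t ^ 2 * (B v v / 2) := by
    intro t
    have h1 : u ⬝ᵥ B.mulVec (Pi.single v 1) = B.mulVec u v := by
      rw [Matrix.dotProduct_mulVec, ← Matrix.mulVec_transpose, hB.eq]
      simp
    simp only [dotProduct_add, add_dotProduct, Matrix.mulVec_add, Matrix.mulVec_smul,
      dotProduct_smul, smul_dotProduct, smul_eq_mul, h1]
    simp
    ring
  unfold HasLineDerivAt gaussKernel
  simp only [h]
  have h2 : HasDerivAt (fun t : ℝ => (z ⬝ᵥ u - 1 / 2 * (u ⬝ᵥ B.mulVec u)) +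
      t * (z v - B.mulVec u v) - t ^ 2 * (B v v / 2)) (z v - B.mulVec u v) 0 := by
    have := ((((hasDerivAt_id (0 : ℝ)).mul_const (z v - B.mulVec u v)).const_add
      (z ⬝ᵥ u - 1 / 2 * (u ⬝ᵥ B.mulVec u)))).fun_sub
        (((hasDerivAt_id (0 : ℝ)).fun_pow 2).mul_const (B v v / 2))
    simpa using this
  simpa using h2.exp

lemma PolyGrowth.mulVec (B : Matrix (Fin p) (Fin p) ℝ) (v : Fin p) :
    PolyGrowth fun u : Param p => B.mulVec u v :=
  PolyGrowth.sum Finset.univ (q := fun r u => B v r * u r) fun r =>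
    (PolyGrowth.const (B v r)).mul (PolyGrowth.coord r)

/-- Integration by parts against a Gaussian density. -/
lemma integral_mulVec_mul_gaussKernel {z : Param p} {B : Matrix (Fin p) (Fin p) ℝ}
    (hsymm : B.IsSymm) {c : ℝ} (hc : 0 < c) (hB : ∀ u, 2 * c * ‖u‖ ^ 2 ≤ u ⬝ᵥ B.mulVec u)
    {q q' : Param p → ℝ} (hq : PolyGrowth q) (hq' : PolyGrowth q') (v : Fin p)
    (hderiv : ∀ u, HasLineDerivAt ℝ q (q' u) u (Pi.single v 1)) :
    ∑ r, B v r * ∫ u, q u * u r * gaussKernel z B u =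
      z v * (∫ u, q u * gaussKernel z B u) + ∫ u, q' u * gaussKernel z B u := by
  have h := integral_bilinear_hasLineDerivAt_right_eq_neg_left_of_integrable (μ := volume)
    (f := q) (f' := q') (g := gaussKernel z B)
    (g' := fun u => gaussKernel z B u * (z v - B.mulVec u v)) (v := Pi.single v 1)
    (B := ContinuousLinearMap.mul ℝ ℝ) (hq'.integrable hc hB)
    (by
      have := ((hq.mul ((PolyGrowth.const (z v)).add
        ((PolyGrowth.const (-1)).mul (PolyGrowth.mulVec B v)))).integrable (z := z) hc hB)
      refine this.congr (Eventually.of_forall fun u => ?_)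
      simp only [ContinuousLinearMap.mul_apply']
      ring)
    (hq.integrable hc hB) (fun u _ => hderiv u) (fun u _ => hasLineDerivAt_gaussKernel z hsymm u v)
  simp only [ContinuousLinearMap.mul_apply'] at h
  have h2 : ∀ u, q u * (gaussKernel z B u * (z v - B.mulVec u v)) =
      z v * (q u * gaussKernel z B u) - ∑ r, B v r * (q u * u r * gaussKernel z B u) := by
    intro u
    have : B.mulVec u v = ∑ r, B v r * u r := rfl
    rw [this, mul_sub, mul_sub, Finset.mul_sum, Finset.mul_sum]
    congr 1
    · ring
    · exact Finset.sum_congr rfl fun r _ => by ring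
  have hi : ∀ r, Integrable fun u => B v r * (q u * u r * gaussKernel z B u) := fun r =>
    ((hq.mul (PolyGrowth.coord r)).integrable hc hB).const_mul _
  have h3 : ∫ u, ∑ r, B v r * (q u * u r * gaussKernel z B u) =
      ∑ r, B v r * ∫ u, q u * u r * gaussKernel z B u := by
    rw [integral_finsetSum _ fun r _ => hi r]
    simp only [integral_const_mul]
  simp only [h2] at h
  rw [integral_sub ((hq.integrable hc hB).const_mul _) (integrable_finsetSum _ fun r _ => hi r),
    h3, integral_const_mul] at h
  linarith

end Gaussian

/-! ### Third-order Taylor expansion in several variables. -/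

section Taylor

variable {p : ℕ}

lemma fderiv_apply_eq_sum (g : Param p → ℝ) (x w : Param p) :
    fderiv ℝ g x w = ∑ r, w r * pderiv r g x := by
  conv_lhs => rw [pi_eq_sum_univ' w]
  simp [pderiv, map_sum, smul_eq_mul]

lemma contDiffOn_pderiv {g : Param p → ℝ} {U : Set (Param p)} (hU : IsOpen U) {m n : ℕ}
    (hg : ContDiffOn ℝ n g U) (hmn : m + 1 ≤ n) (r : Fin p) : ContDiffOn ℝ m (pderiv r g) U :=
  (hg.fderiv_of_isOpen hU (by exact_mod_cast hmn)).clm_apply contDiffOn_const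

lemma pderiv_comm {g : Param p → ℝ} {U : Set (Param p)} (hU : IsOpen U)
    (hg : ContDiffOn ℝ 2 g U) {x : Param p} (hx : x ∈ U) (r s : Fin p) :
    pderiv r (pderiv s g) x = pderiv s (pderiv r g) x := by
  have hd : DifferentiableAt ℝ (fderiv ℝ g) x :=
    ((hg.fderiv_of_isOpen hU (m := 1) (by norm_num)).differentiableOn
      (by norm_num)).differentiableAt (hU.mem_nhds hx)
  have h : ∀ r s : Fin p, pderiv r (pderiv s g) x =
      fderiv ℝ (fderiv ℝ g) x (Pi.single r 1) (Pi.single s 1) := by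
    intro r s
    unfold pderiv
    rw [fderiv_clm_apply hd (differentiableAt_const _)]
    simp
  rw [h, h]
  exact ((hg.contDiffAt (hU.mem_nhds hx)).isSymmSndFDerivAt (by simp)).eq _ _

lemma pderiv_pderiv_comm_left {g : Param p → ℝ} {U : Set (Param p)} (hU : IsOpen U)
    (hg : ContDiffOn ℝ 3 g U) {x : Param p} (hx : x ∈ U) (r s t : Fin p) :
    pderiv r (pderiv s (pderiv t g)) x = pderiv s (pderiv r (pderiv t g)) x :=
  pderiv_comm hU (contDiffOn_pderiv hU (m := 2) (n := 3) hg le_rfl t) hx r s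

lemma pderiv_pderiv_comm_right {g : Param p → ℝ} {U : Set (Param p)} (hU : IsOpen U)
    (hg : ContDiffOn ℝ 3 g U) {x : Param p} (hx : x ∈ U) (r s t : Fin p) :
    pderiv r (pderiv s (pderiv t g)) x = pderiv r (pderiv t (pderiv s g)) x := by
  have h : pderiv s (pderiv t g) =ᶠ[𝓝 x] pderiv t (pderiv s g) :=
    Filter.eventuallyEq_of_mem (hU.mem_nhds hx) fun y hy =>
      pderiv_comm hU (hg.of_le (by norm_num)) hy s t
  show fderiv ℝ _ x _ = fderiv ℝ _ x _
  rw [h.fderiv_eq]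

lemma hasDerivAt_line {g : Param p → ℝ} {U : Set (Param p)} (hU : IsOpen U)
    (hg : DifferentiableOn ℝ g U) {θ w : Param p} {t : ℝ} (ht : θ + t • w ∈ U) :
    HasDerivAt (fun t : ℝ => g (θ + t • w)) (∑ r, w r * pderiv r g (θ + t • w)) t := by
  have h1 : HasDerivAt (fun t : ℝ => θ + t • w) w t := by
    simpa using ((hasDerivAt_id t).smul_const w).const_add θ
  have h2 := (hg.differentiableAt (hU.mem_nhds ht)).hasFDerivAt.comp_hasDerivAt t h1
  rwa [fderiv_apply_eq_sum] at h2

lemma abs_sub_le_of_deriv_le {f f' : ℝ → ℝ} {C : ℝ}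
    (hf : ∀ t ∈ Set.Icc (0 : ℝ) 1, HasDerivAt f (f' t) t)
    (hC : ∀ t ∈ Set.Icc (0 : ℝ) 1, |f' t| ≤ C) {t : ℝ} (ht : t ∈ Set.Icc (0 : ℝ) 1) :
    |f t - f 0| ≤ C := by
  have h := (convex_Icc (0 : ℝ) 1).norm_image_sub_le_of_norm_hasDerivWithin_le
    (fun t ht => (hf t ht).hasDerivWithinAt) hC (Set.left_mem_Icc.2 zero_le_one) ht
  have hC0 : 0 ≤ C := (abs_nonneg _).trans (hC t ht)
  refine h.trans ?_
  rw [Real.norm_eq_abs, sub_zero, abs_of_nonneg ht.1]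
  exact mul_le_of_le_one_right hC0 ht.2

/-- Subtract the cubic polynomial with third derivative $k$ and apply the mean value inequality
three times on $[0,1]$. The constant $\varepsilon$ is not optimal, but only its smallness matters.
-/
lemma abs_taylor_three_le {f f₁ f₂ f₃ : ℝ → ℝ} {k ε : ℝ}
    (h₀ : ∀ t ∈ Set.Icc (0 : ℝ) 1, HasDerivAt f (f₁ t) t)
    (h₁ : ∀ t ∈ Set.Icc (0 : ℝ) 1, HasDerivAt f₁ (f₂ t) t)
    (h₂ : ∀ t ∈ Set.Icc (0 : ℝ) 1, HasDerivAt f₂ (f₃ t) t)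
    (h₃ : ∀ t ∈ Set.Icc (0 : ℝ) 1, |f₃ t - k| ≤ ε) :
    |f 1 - f 0 - f₁ 0 - f₂ 0 / 2 - k / 6| ≤ ε := by
  have e2 : ∀ t ∈ Set.Icc (0 : ℝ) 1, |f₂ t - f₂ 0 - t * k| ≤ ε := by
    intro t ht
    have := abs_sub_le_of_deriv_le (f := fun t => f₂ t - t * k) (f' := fun t => f₃ t - k)
      (fun t ht => by simpa using (h₂ t ht).fun_sub ((hasDerivAt_id t).mul_const k)) h₃ ht
    simp only [zero_mul, sub_zero] at this
    rwa [sub_right_comm]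
  have e1 : ∀ t ∈ Set.Icc (0 : ℝ) 1, |f₁ t - f₁ 0 - t * f₂ 0 - t ^ 2 * (k / 2)| ≤ ε := by
    intro t ht
    have := abs_sub_le_of_deriv_le (f := fun t => f₁ t - t * f₂ 0 - t ^ 2 * (k / 2))
      (f' := fun t => f₂ t - f₂ 0 - t * k)
      (fun t ht => by
        refine (((h₁ t ht).fun_sub ((hasDerivAt_id t).mul_const (f₂ 0))).fun_sub
          (((hasDerivAt_id t).fun_pow 2).mul_const (k / 2))).congr_deriv ?_
        simp only [id]
        norm_num
        ring) e2 ht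
    convert this using 2
    ring
  have e0 := abs_sub_le_of_deriv_le
    (f := fun t => f t - t * f₁ 0 - t ^ 2 * (f₂ 0 / 2) - t ^ 3 * (k / 6))
    (f' := fun t => f₁ t - f₁ 0 - t * f₂ 0 - t ^ 2 * (k / 2))
    (fun t ht => by
      refine ((((h₀ t ht).fun_sub ((hasDerivAt_id t).mul_const (f₁ 0))).fun_sub
        (((hasDerivAt_id t).fun_pow 2).mul_const (f₂ 0 / 2))).fun_sub
          (((hasDerivAt_id t).fun_pow 3).mul_const (k / 6))).congr_deriv ?_
      simp only [id]
      norm_num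
      ring) e1 (Set.right_mem_Icc.2 zero_le_one)
  convert e0 using 2
  ring

/-- The cubic form `∑ k_{rst} w_r w_s w_t`. -/
def cubic (k : Fin p → Fin p → Fin p → ℝ) (w : Param p) : ℝ :=
  ∑ r, ∑ s, ∑ t, k r s t * (w r * w s * w t)

lemma line_mem_ball {θ w : Param p} {δ : ℝ} (hw : ‖w‖ < δ) {t : ℝ} (ht : t ∈ Set.Icc (0 : ℝ) 1) :
    θ + t • w ∈ Metric.ball θ δ := by
  rw [Metric.mem_ball, dist_eq_norm, add_sub_cancel_left, norm_smul, Real.norm_of_nonneg ht.1]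
  exact (mul_le_of_le_one_left (norm_nonneg _) ht.2).trans_lt hw

lemma abs_sub_le_of_pderiv_le {g : Param p → ℝ} {θ w : Param p} {δ C : ℝ}
    (hg : DifferentiableOn ℝ g (Metric.ball θ δ))
    (hC : ∀ y ∈ Metric.ball θ δ, ∀ r, |pderiv r g y| ≤ C) (hw : ‖w‖ < δ) :
    |g (θ + w) - g θ| ≤ p * C * ‖w‖ := by
  have h := abs_sub_le_of_deriv_le (C := p * C * ‖w‖)
    (fun t ht => hasDerivAt_line (w := w) Metric.isOpen_ball hg (line_mem_ball hw ht))
    (fun t ht => by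
      refine (Finset.abs_sum_le_sum_abs _ _).trans ?_
      calc _ ≤ ∑ _r : Fin p, ‖w‖ * C := by
            refine Finset.sum_le_sum fun r _ => ?_
            rw [abs_mul]
            exact mul_le_mul (norm_le_pi_norm w r) (hC _ (line_mem_ball hw ht) r) (abs_nonneg _)
              (norm_nonneg _)
        _ = _ := by simp; ring) (Set.right_mem_Icc.2 zero_le_one)
  simpa using h

/-- One-variable Taylor on the segment from $\theta$ to $\theta+w$. The cubic term has prescribed
coefficients $k$ instead of the third derivatives at $\theta$, so that the random $K_n$ can be
replaced by its limit in the same step. -/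
lemma abs_taylor_le {g : Param p → ℝ} {θ w : Param p} {δ ε : ℝ}
    {k : Fin p → Fin p → Fin p → ℝ} (hg : ContDiffOn ℝ 3 g (Metric.ball θ δ))
    (hk : ∀ y ∈ Metric.ball θ δ, ∀ r s t, |pderiv r (pderiv s (pderiv t g)) y - k r s t| ≤ ε)
    (hw : ‖w‖ < δ) :
    |g (θ + w) - g θ - (∑ r, w r * pderiv r g θ) -
      (∑ s, ∑ r, w s * w r * pderiv r (pderiv s g) θ) / 2 - cubic k w / 6| ≤
      p ^ 3 * ε * ‖w‖ ^ 3 := by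
  have hU : IsOpen (Metric.ball θ δ) := Metric.isOpen_ball
  have hg0 : DifferentiableOn ℝ g (Metric.ball θ δ) := hg.differentiableOn (by norm_num)
  have hg1 : ∀ r, DifferentiableOn ℝ (pderiv r g) (Metric.ball θ δ) := fun r =>
    (contDiffOn_pderiv hU (m := 2) (n := 3) hg le_rfl r).differentiableOn (by norm_num)
  have hg2 : ∀ r s, DifferentiableOn ℝ (pderiv r (pderiv s g)) (Metric.ball θ δ) := fun r s =>
    (contDiffOn_pderiv hU (m := 1) (n := 2)
      (contDiffOn_pderiv hU (m := 2) (n := 3) hg le_rfl s) le_rfl r).differentiableOn (by norm_num)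
  have h := abs_taylor_three_le (f := fun t => g (θ + t • w))
    (f₁ := fun t => ∑ r, w r * pderiv r g (θ + t • w))
    (f₂ := fun t => ∑ s, w s * ∑ r, w r * pderiv r (pderiv s g) (θ + t • w))
    (f₃ := fun t => ∑ s, w s * ∑ r, w r * ∑ t', w t' *
      pderiv t' (pderiv r (pderiv s g)) (θ + t • w))
    (k := cubic k w) (ε := p ^ 3 * ε * ‖w‖ ^ 3)
    (fun t ht => hasDerivAt_line hU hg0 (line_mem_ball hw ht))
    (fun t ht => HasDerivAt.fun_sum fun r _ =>
      (hasDerivAt_line hU (hg1 r) (line_mem_ball hw ht)).const_mul (w r))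
    (fun t ht => HasDerivAt.fun_sum fun s _ => (HasDerivAt.fun_sum fun r _ =>
      (hasDerivAt_line hU (hg2 r s) (line_mem_ball hw ht)).const_mul (w r)).const_mul (w s))
    (fun t ht => by
      -- The sums are reordered to match the order in which the derivatives along the segment are
      -- taken.
      have hc : cubic k w = ∑ s, ∑ r, ∑ t', w s * (w r * (w t' * k t' r s)) := by
        unfold cubic
        rw [Finset.sum_comm]
        rw [Finset.sum_congr rfl fun r _ => Finset.sum_comm]
        rw [Finset.sum_comm]
        exact Finset.sum_congr rfl fun r _ => Finset.sum_congr rfl fun s _ =>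
          Finset.sum_congr rfl fun t _ => by ring
      rw [hc]
      simp only [Finset.mul_sum, ← Finset.sum_sub_distrib]
      calc _ ≤ ∑ _s : Fin p, ∑ _r : Fin p, ∑ _t' : Fin p, ‖w‖ * (‖w‖ * (‖w‖ * ε)) := by
            refine (Finset.abs_sum_le_sum_abs _ _).trans (Finset.sum_le_sum fun s _ => ?_)
            refine (Finset.abs_sum_le_sum_abs _ _).trans (Finset.sum_le_sum fun r _ => ?_)
            refine (Finset.abs_sum_le_sum_abs _ _).trans (Finset.sum_le_sum fun t' _ => ?_)
            rw [← mul_sub, ← mul_sub, ← mul_sub, abs_mul, abs_mul, abs_mul]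
            have hn := fun r => norm_le_pi_norm w r
            simp only [Real.norm_eq_abs] at hn
            gcongr
            · exact hn s
            · exact hn r
            · exact hn t'
            · exact hk _ (line_mem_ball hw ht) _ _ _
        _ = _ := by simp; ring)
  simpa [Finset.mul_sum, mul_assoc] using h

end Taylor

/-! ### Laplace's approximation in the rescaled variable. -/

section Laplace

variable {p : ℕ}

lemma exists_abs_cubic_le (k : Fin p → Fin p → Fin p → ℝ) :
    ∃ A : ℝ, 0 ≤ A ∧ ∀ u, |cubic k u| ≤ A * ‖u‖ ^ 3 := by
  refine ⟨∑ r, ∑ s, ∑ t, |k r s t|, by positivity, fun u => ?_⟩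
  have hn := fun r => norm_le_pi_norm u r
  simp only [Real.norm_eq_abs] at hn
  simp only [Finset.sum_mul]
  refine (Finset.abs_sum_le_sum_abs _ _).trans (Finset.sum_le_sum fun r _ => ?_)
  refine (Finset.abs_sum_le_sum_abs _ _).trans (Finset.sum_le_sum fun s _ => ?_)
  refine (Finset.abs_sum_le_sum_abs _ _).trans (Finset.sum_le_sum fun t _ => ?_)
  rw [abs_mul, abs_mul, abs_mul, show ‖u‖ ^ 3 = ‖u‖ * ‖u‖ * ‖u‖ by ring]
  gcongr <;> exact hn _

/-- No smallness of $y$ is assumed: it will be applied with $|y|$ up to a multiple of $\|u\|^2$, and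
the Gaussian decay absorbs $e^{|y|}$. -/
lemma abs_exp_sub_one_sub_le (y : ℝ) : |Real.exp y - 1 - y| ≤ y ^ 2 * Real.exp |y| := by
  have h := Complex.norm_exp_sub_sum_le_norm_mul_exp (y : ℂ) 2
  simp only [Finset.sum_range_succ, Finset.sum_range_zero] at h
  norm_num at h
  rw [← Complex.ofReal_exp, ← Complex.ofReal_one, ← Complex.ofReal_add, ← Complex.ofReal_sub,
    Complex.norm_real, Real.norm_eq_abs] at h
  rwa [sub_sub]

lemma abs_exp_sub_one_le' (y : ℝ) : |Real.exp y - 1| ≤ |y| * Real.exp |y| := by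
  have h := Complex.norm_exp_sub_sum_le_norm_mul_exp (y : ℂ) 1
  simp only [Finset.sum_range_succ, Finset.sum_range_zero] at h
  norm_num at h
  rwa [← Complex.ofReal_exp, ← Complex.ofReal_one, ← Complex.ofReal_sub,
    Complex.norm_real, Real.norm_eq_abs] at h

/-- Here $a=\|u\|$, $T$ is the cubic term, $g$ the prior term, and $e,e'$ are their errors. As long
as $sa\le\delta$, the perturbation $y=s(T+e)$ satisfies $|y|\le(A+1)(sa)a^2\le\frac c2a^2$ and uses
up only half of the Gaussian decay. Beyond $1+s(T+g)$ there remain four terms; those of order $s^2$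
become $O(s\varepsilon)$ through $s\le\varepsilon$. -/
lemma abs_laplace_near {φ s a T e g e' A ε δ M c : ℝ} (hφ : 0 < φ)
    (hφ' : φ ≤ Real.exp (M * a - c * a ^ 2)) (ha : 0 ≤ a) (hA : 0 ≤ A) (hs : 0 < s) (hsε : s ≤ ε)
    (hε : ε ≤ 1) (hsa : s * a ≤ δ) (hδ : (A + 1) * δ ≤ c / 2) (hT : |T| ≤ A * a ^ 3)
    (hg : |g| ≤ A * a) (he : |e| ≤ ε * a ^ 3) (he' : |e'| ≤ ε * a) :
    |φ * Real.exp (s * (T + e)) * (1 + s * (g + e')) - (1 + s * (T + g)) * φ| ≤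
      s * ε * (2 * (A + 1) ^ 2 + 2) * ((1 + a) ^ 6 * Real.exp (M * a - c / 2 * a ^ 2)) := by
  set y := s * (T + e) with hy
  have hε0 : 0 < ε := hs.trans_le hsε
  have hTe : |T + e| ≤ (A + 1) * a ^ 3 := by
    refine (abs_add_le _ _).trans ?_
    have : ε * a ^ 3 ≤ 1 * a ^ 3 := by gcongr
    linarith
  have hy1 : |y| ≤ s * ((A + 1) * a ^ 3) := by
    rw [hy, abs_mul, abs_of_pos hs]
    gcongr
  have hy2 : |y| ≤ c / 2 * a ^ 2 := by
    calc |y| ≤ (A + 1) * (s * a) * a ^ 2 := by linarith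
      _ ≤ (A + 1) * δ * a ^ 2 := by gcongr
      _ ≤ c / 2 * a ^ 2 := by gcongr
  have hE1 : (1 : ℝ) ≤ Real.exp |y| := Real.one_le_exp (abs_nonneg y)
  have hdec : φ * Real.exp y * (1 + s * (g + e')) - (1 + s * (T + g)) * φ =
      φ * ((Real.exp y - 1 - y) + s * e + s * g * (Real.exp y - 1) + s * e' * Real.exp y) := by
    rw [hy]; ring
  have h1a : (1 : ℝ) ≤ 1 + a := by linarith
  have pw : ∀ m ≤ 6, a ^ m ≤ (1 + a) ^ 6 := fun m hm =>
    (pow_le_pow_left₀ ha (by linarith) m).trans (pow_le_pow_right₀ h1a hm)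
  have b1 : |Real.exp y - 1 - y| ≤ s * ε * (A + 1) ^ 2 * (1 + a) ^ 6 * Real.exp |y| := by
    refine (abs_exp_sub_one_sub_le y).trans ?_
    have : y ^ 2 ≤ s * ε * (A + 1) ^ 2 * (1 + a) ^ 6 := by
      calc y ^ 2 = |y| ^ 2 := (sq_abs y).symm
        _ ≤ (s * ((A + 1) * a ^ 3)) ^ 2 := by gcongr
        _ = s * s * (A + 1) ^ 2 * a ^ 6 := by ring
        _ ≤ s * ε * (A + 1) ^ 2 * (1 + a) ^ 6 := by
          gcongr
          linarith
    gcongr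
  have b2 : |s * e| ≤ s * ε * 1 * (1 + a) ^ 6 * Real.exp |y| := by
    rw [abs_mul, abs_of_pos hs]
    calc s * |e| ≤ s * (ε * a ^ 3) * 1 := by rw [mul_one]; gcongr
      _ ≤ s * (ε * (1 + a) ^ 6) * Real.exp |y| := by
        gcongr
        exact pw 3 (by norm_num)
      _ = _ := by ring
  have b3 : |s * g * (Real.exp y - 1)| ≤ s * ε * (A + 1) ^ 2 * (1 + a) ^ 6 * Real.exp |y| := by
    rw [abs_mul, abs_mul, abs_of_pos hs]
    calc s * |g| * |Real.exp y - 1| ≤ s * (A * a) * (s * ((A + 1) * a ^ 3) * Real.exp |y|) := by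
          gcongr
          exact (abs_exp_sub_one_le' y).trans (by gcongr)
      _ = s * s * (A * (A + 1)) * a ^ 4 * Real.exp |y| := by ring
      _ ≤ s * ε * (A + 1) ^ 2 * (1 + a) ^ 6 * Real.exp |y| := by
        gcongr
        · nlinarith
        · exact pw 4 (by norm_num)
  have b4 : |s * e' * Real.exp y| ≤ s * ε * 1 * (1 + a) ^ 6 * Real.exp |y| := by
    rw [abs_mul, abs_mul, abs_of_pos hs, abs_of_pos (Real.exp_pos y)]
    calc s * |e'| * Real.exp y ≤ s * (ε * a ^ 1) * Real.exp |y| := by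
          rw [pow_one]
          gcongr
          exact le_abs_self y
      _ ≤ s * (ε * (1 + a) ^ 6) * Real.exp |y| := by
        gcongr
        exact pw 1 (by norm_num)
      _ = _ := by ring
  rw [hdec, abs_mul, abs_of_pos hφ]
  calc φ * |(Real.exp y - 1 - y) + s * e + s * g * (Real.exp y - 1) + s * e' * Real.exp y|
      ≤ Real.exp (M * a - c * a ^ 2) *
        (s * ε * (2 * (A + 1) ^ 2 + 2) * (1 + a) ^ 6 * Real.exp (c / 2 * a ^ 2)) := by
        refine mul_le_mul hφ' ?_ (abs_nonneg _) (Real.exp_pos _).le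
        have h4 := (abs_add_le (Real.exp y - 1 - y + s * e + s * g * (Real.exp y - 1))
          (s * e' * Real.exp y))
        have h3 := (abs_add_le (Real.exp y - 1 - y + s * e) (s * g * (Real.exp y - 1)))
        have h2 := (abs_add_le (Real.exp y - 1 - y) (s * e))
        calc _ ≤ s * ε * (2 * (A + 1) ^ 2 + 2) * (1 + a) ^ 6 * Real.exp |y| := by linarith
          _ ≤ _ := by gcongr
    _ = s * ε * (2 * (A + 1) ^ 2 + 2) * ((1 + a) ^ 6 *
        (Real.exp (M * a - c * a ^ 2) * Real.exp (c / 2 * a ^ 2))) := by ring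
    _ = _ := by
        rw [← Real.exp_add, show M * a - c * a ^ 2 + c / 2 * a ^ 2 = M * a - c / 2 * a ^ 2 by ring]

/-- For $sa\ge\delta$ only the Gaussian approximation has to be shown small. From $\delta^2\le
s\cdot sa^2$ and $s\le\varepsilon\delta^2$ follows $1\le s\varepsilon a^2$, so the factor
$s\varepsilon$ is gained at the price of two powers of $1+a$. -/
lemma abs_laplace_far {φ s a T g A ε δ M c : ℝ} (hφ : 0 < φ)
    (hφ' : φ ≤ Real.exp (M * a - c * a ^ 2)) (hc : 0 ≤ c) (ha : 0 ≤ a) (hA : 0 ≤ A) (hs : 0 < s)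
    (hs1 : s ≤ 1) (hδ : 0 < δ) (hsδ : s ≤ ε * δ ^ 2) (hsa : δ ≤ s * a) (hT : |T| ≤ A * a ^ 3)
    (hg : |g| ≤ A * a) :
    |(1 + s * (T + g)) * φ| ≤
      s * ε * (2 * (A + 1) ^ 2 + 2) * ((1 + a) ^ 6 * Real.exp (M * a - c / 2 * a ^ 2)) := by
  have hTg : |1 + s * (T + g)| ≤ (2 * (A + 1) ^ 2 + 2) * (1 + a) ^ 3 := by
    calc |1 + s * (T + g)| ≤ 1 + s * (|T| + |g|) := by
          refine (abs_add_le _ _).trans ?_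
          rw [abs_one, abs_mul, abs_of_pos hs]
          gcongr
          exact abs_add_le _ _
      _ ≤ 1 + 1 * (A * a ^ 3 + A * a) := by gcongr
      _ ≤ (1 + 2 * A) * (1 + a) ^ 3 := by
          have h1 : 0 ≤ A * (2 + 5 * a + 6 * a ^ 2 + a ^ 3) := by positivity
          have h2 : 0 ≤ 3 * a + 3 * a ^ 2 + a ^ 3 := by positivity
          nlinarith
      _ ≤ _ := mul_le_mul_of_nonneg_right (by nlinarith) (by positivity)
  have h1 : 1 ≤ s * ε * (1 + a) ^ 2 := by
    have h2 : δ ^ 2 ≤ (s * a) ^ 2 := by gcongr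
    have hε : 0 < ε := by
      by_contra h
      have : ε * δ ^ 2 ≤ 0 := mul_nonpos_of_nonpos_of_nonneg (not_lt.1 h) (by positivity)
      linarith
    have h3 : s * δ ^ 2 ≤ δ ^ 2 * (s * ε * a ^ 2) := by
      calc s * δ ^ 2 ≤ s * (s * a) ^ 2 := by gcongr
        _ = s * s * (s * a ^ 2) := by ring
        _ ≤ s * 1 * (s * a ^ 2) := by gcongr
        _ = s * (s * a ^ 2) := by ring
        _ ≤ (ε * δ ^ 2) * (s * a ^ 2) := by gcongr
        _ = _ := by ring
    have h4 : δ ^ 2 * 1 ≤ δ ^ 2 * (s * ε * a ^ 2) := by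
      calc δ ^ 2 * 1 ≤ (s * a) ^ 2 := by linarith
        _ = s * (s * a ^ 2) := by ring
        _ ≤ (ε * δ ^ 2) * (s * a ^ 2) := by gcongr
        _ = _ := by ring
    have h5 := le_of_mul_le_mul_left h4 (by positivity)
    refine h5.trans ?_
    gcongr
    linarith
  rw [abs_mul, abs_of_pos hφ]
  have hE : φ ≤ Real.exp (M * a - c / 2 * a ^ 2) := hφ'.trans (Real.exp_le_exp.2 (by
    have : 0 ≤ c * a ^ 2 := by positivity
    linarith))
  calc |1 + s * (T + g)| * φ
      ≤ 1 * ((2 * (A + 1) ^ 2 + 2) * (1 + a) ^ 3 * Real.exp (M * a - c / 2 * a ^ 2)) := by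
        rw [one_mul]
        gcongr
    _ ≤ s * ε * (1 + a) ^ 2 * ((2 * (A + 1) ^ 2 + 2) * (1 + a) ^ 4 *
          Real.exp (M * a - c / 2 * a ^ 2)) := by
        gcongr
        · linarith
        · norm_num
    _ = _ := by ring

/-- The first-order correction `K[u,u,u]/6 + ρ·u` to the Gaussian approximation. -/
noncomputable def correction (k : Fin p → Fin p → Fin p → ℝ) (ρ u : Param p) : ℝ :=
  cubic k u / 6 + ρ ⬝ᵥ u

lemma polyGrowth_correction (k : Fin p → Fin p → Fin p → ℝ) (ρ : Param p) :
    PolyGrowth (correction k ρ) := by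
  have h1 : PolyGrowth (cubic k) :=
    PolyGrowth.sum Finset.univ (q := fun r u => ∑ s, ∑ t, k r s t * (u r * u s * u t)) fun r =>
    PolyGrowth.sum Finset.univ (q := fun s u => ∑ t, k r s t * (u r * u s * u t)) fun s =>
    PolyGrowth.sum Finset.univ (q := fun t u => k r s t * (u r * u s * u t)) fun t =>
      (PolyGrowth.const _).mul (((PolyGrowth.coord r).mul (PolyGrowth.coord s)).mul
        (PolyGrowth.coord t))
  have h2 : PolyGrowth fun u : Param p => ρ ⬝ᵥ u :=
    PolyGrowth.sum Finset.univ (q := fun r u => ρ r * u r) fun r =>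
      (PolyGrowth.const _).mul (PolyGrowth.coord r)
  unfold correction
  simp only [div_eq_mul_inv]
  exact (h1.mul (PolyGrowth.const 6⁻¹)).add h2

/-- Laplace's expansion with relative error `o(s)`, in the rescaled variable. -/
lemma laplace_scaled {ι : Type*} {L : Filter ι} {s : ι → ℝ} {z : ι → Param p}
    {B : ι → Matrix (Fin p) (Fin p) ℝ} {k : Fin p → Fin p → Fin p → ℝ} {ρ : Param p}
    {U : ι → Param p → ℝ} {M c : ℝ} (hs0 : ∀ᶠ i in L, 0 < s i) (hs : Tendsto s L (𝓝 0))
    (hc : 0 < c) (hz : ∀ᶠ i in L, p * ‖z i‖ ≤ M)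
    (hB : ∀ᶠ i in L, ∀ u, 2 * c * ‖u‖ ^ 2 ≤ u ⬝ᵥ (B i).mulVec u)
    (hU0 : ∀ᶠ i in L, ∀ u, 0 ≤ U i u) (hint : ∀ᶠ i in L, Integrable (U i))
    (hint' : ∀ᶠ i in L, Integrable fun u => ‖u‖ * U i u)
    (hloc : ∀ δ : ℝ, 0 < δ → (fun i => ∫ u in {u | δ ≤ s i * ‖u‖}, ‖u‖ * U i u) =o[L] s)
    (hexp : ∀ ε : ℝ, 0 < ε → ∃ δ : ℝ, 0 < δ ∧ ∀ᶠ i in L, ∀ u : Param p, s i * ‖u‖ < δ →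
      ∃ e e' : ℝ, |e| ≤ ε * ‖u‖ ^ 3 ∧ |e'| ≤ ε * ‖u‖ ∧
        U i u = gaussKernel (z i) (B i) u * Real.exp (s i * (cubic k u / 6 + e)) *
          (1 + s i * (ρ ⬝ᵥ u + e')))
    {q : Param p → ℝ} (hq : PolyGrowth q) (hq1 : ∀ u, |q u| ≤ 1 + ‖u‖) :
    (fun i => (∫ u, q u * U i u) -
      ∫ u, q u * (1 + s i * correction k ρ u) * gaussKernel (z i) (B i) u) =o[L] s := by
  obtain ⟨A₁, hA₁, hk⟩ := exists_abs_cubic_le k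
  set A : ℝ := max A₁ (p * ‖ρ‖) with hAdef
  have hA : 0 ≤ A := hA₁.trans (le_max_left _ _)
  have hT : ∀ u, |cubic k u / 6| ≤ A * ‖u‖ ^ 3 := by
    intro u
    rw [abs_div, abs_of_pos (by norm_num : (0 : ℝ) < 6)]
    have h1 := hk u
    have h2 : A₁ * ‖u‖ ^ 3 ≤ A * ‖u‖ ^ 3 := by
      gcongr
      exact le_max_left _ _
    have h3 := abs_nonneg (cubic k u)
    linarith
  have hg : ∀ u, |ρ ⬝ᵥ u| ≤ A * ‖u‖ := fun u =>
    (abs_dotProduct_le ρ u).trans (by gcongr; exact le_max_right _ _)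
  set C₀ : ℝ := 2 * (A + 1) ^ 2 + 2 with hC₀
  -- Six powers from the pointwise bounds and one from $|q(u)|\le1+\|u\|$.
  set G : Param p → ℝ := fun u => (1 + ‖u‖) ^ 7 * Real.exp (M * ‖u‖ - c / 2 * ‖u‖ ^ 2) with hG
  have hGint : Integrable G := integrable_envelope M (half_pos hc) 7
  have hG0 : 0 ≤ ∫ u, G u := integral_nonneg fun u => by positivity
  have hC0pos : 0 < C₀ := by positivity
  rw [isLittleO_iff]
  intro η hη
  -- The Gaussian error then integrates to at most $s\eta/2$; the far part of the posterior, with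
  -- its factor $2$ and tolerance $\eta/4$, gives the other half.
  set ε : ℝ := min 1 (η / (2 * (C₀ * (∫ u, G u) + 1))) with hε
  have hε0 : 0 < ε := lt_min one_pos (by positivity)
  have hεη : ε * (C₀ * ∫ u, G u) ≤ η / 2 := by
    have h1 : ε ≤ η / (2 * (C₀ * (∫ u, G u) + 1)) := min_le_right _ _
    rw [le_div_iff₀ (by positivity)] at h1
    linarith
  obtain ⟨δ₀, hδ₀, hexp⟩ := hexp ε hε0
  set δ : ℝ := min δ₀ (c / 2 / (A + 1)) with hδdef
  have hδ : 0 < δ := lt_min hδ₀ (by positivity)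
  have hδA : (A + 1) * δ ≤ c / 2 := by
    have h1 : δ ≤ c / 2 / (A + 1) := min_le_right _ _
    rw [le_div_iff₀ (by positivity)] at h1
    linarith
  have hsmall : ∀ a : ℝ, 0 < a → ∀ᶠ i in L, s i ≤ a := fun a ha =>
    (hs.eventually (gt_mem_nhds ha)).mono fun i hi => le_of_lt hi
  filter_upwards [hs0, hz, hB, hU0, hint, hint', hexp,
    isLittleO_iff.1 (hloc δ hδ) (by positivity : 0 < η / 4), hsmall ε hε0,
    hsmall (ε * δ ^ 2) (by positivity), hsmall δ hδ] with i hs0 hz hB hU0 hint hint' hexp hloc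
    hsε hsδ hsδ'
  have hs1 : s i ≤ 1 := hsε.trans (min_le_left _ _)
  set φ := gaussKernel (z i) (B i) with hφ
  set far : Set (Param p) := {u | δ ≤ s i * ‖u‖} with hfar
  have hmeas : MeasurableSet far :=
    (isClosed_le continuous_const (continuous_const.mul continuous_norm)).measurableSet
  have hqP : PolyGrowth fun u => q u * (1 + s i * correction k ρ u) :=
    hq.mul ((PolyGrowth.const 1).add ((PolyGrowth.const (s i)).mul (polyGrowth_correction k ρ)))
  have hqPint := hqP.integrable (z := z i) hc hB
  have hUint : Integrable fun u => q u * U i u := by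
    refine (hint.add hint').mono' (hq.1.aestronglyMeasurable.mul hint.1)
      (Eventually.of_forall fun u => ?_)
    rw [norm_mul, Real.norm_eq_abs, Real.norm_of_nonneg (hU0 u), Pi.add_apply]
    calc |q u| * U i u ≤ (1 + ‖u‖) * U i u := mul_le_mul_of_nonneg_right (hq1 u) (hU0 u)
      _ = _ := by ring
  rw [← integral_sub hUint hqPint]
  have hpt : ∀ u, ‖q u * U i u - q u * (1 + s i * correction k ρ u) * φ u‖ ≤
      s i * ε * C₀ * G u + 2 * far.indicator (fun u => ‖u‖ * U i u) u := by
    intro u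
    have hφle := gaussKernel_le hz hB u
    have hGu : (1 + ‖u‖) * ((1 + ‖u‖) ^ 6 * Real.exp (M * ‖u‖ - c / 2 * ‖u‖ ^ 2)) = G u := by
      simp only [hG]; ring
    by_cases hu : u ∈ far
    · have h1 := abs_laplace_far (gaussKernel_pos (z i) (B i) u) hφle hc.le (norm_nonneg u) hA hs0
        hs1 hδ hsδ hu (hT u) (hg u)
      -- Since $s\le\delta$, the far region lies outside the open unit ball. There
      -- $1+\|u\|\le2\|u\|$, so the hypothesis on $\int\|u\|U$ controls the denominator as well as
      -- the numerator.
      have hu1 : 1 ≤ ‖u‖ := by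
        have h2 : δ ≤ s i * ‖u‖ := hu
        have h3 : s i * 1 ≤ s i * ‖u‖ := by linarith
        exact le_of_mul_le_mul_left h3 hs0
      rw [Set.indicator_of_mem hu]
      calc ‖q u * U i u - q u * (1 + s i * correction k ρ u) * φ u‖
          ≤ |q u| * U i u + |q u| * |(1 + s i * (cubic k u / 6 + ρ ⬝ᵥ u)) * φ u| := by
            refine (norm_sub_le _ _).trans (le_of_eq ?_)
            rw [mul_assoc, norm_mul, norm_mul, Real.norm_of_nonneg (hU0 u)]
            rfl
        _ ≤ (2 * ‖u‖) * U i u + (1 + ‖u‖) * (s i * ε * C₀ * ((1 + ‖u‖) ^ 6 *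
              Real.exp (M * ‖u‖ - c / 2 * ‖u‖ ^ 2))) := by
            gcongr
            · exact hU0 u
            · exact (hq1 u).trans (by linarith)
            · exact hq1 u
        _ = _ := by rw [← hGu]; ring
    · have hlt : s i * ‖u‖ < δ := not_le.1 hu
      obtain ⟨e, e', he, he', hUeq⟩ := hexp u (hlt.trans_le (min_le_left _ _))
      have h1 := abs_laplace_near (gaussKernel_pos (z i) (B i) u) hφle (norm_nonneg u) hA hs0
        hsε (min_le_left _ _) hlt.le hδA (hT u) (hg u) he he'
      rw [Set.indicator_of_notMem hu, mul_zero, add_zero, mul_assoc (q u), ← mul_sub, norm_mul,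
        Real.norm_eq_abs, Real.norm_eq_abs, hUeq]
      calc _ ≤ (1 + ‖u‖) * (s i * ε * C₀ * ((1 + ‖u‖) ^ 6 *
              Real.exp (M * ‖u‖ - c / 2 * ‖u‖ ^ 2))) := by
            refine mul_le_mul (hq1 u) ?_ (abs_nonneg _) (by positivity)
            exact h1
        _ = _ := by rw [← hGu]; ring
  have hind : Integrable (far.indicator fun u => ‖u‖ * U i u) := hint'.indicator hmeas
  refine (norm_integral_le_of_norm_le ((hGint.const_mul _).add (hind.const_mul 2))
    (Eventually.of_forall hpt)).trans ?_
  simp only [Pi.add_apply]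
  rw [integral_add (hGint.const_mul _) (hind.const_mul 2), integral_const_mul, integral_const_mul,
    integral_indicator hmeas]
  rw [Real.norm_eq_abs, Real.norm_of_nonneg hs0.le] at hloc
  rw [Real.norm_of_nonneg hs0.le]
  have h5 := (le_abs_self _).trans hloc
  have h6 := mul_le_mul_of_nonneg_left hεη hs0.le
  linarith

end Laplace

/-! ### Uniform bounds for families of Gaussian kernels. -/

section GaussianLimit

variable {p : ℕ} {ι : Type*} {L : Filter ι}

lemma isBigO_mulVec {A : ι → Matrix (Fin p) (Fin p) ℝ} {x : ι → Param p} {f g : ι → ℝ}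
    (hA : ∀ r t, (fun i => A i r t) =O[L] f) (hx : x =O[L] g) :
    (fun i => (A i).mulVec (x i)) =O[L] fun i => f i * g i :=
  isBigO_pi.2 fun r =>
    IsBigO.fun_sum (s := Finset.univ) (A := fun t i => A i r t * x i t) fun t _ =>
    (hA r t).mul (isBigO_pi.1 hx t)

lemma isLittleO_mulVec {A : ι → Matrix (Fin p) (Fin p) ℝ} {x : ι → Param p} {f g : ι → ℝ}
    (hA : ∀ r t, (fun i => A i r t) =O[L] f) (hx : x =o[L] g) :
    (fun i => (A i).mulVec (x i)) =o[L] fun i => f i * g i :=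
  isLittleO_pi.2 fun r =>
    IsLittleO.fun_sum (s := Finset.univ) (A := fun t i => A i r t * x i t) fun t _ =>
    (hA r t).mul_isLittleO (isLittleO_pi.1 hx t)

lemma isBigO_const_mulVec (A : Matrix (Fin p) (Fin p) ℝ) {x : ι → Param p} {g : ι → ℝ}
    (hx : x =O[L] g) : (fun i => A.mulVec (x i)) =O[L] g := by
  simpa using isBigO_mulVec (A := fun _ => A) (f := fun _ => 1)
    (fun r t => isBigO_const_const _ one_ne_zero _) hx

lemma isLittleO_const_mulVec (A : Matrix (Fin p) (Fin p) ℝ) {x : ι → Param p} {g : ι → ℝ}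
    (hx : x =o[L] g) : (fun i => A.mulVec (x i)) =o[L] g := by
  simpa using isLittleO_mulVec (A := fun _ => A) (f := fun _ => 1)
    (fun r t => isBigO_const_const _ one_ne_zero _) hx

/-- The total mass of the Gaussian density. -/
noncomputable def gaussMass (z : Param p) (B : Matrix (Fin p) (Fin p) ℝ) : ℝ :=
  ∫ u, gaussKernel z B u

/-- Gaussian densities `exp(z·u - ½ uᵀBu)` with bounded `z`, and with `B = H + O(s)`. -/
structure GaussianFamily (L : Filter ι) (s : ι → ℝ) (z : ι → Param p)
    (B : ι → Matrix (Fin p) (Fin p) ℝ) (H : Matrix (Fin p) (Fin p) ℝ) (M c : ℝ) : Prop where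
  s_pos : ∀ᶠ i in L, 0 < s i
  s_tendsto : Tendsto s L (𝓝 0)
  c_pos : 0 < c
  z_bound : ∀ᶠ i in L, p * ‖z i‖ ≤ M
  coercive : ∀ᶠ i in L, ∀ u, 2 * c * ‖u‖ ^ 2 ≤ u ⬝ᵥ (B i).mulVec u
  symm : ∀ᶠ i in L, (B i).IsSymm
  sub_isBigO : ∀ r t, (fun i => B i r t - H r t) =O[L] s
  isUnit : IsUnit H

variable {s : ι → ℝ} {z : ι → Param p} {B : ι → Matrix (Fin p) (Fin p) ℝ}
  {H : Matrix (Fin p) (Fin p) ℝ} {M c : ℝ}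

namespace GaussianFamily

lemma inv_mulVec_mulVec (h : GaussianFamily L s z B H M c) (x : Param p) :
    H⁻¹.mulVec (H.mulVec x) = x := by
  rw [Matrix.mulVec_mulVec, Matrix.nonsing_inv_mul _ ((Matrix.isUnit_iff_isUnit_det H).1 h.isUnit),
    Matrix.one_mulVec]

lemma mulVec_inv_mulVec (h : GaussianFamily L s z B H M c) (x : Param p) :
    H.mulVec (H⁻¹.mulVec x) = x := by
  rw [Matrix.mulVec_mulVec, Matrix.mul_nonsing_inv _ ((Matrix.isUnit_iff_isUnit_det H).1 h.isUnit),
    Matrix.one_mulVec]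

lemma s_isLittleO (h : GaussianFamily L s z B H M c) : s =o[L] fun _ => (1 : ℝ) :=
  (isLittleO_one_iff ℝ).2 h.s_tendsto

lemma B_isBigO (h : GaussianFamily L s z B H M c) (r t : Fin p) :
    (fun i => B i r t) =O[L] fun _ => (1 : ℝ) := by
  simpa using ((h.sub_isBigO r t).trans h.s_isLittleO.isBigO).add
    (isBigO_const_const (H r t) (one_ne_zero (α := ℝ)) L)

lemma z_isBigO (h : GaussianFamily L s z B H M c) : z =O[L] fun _ => (1 : ℝ) := by
  -- For $p=0$ the bound on $p\|z\|$ carries no information, but then $z=0$.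
  rcases Nat.eq_zero_or_pos p with rfl | hp
  · exact IsBigO.of_bound 0 (Eventually.of_forall fun i => by simp [Subsingleton.elim (z i) 0])
  · refine IsBigO.of_bound M (h.z_bound.mono fun i hi => ?_)
    rw [norm_one, mul_one]
    have h1 : (1 : ℝ) ≤ p := by exact_mod_cast hp
    nlinarith [norm_nonneg (z i)]

/-- The integrable envelope depends only on $M$ and $c$, so it dominates all members of the family
at once. -/
lemma integral_isBigO (h : GaussianFamily L s z B H M c) {q : Param p → ℝ} (hq : PolyGrowth q) :
    (fun i => ∫ u, q u * gaussKernel (z i) (B i) u) =O[L] fun _ => (1 : ℝ) := by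
  obtain ⟨_, C, k, hC⟩ := hq
  refine IsBigO.of_bound
    (∫ u : Param p, C * ((1 + ‖u‖) ^ k * Real.exp (M * ‖u‖ - c * ‖u‖ ^ 2))) ?_
  filter_upwards [h.z_bound, h.coercive] with i hz hB
  rw [norm_one, mul_one]
  refine norm_integral_le_of_norm_le ((integrable_envelope M h.c_pos k).const_mul C)
    (Eventually.of_forall fun u => ?_)
  rw [norm_mul, Real.norm_eq_abs, Real.norm_of_nonneg (gaussKernel_pos _ _ u).le, ← mul_assoc]
  exact mul_le_mul (hC u) (gaussKernel_le hz hB u) (gaussKernel_pos _ _ u).le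
    ((abs_nonneg _).trans (hC u))

/-- On the unit ball the exponent is bounded below uniformly, because $z$ and the entries of $B$ are
bounded. This allows division by the mass. -/
lemma exists_le_integral (h : GaussianFamily L s z B H M c) :
    ∃ a : ℝ, 0 < a ∧ ∀ᶠ i in L, a ≤ gaussMass (z i) (B i) := by
  have h1 : ∀ r, ∃ C : ℝ, ∀ᶠ i in L, ∀ t, |B i r t| ≤ C := by
    intro r
    obtain ⟨C, hC⟩ := (isBigO_pi.2 (h.B_isBigO r)).bound
    refine ⟨C, hC.mono fun i hi t => ?_⟩
    rw [norm_one, mul_one] at hi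
    exact (norm_le_pi_norm (fun t => B i r t) t).trans hi
  choose C hC using h1
  set K : ℝ := M + ∑ r, ∑ _t : Fin p, C r with hK
  refine ⟨Real.exp (-K) * volume.real (Metric.ball (0 : Param p) 1), ?_, ?_⟩
  · have := Metric.measure_ball_pos (volume : Measure (Param p)) 0 one_pos
    have h2 : 0 < volume.real (Metric.ball (0 : Param p) 1) :=
      ENNReal.toReal_pos this.ne' measure_ball_lt_top.ne
    positivity
  · filter_upwards [h.z_bound, h.coercive, eventually_all.2 hC] with i hz hB hC
    have hint : Integrable (gaussKernel (z i) (B i)) := by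
      simpa using (PolyGrowth.const 1).integrable (z := z i) h.c_pos hB
    calc Real.exp (-K) * volume.real (Metric.ball (0 : Param p) 1)
        = ∫ _u in Metric.ball (0 : Param p) 1, Real.exp (-K) := by
          rw [setIntegral_const, smul_eq_mul, mul_comm]
      _ ≤ ∫ u in Metric.ball (0 : Param p) 1, gaussKernel (z i) (B i) u := by
          refine setIntegral_mono_on (integrableOn_const measure_ball_lt_top.ne)
            hint.integrableOn measurableSet_ball fun u hu => Real.exp_le_exp.2 ?_
          have hu1 : ‖u‖ ≤ 1 := (mem_ball_zero_iff.1 hu).le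
          have h3 : -(z i ⬝ᵥ u) ≤ M := by
            refine (neg_le_abs _).trans ((abs_dotProduct_le _ _).trans ?_)
            exact (mul_le_of_le_one_right (by positivity) hu1).trans hz
          have hn : ∀ r, |u r| ≤ 1 := fun r => (norm_le_pi_norm u r).trans hu1
          have h4 : u ⬝ᵥ (B i).mulVec u ≤ ∑ r, ∑ _t : Fin p, C r := by
            refine Finset.sum_le_sum fun r _ => (le_abs_self _).trans ?_
            rw [abs_mul]
            refine (mul_le_of_le_one_left (abs_nonneg _) (hn r)).trans ?_
            refine (Finset.abs_sum_le_sum_abs (fun t => B i r t * u t) Finset.univ).trans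
              (Finset.sum_le_sum fun t _ => ?_)
            rw [abs_mul]
            exact (mul_le_of_le_one_right (abs_nonneg _) (hn t)).trans (hC r t)
          have h5 : 0 ≤ u ⬝ᵥ (B i).mulVec u := le_trans (by have := h.c_pos; positivity) (hB u)
          linarith
      _ ≤ ∫ u, gaussKernel (z i) (B i) u :=
          setIntegral_le_integral hint (Eventually.of_forall fun u => (gaussKernel_pos _ _ u).le)

/-- Solutions of `B x = y` are close to solutions of `H x = y`. -/
lemma sub_inv_mulVec (h : GaussianFamily L s z B H M c) {x y : ι → Param p}
    {f : ι → ℝ} (hx : x =O[L] fun _ => (1 : ℝ))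
    (he : (fun i => (B i).mulVec (x i) - y i) =O[L] f) (hs : s =O[L] f) :
    (fun i => x i - H⁻¹.mulVec (y i)) =O[L] f := by
  have h1 : (fun i => (B i - H).mulVec (x i)) =O[L] f := by
    refine IsBigO.trans (isBigO_mulVec (A := fun i => B i - H) h.sub_isBigO hx) ?_
    simpa using hs
  refine (isBigO_const_mulVec H⁻¹ (he.sub h1)).congr_left fun i => ?_
  rw [Matrix.sub_mulVec, sub_sub_sub_cancel_left, Matrix.mulVec_sub, h.inv_mulVec_mulVec]

end GaussianFamily

end GaussianLimit

/-! ### Expansion of the mean of a corrected Gaussian density. -/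

section MeanExpansion

variable {p : ℕ} {ι : Type*} {L : Filter ι} {s : ι → ℝ} {z : ι → Param p}
  {B : ι → Matrix (Fin p) (Fin p) ℝ} {H : Matrix (Fin p) (Fin p) ℝ} {M c : ℝ}

lemma hasLineDerivAt_coord (u : Param p) (r v : Fin p) :
    HasLineDerivAt ℝ (fun u : Param p => u r) ((Pi.single v 1 : Param p) r) u (Pi.single v 1) := by
  unfold HasLineDerivAt
  simpa using ((hasDerivAt_id (0 : ℝ)).mul_const ((Pi.single v 1 : Param p) r)).const_add (u r)

/-- The quadratic form `∑ k_{rtv} S_{rt}`, as a vector. -/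
def contract (k : Fin p → Fin p → Fin p → ℝ) (S : Fin p → Fin p → ℝ) : Param p :=
  fun v => ∑ r, ∑ t, k r t v * S r t

/-- The product rule gives three sums, which coincide by the full symmetry of $k$. -/
lemma hasLineDerivAt_cubic {k : Fin p → Fin p → Fin p → ℝ} (hk₁ : ∀ r s t, k r s t = k s r t)
    (hk₂ : ∀ r s t, k r s t = k r t s) (u : Param p) (v : Fin p) :
    HasLineDerivAt ℝ (cubic k) (3 * contract k (fun r t => u r * u t) v) u (Pi.single v 1) := by
  have h : HasLineDerivAt ℝ (cubic k) (∑ r, ∑ s, ∑ t, k r s t *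
      (((Pi.single v 1 : Param p) r * u s + u r * (Pi.single v 1 : Param p) s) * u t +
        u r * u s * (Pi.single v 1 : Param p) t)) u (Pi.single v 1) := by
    unfold HasLineDerivAt cubic
    refine HasDerivAt.fun_sum fun r _ => HasDerivAt.fun_sum fun s _ => HasDerivAt.fun_sum fun t _ =>
      HasDerivAt.const_mul _ ?_
    have hd := fun r => hasLineDerivAt_coord u r v
    unfold HasLineDerivAt at hd
    simpa using ((hd r).fun_mul (hd s)).fun_mul (hd t)
  convert h using 1
  simp only [add_mul, mul_add, Finset.sum_add_distrib, contract]
  have e1 : ∑ r, ∑ s, ∑ t, k r s t * ((Pi.single v 1 : Param p) r * u s * u t) =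
      ∑ r, ∑ t, k r t v * (u r * u t) := by
    rw [Finset.sum_comm]
    refine Finset.sum_congr rfl fun s _ => ?_
    rw [Finset.sum_comm]
    refine Finset.sum_congr rfl fun t _ => ?_
    rw [Finset.sum_eq_single v (fun b _ hb => by simp [hb]) (by simp), hk₁ v s t, hk₂ s v t]
    simp
  have e2 : ∑ r, ∑ s, ∑ t, k r s t * (u r * (Pi.single v 1 : Param p) s * u t) =
      ∑ r, ∑ t, k r t v * (u r * u t) := by
    refine Finset.sum_congr rfl fun r _ => ?_
    rw [Finset.sum_comm]
    refine Finset.sum_congr rfl fun t _ => ?_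
    rw [Finset.sum_eq_single v (fun b _ hb => by simp [hb]) (by simp), hk₂ r v t]
    simp
  have e3 : ∑ r, ∑ s, ∑ t, k r s t * (u r * u s * (Pi.single v 1 : Param p) t) =
      ∑ r, ∑ t, k r t v * (u r * u t) := by
    refine Finset.sum_congr rfl fun r _ => Finset.sum_congr rfl fun s _ => ?_
    rw [Finset.sum_eq_single v (fun b _ hb => by simp [hb]) (by simp)]
    simp
  rw [e1, e2, e3]
  ring

lemma hasLineDerivAt_correction {k : Fin p → Fin p → Fin p → ℝ} (hk₁ : ∀ r s t, k r s t = k s r t)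
    (hk₂ : ∀ r s t, k r s t = k r t s) (ρ u : Param p) (v : Fin p) :
    HasLineDerivAt ℝ (correction k ρ) (1 / 2 * contract k (fun r t => u r * u t) v + ρ v) u
      (Pi.single v 1) := by
  have h1 := hasLineDerivAt_cubic hk₁ hk₂ u v
  have h2 : HasLineDerivAt ℝ (fun u : Param p => ρ ⬝ᵥ u) (ρ v) u (Pi.single v 1) := by
    unfold HasLineDerivAt
    simpa [dotProduct_add, dotProduct_smul] using
      ((hasDerivAt_id (0 : ℝ)).mul_const (ρ v)).const_add (ρ ⬝ᵥ u)
  unfold HasLineDerivAt at *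
  unfold correction
  refine ((h1.div_const 6).fun_add h2).congr_deriv ?_
  ring

/-- The linear term of the expansion of the posterior mean. -/
noncomputable def linearTerm (k : Fin p → Fin p → Fin p → ℝ) (ρ : Param p)
    (H : Matrix (Fin p) (Fin p) ℝ) (m : Param p) : Param p :=
  ρ + (1 / 2 : ℝ) • contract k fun r t => m r * m t + H⁻¹ r t

namespace GaussianFamily

/-- Integration by parts with $q=1$. Moments are kept as solutions of linear systems with matrix
$B$, so $B^{-1}$ never appears. -/
lemma mean_eq (h : GaussianFamily L s z B H M c) : ∀ᶠ i in L,
    (B i).mulVec (fun r => ∫ u, u r * gaussKernel (z i) (B i) u) = gaussMass (z i) (B i) • z i := by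
  filter_upwards [h.coercive, h.symm] with i hB hs
  ext v
  have := integral_mulVec_mul_gaussKernel (z := z i) hs h.c_pos hB (PolyGrowth.const 1)
    (PolyGrowth.const 0) v (fun u => by unfold HasLineDerivAt; exact hasDerivAt_const _ _)
  simp only [one_mul, zero_mul, integral_zero, add_zero] at this
  rw [Pi.smul_apply, smul_eq_mul, mul_comm]
  exact this

lemma second_moment_eq (h : GaussianFamily L s z B H M c) (t : Fin p) : ∀ᶠ i in L,
    (B i).mulVec (fun r => ∫ u, u t * u r * gaussKernel (z i) (B i) u) =
      (∫ u, u t * gaussKernel (z i) (B i) u) • z i + gaussMass (z i) (B i) • Pi.single t 1 := by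
  filter_upwards [h.coercive, h.symm] with i hB hs
  ext v
  have := integral_mulVec_mul_gaussKernel (z := z i) hs h.c_pos hB (PolyGrowth.coord t)
    (PolyGrowth.const _) v (fun u => hasLineDerivAt_coord u t v)
  rw [integral_const_mul, Pi.single_comm] at this
  rw [Pi.add_apply, Pi.smul_apply, Pi.smul_apply, smul_eq_mul, smul_eq_mul, mul_comm,
    mul_comm (gaussMass (z i) (B i))]
  exact this

lemma inv_mass_isBigO (h : GaussianFamily L s z B H M c) :
    (fun i => (gaussMass (z i) (B i))⁻¹) =O[L] fun _ => (1 : ℝ) := by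
  obtain ⟨a, ha, hle⟩ := h.exists_le_integral
  refine IsBigO.of_bound a⁻¹ (hle.mono fun i hi => ?_)
  rw [norm_one, mul_one, norm_inv, Real.norm_of_nonneg (ha.le.trans hi)]
  exact inv_anti₀ ha hi

/-- The normalized mean solves $Bx=z$ and is bounded, so replacing $B$ by $H$ costs $O(s)$. -/
lemma mean_sub_isBigO (h : GaussianFamily L s z B H M c) :
    (fun i => (gaussMass (z i) (B i))⁻¹ • (fun r => ∫ u, u r * gaussKernel (z i) (B i) u) -
      H⁻¹.mulVec (z i)) =O[L] s := by
  obtain ⟨a, ha, hle⟩ := h.exists_le_integral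
  refine h.sub_inv_mulVec ?_ ?_ (isBigO_refl _ _)
  · simpa using h.inv_mass_isBigO.smul
      (isBigO_pi.2 fun r => h.integral_isBigO (PolyGrowth.coord r))
  · refine EventuallyEq.trans_isBigO ?_ (isBigO_zero _ _)
    filter_upwards [h.mean_eq, hle] with i hi hle
    rw [Matrix.mulVec_smul, hi, inv_smul_smul₀ (ha.trans_le hle).ne', sub_self]

lemma inv_mulVec_isBigO (h : GaussianFamily L s z B H M c) :
    (fun i => H⁻¹.mulVec (z i)) =O[L] fun _ => (1 : ℝ) :=
  isBigO_const_mulVec _ h.z_isBigO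

/-- As for the mean, with the system obtained from $q(u)=u_t$. Its right-hand side contains the mean
itself, which is then replaced by $H^{-1}z$ with another error $O(s)$. -/
lemma second_moment_sub_isBigO (h : GaussianFamily L s z B H M c) (r t : Fin p) :
    (fun i => (gaussMass (z i) (B i))⁻¹ * (∫ u, u r * u t * gaussKernel (z i) (B i) u) -
      (H⁻¹.mulVec (z i) r * H⁻¹.mulVec (z i) t + H⁻¹ r t)) =O[L] s := by
  obtain ⟨a, ha, hle⟩ := h.exists_le_integral
  have h1 : (fun i => (gaussMass (z i) (B i))⁻¹ •
      (fun r => ∫ u, u t * u r * gaussKernel (z i) (B i) u) - H⁻¹.mulVec (((gaussMass (z i) (B i))⁻¹ * ∫ u, u t * gaussKernel (z i) (B i) u) • z i +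
        Pi.single t 1)) =O[L] s := by
    refine h.sub_inv_mulVec ?_ ?_ (isBigO_refl _ _)
    · simpa using h.inv_mass_isBigO.smul (isBigO_pi.2 fun r =>
        h.integral_isBigO ((PolyGrowth.coord t).mul (PolyGrowth.coord r)))
    · refine EventuallyEq.trans_isBigO ?_ (isBigO_zero _ _)
      filter_upwards [h.second_moment_eq t, hle] with i hi hle
      rw [Matrix.mulVec_smul, hi, smul_add, inv_smul_smul₀ (ha.trans_le hle).ne', smul_smul,
        sub_self]
  have h2 := isBigO_pi.1 h1 r
  have h3 : (fun i => ((gaussMass (z i) (B i))⁻¹ * (∫ u, u t * gaussKernel (z i) (B i) u) -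
      H⁻¹.mulVec (z i) t) * H⁻¹.mulVec (z i) r) =O[L] s := by
    simpa using (isBigO_pi.1 h.mean_sub_isBigO t).mul (isBigO_pi.1 h.inv_mulVec_isBigO r)
  refine (h2.add h3).congr_left fun i => ?_
  have h4 : ∀ u : Param p, u t * u r = u r * u t := fun u => mul_comm _ _
  simp only [Pi.sub_apply, Pi.smul_apply, smul_eq_mul, Matrix.mulVec_add, Matrix.mulVec_smul,
    Pi.add_apply, Matrix.mulVec_single_one, Matrix.col_apply, h4]
  ring

lemma mass_sub_isBigO (h : GaussianFamily L s z B H M c) {q Q : Param p → ℝ} (hq : PolyGrowth q)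
    (hQ : PolyGrowth Q) :
    (fun i => (∫ u, q u * (1 + s i * Q u) * gaussKernel (z i) (B i) u) -
      ∫ u, q u * gaussKernel (z i) (B i) u) =O[L] s := by
  have h1 : (fun i => s i * ∫ u, q u * Q u * gaussKernel (z i) (B i) u) =O[L] s := by
    simpa using (isBigO_refl s L).mul (h.integral_isBigO (hq.mul hQ))
  refine EventuallyEq.trans_isBigO ?_ h1
  filter_upwards [h.coercive] with i hB
  rw [sub_eq_iff_eq_add, add_comm, ← integral_const_mul,
    ← integral_add (hq.integrable h.c_pos hB) (((hq.mul hQ).integrable h.c_pos hB).const_mul _)]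
  exact integral_congr_ae (Eventually.of_forall fun u => by ring)

lemma linearTerm_isBigO (h : GaussianFamily L s z B H M c) (k : Fin p → Fin p → Fin p → ℝ)
    (ρ : Param p) :
    (fun i => linearTerm k ρ H (H⁻¹.mulVec (z i))) =O[L] fun _ => (1 : ℝ) := by
  have hm := isBigO_pi.1 h.inv_mulVec_isBigO
  refine (isBigO_const_const ρ one_ne_zero L).add (isBigO_pi.2 fun v =>
    IsBigO.const_mul_left (f := fun i => contract k (fun r t => H⁻¹.mulVec (z i) r *
      H⁻¹.mulVec (z i) t + H⁻¹ r t) v) ?_ (1 / 2))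
  refine IsBigO.fun_sum fun r _ => IsBigO.fun_sum fun t _ => IsBigO.const_mul_left ?_ _
  refine IsBigO.add ?_ (isBigO_const_const _ one_ne_zero L)
  simpa using (hm r).mul (hm t)

/-- The integrand is the $v$-th derivative of `correction` times the kernel. It is quadratic in $u$,
so its Gaussian mean involves only second moments, which are $mm^T+H^{-1}$ up to $O(s)$. -/
lemma integral_linearTerm_sub_isBigO (h : GaussianFamily L s z B H M c)
    (k : Fin p → Fin p → Fin p → ℝ) (ρ : Param p) :
    (fun i => ((gaussMass (z i) (B i))⁻¹ • fun v =>
      ∫ u, (1 / 2 * contract k (fun r t => u r * u t) v +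
      ρ v) * gaussKernel (z i) (B i) u) - linearTerm k ρ H (H⁻¹.mulVec (z i))) =O[L] s := by
  obtain ⟨a, ha, hle⟩ := h.exists_le_integral
  refine isBigO_pi.2 fun v => ?_
  have h1 : (fun i => 1 / 2 * ∑ r, ∑ t, k r t v *
      ((gaussMass (z i) (B i))⁻¹ * (∫ u, u r * u t * gaussKernel (z i) (B i) u) -
      (H⁻¹.mulVec (z i) r * H⁻¹.mulVec (z i) t + H⁻¹ r t))) =O[L] s :=
    IsBigO.const_mul_left (IsBigO.fun_sum fun r _ => IsBigO.fun_sum fun t _ =>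
      (h.second_moment_sub_isBigO r t).const_mul_left _) _
  refine EventuallyEq.trans_isBigO ?_ h1
  filter_upwards [h.coercive, hle] with i hB hle
  have hmass := (ha.trans_le hle).ne'
  have hint : ∀ r t, Integrable fun u : Param p =>
      k r t v * (u r * u t * gaussKernel (z i) (B i) u) := fun r t =>
    (((PolyGrowth.coord r).mul (PolyGrowth.coord t)).integrable h.c_pos hB).const_mul _
  have hφ : Integrable (gaussKernel (z i) (B i)) := by
    simpa using (PolyGrowth.const 1).integrable (z := z i) h.c_pos hB
  have h2 : ∫ u, (1 / 2 * contract k (fun r t => u r * u t) v + ρ v) * gaussKernel (z i) (B i) u =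
      1 / 2 * (∑ r, ∑ t, k r t v * ∫ u, u r * u t * gaussKernel (z i) (B i) u) +
        ρ v * gaussMass (z i) (B i) := by
    have h3 : ∀ u : Param p,
        (1 / 2 * contract k (fun r t => u r * u t) v + ρ v) * gaussKernel (z i) (B i) u =
        1 / 2 * (∑ r, ∑ t, k r t v * (u r * u t * gaussKernel (z i) (B i) u)) +
          ρ v * gaussKernel (z i) (B i) u := by
      intro u
      simp only [contract, add_mul, mul_assoc, Finset.sum_mul]
    simp only [h3]
    rw [integral_add ((integrable_finsetSum _ fun r _ => integrable_finsetSum _ fun t _ =>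
      hint r t).const_mul _) (hφ.const_mul _), integral_const_mul, integral_const_mul,
      integral_finsetSum _ fun r _ => integrable_finsetSum _ fun t _ => hint r t]
    congr 3
    ext r
    rw [integral_finsetSum _ fun t _ => hint r t]
    simp only [integral_const_mul]
  simp only [linearTerm, Pi.sub_apply, Pi.smul_apply, Pi.add_apply, smul_eq_mul]
  rw [h2]
  simp only [contract, mul_sub, Finset.sum_sub_distrib]
  have h4 : ∑ r, ∑ t, k r t v *
      ((gaussMass (z i) (B i))⁻¹ * ∫ u, u r * u t * gaussKernel (z i) (B i) u) =
      (gaussMass (z i) (B i))⁻¹ * ∑ r, ∑ t, k r t v *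
        ∫ u, u r * u t * gaussKernel (z i) (B i) u := by
    simp only [Finset.mul_sum]
    exact Finset.sum_congr rfl fun r _ => Finset.sum_congr rfl fun t _ => by ring
  rw [h4]
  field_simp
  ring

/-- Expansion of a ratio `N / D` of integrals against the corrected Gaussian density. -/
lemma ratio_expansion (h : GaussianFamily L s z B H M c) {k : Fin p → Fin p → Fin p → ℝ}
    (hk₁ : ∀ r s t, k r s t = k s r t) (hk₂ : ∀ r s t, k r s t = k r t s) {ρ : Param p}
    {D : ι → ℝ} {N : ι → Param p}
    (hD : (fun i => D i - ∫ u, (1 + s i * correction k ρ u) * gaussKernel (z i) (B i) u) =o[L] s)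
    (hN : ∀ r, (fun i => N i r -
      ∫ u, u r * (1 + s i * correction k ρ u) * gaussKernel (z i) (B i) u) =o[L] s) :
    (∀ᶠ i in L, 0 < D i) ∧
    (fun i => H.mulVec ((D i)⁻¹ • N i) - ((2 : ℝ) • z i - (B i).mulVec (H⁻¹.mulVec (z i)) +
      s i • linearTerm k ρ H (H⁻¹.mulVec (z i)))) =o[L] s := by
  obtain ⟨a, ha, hle⟩ := h.exists_le_integral
  have hQ := polyGrowth_correction k ρ
  have hDZ : (fun i => D i - gaussMass (z i) (B i)) =O[L] s := by
    have := hD.isBigO.add (h.mass_sub_isBigO (PolyGrowth.const 1) hQ)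
    simpa [gaussMass] using this
  have hDle : ∀ᶠ i in L, a / 2 ≤ D i := by
    have h1 := isLittleO_iff.1 (hDZ.trans_isLittleO h.s_isLittleO) (half_pos ha)
    filter_upwards [h1, hle] with i h1 hle
    rw [norm_one, mul_one, Real.norm_eq_abs] at h1
    have := neg_le_of_abs_le h1
    linarith
  have hDpos : ∀ᶠ i in L, 0 < D i := hDle.mono fun i hi => (half_pos ha).trans_le hi
  refine ⟨hDpos, ?_⟩
  have hDinv : (fun i => (D i)⁻¹) =O[L] fun _ => (1 : ℝ) := by
    refine IsBigO.of_bound (a / 2)⁻¹ (hDle.mono fun i hi => ?_)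
    rw [norm_one, mul_one, norm_inv, Real.norm_of_nonneg ((half_pos ha).le.trans hi)]
    exact inv_anti₀ (half_pos ha) hi
  have hNO : N =O[L] fun _ => (1 : ℝ) := by
    refine isBigO_pi.2 fun r => ?_
    have h1 := ((hN r).isBigO.add (h.mass_sub_isBigO (PolyGrowth.coord r) hQ)).trans
      h.s_isLittleO.isBigO
    simpa using h1.add (h.integral_isBigO (PolyGrowth.coord r))
  set X : ι → Param p := fun i r =>
    ∫ u, u r * (1 + s i * correction k ρ u) * gaussKernel (z i) (B i) u with hX
  set D' : ι → ℝ := fun i =>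
    ∫ u, (1 + s i * correction k ρ u) * gaussKernel (z i) (B i) u with hD'
  set G : ι → Param p := fun i v =>
    ∫ u, (1 / 2 * contract k (fun r t => u r * u t) v + ρ v) * gaussKernel (z i) (B i) u with hG
  have hpG : ∀ v, PolyGrowth fun u : Param p => 1 / 2 * contract k (fun r t => u r * u t) v + ρ v :=
    fun v => ((PolyGrowth.const _).mul (PolyGrowth.sum Finset.univ
      (q := fun r u => ∑ t, k r t v * (u r * u t)) fun r => PolyGrowth.sum Finset.univ
      (q := fun t u => k r t v * (u r * u t)) fun t =>
        (PolyGrowth.const _).mul ((PolyGrowth.coord r).mul (PolyGrowth.coord t)))).add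
      (PolyGrowth.const _)
  have hGO : G =O[L] fun _ => (1 : ℝ) := isBigO_pi.2 fun v => h.integral_isBigO (hpG v)
  -- Integration by parts with $q=1+sQ$; this identity is exact.
  have hibp : ∀ᶠ i in L, (B i).mulVec (X i) = D' i • z i + s i • G i := by
    filter_upwards [h.coercive, h.symm] with i hB hs
    ext v
    have h1 := integral_mulVec_mul_gaussKernel (z := z i) hs h.c_pos hB
      ((PolyGrowth.const 1).add ((PolyGrowth.const (s i)).mul hQ))
      ((PolyGrowth.const (s i)).mul (hpG v)) v (fun u => by
        have h2 := hasLineDerivAt_correction hk₁ hk₂ ρ u v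
        unfold HasLineDerivAt at *
        exact (h2.const_mul (s i)).const_add 1)
    simp only [mul_assoc (s i), integral_const_mul] at h1
    simp only [Pi.add_apply, Pi.smul_apply, smul_eq_mul, hG, hD', mul_comm _ (z i v)]
    rw [← h1]
    change ∑ r, B i v r * X i r = _
    refine Finset.sum_congr rfl fun r _ => ?_
    simp only [hX]
    congr 1
    exact integral_congr_ae (Eventually.of_forall fun u => by ring)
  have hBN : (fun i => (B i).mulVec (N i) - D i • z i - s i • G i) =o[L] s := by
    have hNX : (fun i => N i - X i) =o[L] s := isLittleO_pi.2 hN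
    have h1 : (fun i => (B i).mulVec (N i - X i)) =o[L] s := by
      simpa only [one_mul] using isLittleO_mulVec h.B_isBigO hNX
    have h2 : (fun i => (D i - D' i) • z i) =o[L] s := by
      simpa using hD.smul_isBigO h.z_isBigO
    refine EventuallyEq.trans_isLittleO ?_ (h1.sub h2)
    filter_upwards [hibp] with i hi
    rw [Matrix.mulVec_sub, hi]
    module
  set b : ι → Param p := fun i => (D i)⁻¹ • N i with hb
  set m : ι → Param p := fun i => H⁻¹.mulVec (z i) with hm
  have hbO : b =O[L] fun _ => (1 : ℝ) := by simpa using hDinv.smul hNO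
  -- Dividing by `D` instead of the pure Gaussian mass changes the result by $O(s)$, which is
  -- harmless because this term enters with a factor $s$.
  have hGg : (fun i => (D i)⁻¹ • G i - linearTerm k ρ H (m i)) =O[L] s := by
    have h1 : (fun i => ((D i)⁻¹ * (D i - gaussMass (z i) (B i)) *
        (gaussMass (z i) (B i))⁻¹) • G i) =O[L] s := by
      simpa using ((hDinv.mul hDZ).mul h.inv_mass_isBigO).smul hGO
    refine EventuallyEq.trans_isBigO ?_ ((h.integral_linearTerm_sub_isBigO k ρ).sub h1)
    filter_upwards [hDpos, hle] with i hi hle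
    have h2 : gaussMass (z i) (B i) ≠ 0 := (ha.trans_le hle).ne'
    have h3 : (D i)⁻¹ * (D i - gaussMass (z i) (B i)) * (gaussMass (z i) (B i))⁻¹ =
        (gaussMass (z i) (B i))⁻¹ - (D i)⁻¹ := by
      have := hi.ne'
      field_simp
    rw [h3]
    simp only [hG, hm]
    module
  have hBb : (fun i => (B i).mulVec (b i) - z i - s i • linearTerm k ρ H (m i)) =o[L] s := by
    have h1 : (fun i => (D i)⁻¹ • ((B i).mulVec (N i) - D i • z i - s i • G i)) =o[L] s := by
      simpa using hDinv.smul_isLittleO hBN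
    have h2 : (fun i => s i • ((D i)⁻¹ • G i - linearTerm k ρ H (m i))) =o[L] s := by
      simpa using h.s_isLittleO.smul_isBigO hGg
    refine EventuallyEq.trans_isLittleO ?_ (h1.add h2)
    filter_upwards [hDpos] with i hi
    rw [hb, Matrix.mulVec_smul, smul_sub, smul_sub, inv_smul_smul₀ hi.ne']
    module
  have hbm : (fun i => b i - m i) =O[L] s := by
    refine h.sub_inv_mulVec hbO ?_ (isBigO_refl _ _)
    have h1 : (fun i => s i • linearTerm k ρ H (m i)) =O[L] s := by
      simpa using (isBigO_refl s L).smul (h.linearTerm_isBigO k ρ)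
    simpa using hBb.isBigO.add h1
  -- This product is $O(s^2)$. Subtracting it from $Bb$ leaves $Hb+(B-H)m$, and $Hm=z$ turns
  -- $z-(B-H)m$ into $2z-Bm$.
  have hlast : (fun i => (B i - H).mulVec (b i - m i)) =o[L] s := by
    refine (isBigO_mulVec (A := fun i => B i - H) h.sub_isBigO hbm).trans_isLittleO ?_
    simpa using (isBigO_refl s L).mul_isLittleO h.s_isLittleO
  refine (hBb.sub hlast).congr_left fun i => ?_
  have h5 : H.mulVec (m i) = z i := h.mulVec_inv_mulVec (z i)
  rw [Matrix.sub_mulVec, Matrix.mulVec_sub, Matrix.mulVec_sub, h5]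
  module

end GaussianFamily

end MeanExpansion

/-! ### The posterior in the rescaled variable. -/

section Rescaling

variable {p : ℕ} {X : ℕ → Type*} [∀ i, MeasurableSpace (X i)]

lemma integral_comp_add_smul (F : Param p → ℝ) (θ : Param p) {s : ℝ} (hs : 0 < s) :
    ∫ u, F (θ + s • u) = (s ^ p)⁻¹ * ∫ ϑ, F ϑ := by
  have h := Measure.integral_comp_smul_of_nonneg (volume : Measure (Param p))
    (fun w => F (θ + w)) s (hR := hs.le)
  rw [h, integral_add_left_eq_self (fun ϑ => F ϑ) θ]
  simp

lemma Integrable.comp_add_smul {F : Param p → ℝ} (hF : Integrable F) (θ : Param p) {s : ℝ}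
    (hs : 0 < s) : Integrable fun u : Param p => F (θ + s • u) :=
  (hF.comp_add_left θ).comp_smul hs.ne'

namespace Model

variable (M : Model p X)

lemma measurableSet_Θ : MeasurableSet M.Θ :=
  MeasurableSet.univ_pi fun r => (M.side_ordConnected r).measurableSet

/-- The posterior density relative to its value at `θ`. -/
noncomputable def weight (π : Param p → ℝ) (θ : Param p) (n : ℕ) (x : Sample X n) : Param p → ℝ :=
  M.Θ.indicator fun ϑ => π ϑ * M.f n x ϑ / (π θ * M.f n x θ)

/-- The posterior is proper and has a mean. -/
def Proper (π : Param p → ℝ) (n : ℕ) (x : Sample X n) : Prop :=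
  IntegrableOn (fun ϑ => π ϑ * M.f n x ϑ) M.Θ ∧
    IntegrableOn (fun ϑ => ‖ϑ‖ * (π ϑ * M.f n x ϑ)) M.Θ

variable {M} {π : Param p → ℝ} {θ : Param p}

lemma weight_nonneg (hπ : ∀ ϑ ∈ M.Θ, 0 ≤ π ϑ) (hθ : θ ∈ interior M.Θ) (n : ℕ) (x : Sample X n)
    (ϑ : Param p) : 0 ≤ M.weight π θ n x ϑ := by
  refine Set.indicator_nonneg (fun ϑ hϑ => ?_) ϑ
  exact div_nonneg (mul_nonneg (hπ ϑ hϑ) (M.f_nonneg n x ϑ hϑ))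
    (mul_nonneg (hπ θ (interior_subset hθ)) (M.f_pos n x θ hθ).le)

lemma Proper.integrable_weight {n : ℕ} {x : Sample X n} (h : M.Proper π n x) (θ : Param p) :
    Integrable (M.weight π θ n x) :=
  (integrable_indicator_iff M.measurableSet_Θ).2 (h.1.div_const _)

lemma Proper.integrable_sub_smul {n : ℕ} {x : Sample X n} (h : M.Proper π n x) (θ : Param p) :
    IntegrableOn (fun ϑ => (π ϑ * M.f n x ϑ) • (ϑ - θ)) M.Θ := by
  have h1 : IntegrableOn (fun ϑ => (π ϑ * M.f n x ϑ) • ϑ) M.Θ := by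
    refine Integrable.mono h.2 (h.1.aestronglyMeasurable.smul aestronglyMeasurable_id)
      (Eventually.of_forall fun ϑ => ?_)
    simp [norm_smul, mul_comm]
  simp only [smul_sub]
  exact h1.sub (h.1.smul_const θ)

lemma Proper.integrable_sub_mul_weight {n : ℕ} {x : Sample X n} (h : M.Proper π n x)
    (θ : Param p) (r : Fin p) : Integrable fun ϑ => (ϑ - θ) r * M.weight π θ n x ϑ := by
  have h1 : IntegrableOn (fun ϑ => (π ϑ * M.f n x ϑ) * (ϑ - θ) r / (π θ * M.f n x θ)) M.Θ :=
    ((ContinuousLinearMap.proj (R := ℝ) (φ := fun _ : Fin p => ℝ) r).integrable_comp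
      (h.integrable_sub_smul θ)).div_const _
  refine ((integrable_indicator_iff M.measurableSet_Θ).2 h1).congr
    (Eventually.of_forall fun ϑ => ?_)
  by_cases hϑ : ϑ ∈ M.Θ
  · simp only [weight, Set.indicator_of_mem hϑ]
    ring
  · simp [weight, Set.indicator_of_notMem hϑ]

lemma Proper.integrable_norm_sub_mul_weight {n : ℕ} {x : Sample X n} (h : M.Proper π n x)
    (θ : Param p) : Integrable fun ϑ => ‖ϑ - θ‖ * M.weight π θ n x ϑ := by
  have hw := h.integrable_weight θ
  have h2 : Integrable fun ϑ => M.weight π θ n x ϑ • (ϑ - θ) := by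
    refine Integrable.of_eval fun r => ?_
    simpa [mul_comm] using h.integrable_sub_mul_weight θ r
  refine h2.norm.mono (by fun_prop) (Eventually.of_forall fun ϑ => ?_)
  simp [norm_smul, mul_comm]

/-- The posterior mean in terms of the rescaled weights. -/
lemma Proper.bayes_sub {n : ℕ} {x : Sample X n} (h : M.Proper π n x) {s : ℝ} (hs : 0 < s)
    (hD : 0 < ∫ u : Param p, M.weight π θ n x (θ + s • u)) :
    M.bayes π n x - θ = s • ((∫ u : Param p, M.weight π θ n x (θ + s • u))⁻¹ •
      fun r => ∫ u : Param p, u r * M.weight π θ n x (θ + s • u)) := by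
  set a := π θ * M.f n x θ with ha
  set Z := ∫ ϑ in M.Θ, π ϑ * M.f n x ϑ with hZ
  have hw : ∫ ϑ, M.weight π θ n x ϑ = Z / a := by
    rw [weight, integral_indicator M.measurableSet_Θ, integral_div]
  rw [integral_comp_add_smul _ _ hs, hw] at hD
  have hsp : 0 < s ^ p := by positivity
  -- Positivity of the rescaled integral excludes the default value of division by zero, for the
  -- posterior normalization and for the value at `θ` alike.
  have hZa : Z / a ≠ 0 := fun h0 => by rw [h0] at hD; simp at hD
  have hZ0 : Z ≠ 0 := fun h0 => hZa (by rw [h0, zero_div])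
  have ha0 : a ≠ 0 := fun h0 => hZa (by rw [h0, div_zero])
  have h1 : M.bayes π n x - θ = Z⁻¹ • ∫ ϑ in M.Θ, (π ϑ * M.f n x ϑ) • (ϑ - θ) := by
    have h2 : IntegrableOn (fun ϑ => (π ϑ * M.f n x ϑ) • ϑ) M.Θ := by
      simpa using h.integrable_sub_smul 0
    simp only [smul_sub]
    rw [integral_sub h2 (h.1.smul_const θ), integral_smul_const, smul_sub, inv_smul_smul₀ hZ0]
    rfl
  rw [h1, integral_comp_add_smul _ _ hs, hw]
  ext r
  have h3 : ∫ u : Param p, u r * M.weight π θ n x (θ + s • u) =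
      (s ^ p)⁻¹ * (s⁻¹ * ((∫ ϑ in M.Θ, (π ϑ * M.f n x ϑ) • (ϑ - θ)) r / a)) := by
    have h4 := integral_comp_add_smul (fun ϑ => s⁻¹ * ((ϑ - θ) r * M.weight π θ n x ϑ)) θ hs
    have h5 : ∀ u : Param p, s⁻¹ * ((θ + s • u - θ) r * M.weight π θ n x (θ + s • u)) =
        u r * M.weight π θ n x (θ + s • u) := by
      intro u
      rw [add_sub_cancel_left, Pi.smul_apply, smul_eq_mul]
      field_simp
    simp only [h5] at h4
    rw [h4, integral_const_mul]
    congr 2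
    have h6 := (ContinuousLinearMap.proj (R := ℝ) (φ := fun _ : Fin p => ℝ) r).integral_comp_comm
      (h.integrable_sub_smul θ)
    simp only [ContinuousLinearMap.proj_apply] at h6
    rw [← h6, ← integral_div, ← integral_indicator M.measurableSet_Θ]
    refine integral_congr_ae (Eventually.of_forall fun ϑ => ?_)
    by_cases hϑ : ϑ ∈ M.Θ
    · simp only [weight, Set.indicator_of_mem hϑ, Pi.smul_apply, smul_eq_mul]
      ring
    · simp [weight, Set.indicator_of_notMem hϑ]
  simp only [Pi.smul_apply, smul_eq_mul]
  rw [h3]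
  field_simp

/-- The Jacobian contributes $s^{-p}$ and $\|u\|=s^{-1}\|\vartheta-\theta\|$ one more power. -/
lemma integral_far_weight (n : ℕ) (x : Sample X n) {s δ : ℝ} (hs : 0 < s) :
    ∫ u in {u : Param p | δ ≤ s * ‖u‖}, ‖u‖ * M.weight π θ n x (θ + s • u) =
      (s ^ (p + 1))⁻¹ * ((π θ)⁻¹ * ∫ ϑ in M.Θ \ Metric.ball θ δ,
        ‖ϑ - θ‖ * (π ϑ * (M.f n x ϑ / M.f n x θ))) := by
  have hmeas : MeasurableSet {u : Param p | δ ≤ s * ‖u‖} :=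
    (isClosed_le continuous_const (continuous_const.mul continuous_norm)).measurableSet
  rw [← integral_indicator hmeas, ← integral_const_mul,
    ← integral_indicator (M.measurableSet_Θ.diff measurableSet_ball)]
  have h4 := integral_comp_add_smul (fun ϑ => s⁻¹ * (M.Θ \ Metric.ball θ δ).indicator
    (fun ϑ => (π θ)⁻¹ * (‖ϑ - θ‖ * (π ϑ * (M.f n x ϑ / M.f n x θ)))) ϑ) θ hs
  rw [integral_const_mul s⁻¹ (fun ϑ => (M.Θ \ Metric.ball θ δ).indicator _ ϑ), ← mul_assoc,
    ← mul_inv, ← pow_succ] at h4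
  rw [← h4]
  refine integral_congr_ae (Eventually.of_forall fun u => ?_)
  have hn : ‖θ + s • u - θ‖ = s * ‖u‖ := by
    rw [add_sub_cancel_left, norm_smul, Real.norm_of_nonneg hs.le]
  have hball : θ + s • u ∈ Metric.ball θ δ ↔ s * ‖u‖ < δ := by
    rw [Metric.mem_ball, dist_eq_norm, hn]
  by_cases h2 : θ + s • u ∈ M.Θ
  · by_cases h1 : δ ≤ s * ‖u‖
    · have h3 : θ + s • u ∈ M.Θ \ Metric.ball θ δ := ⟨h2, fun h => not_lt.2 h1 (hball.1 h)⟩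
      have h1' : u ∈ {u : Param p | δ ≤ s * ‖u‖} := h1
      simp only [Set.indicator_of_mem h3, Set.indicator_of_mem h1', weight,
        Set.indicator_of_mem h2, hn]
      field_simp
    · have h3 : θ + s • u ∉ M.Θ \ Metric.ball θ δ := fun h => h.2 (hball.2 (not_le.1 h1))
      have h1' : u ∉ {u : Param p | δ ≤ s * ‖u‖} := h1
      simp only [Set.indicator_of_notMem h3, Set.indicator_of_notMem h1', mul_zero]
  · have h3 : θ + s • u ∉ M.Θ \ Metric.ball θ δ := fun h => h2 h.1
    simp only [Set.indicator_of_notMem h3, mul_zero]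
    exact Set.indicator_apply_eq_zero.2 fun _ => by simp [weight, Set.indicator_of_notMem h2]

end Model

end Rescaling

/-! ### Consequences of the likelihood conditions: bounded score and positive definite limit. -/

section Likelihood

variable {p : ℕ} {X : ℕ → Type*} [∀ i, MeasurableSpace (X i)]

/-- The normalized score `n^{-1/2} ∂ℓ_n(θ)`. -/
noncomputable def Model.score (M : Model p X) (θ : Param p)
    (i : Σ n, Sample X n) : Param p :=
  fun r => (Real.sqrt i.1)⁻¹ * pderiv r (M.ell i.1 i.2) θ

/-- The conditions of the expansion of the posterior mean, along a filter of samples. -/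
structure LaplaceConditions (M : Model p X) (π : Param p → ℝ) (θ : Param p)
    (θML : ∀ n, Sample X n → Param p) (H : Matrix (Fin p) (Fin p) ℝ)
    (K : Fin p → Fin p → Fin p → ℝ) (l : Filter (Σ n, Sample X n)) : Prop where
  mem_interior : θ ∈ interior M.Θ
  tendsto_fst : Tendsto Sigma.fst l atTop
  smooth : ∀ n x, ContDiffOn ℝ 3 (M.ell n x) (interior M.Θ)
  likelihood_equation : ∀ᶠ i in l, θML i.1 i.2 ∈ interior M.Θ ∧
    ∀ r, pderiv r (M.ell i.1 i.2) (θML i.1 i.2) = 0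
  rate : (fun i : Σ n, Sample X n => θML i.1 i.2 - θ) =O[l] fun i => (Real.sqrt i.1)⁻¹
  posDef : ∀ᶠ i in l, (M.Hn i.1 i.2 (θML i.1 i.2)).PosDef
  nonsingular : IsUnit H
  H_limit : ∀ r s, (fun i : Σ n, Sample X n => M.Hn i.1 i.2 θ r s - H r s) =O[l]
    fun i => (Real.sqrt i.1)⁻¹
  K_limit : ∀ r s t, (fun i : Σ n, Sample X n => M.Kn i.1 i.2 θ r s t - K r s t) =o[l]
    fun _ => (1 : ℝ)
  equicontinuous : ∀ ε : ℝ, 0 < ε → ∃ δ : ℝ, 0 < δ ∧ ∀ᶠ i in l, ∀ ϑ ∈ Metric.ball θ δ,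
    ∀ r s t, |M.Kn i.1 i.2 ϑ r s t - M.Kn i.1 i.2 θ r s t| ≤ ε
  prior_differentiable : DifferentiableAt ℝ π θ
  prior_nonneg : ∀ ϑ ∈ M.Θ, 0 ≤ π ϑ
  prior_pos : 0 < π θ
  proper : ∀ᶠ i in l, M.Proper π i.1 i.2
  localized : ∀ δ : ℝ, 0 < δ → (fun i : Σ n, Sample X n => ∫ ϑ in M.Θ \ Metric.ball θ δ,
    ‖ϑ - θ‖ * (π ϑ * (M.f i.1 i.2 ϑ / M.f i.1 i.2 θ))) =o[l]
      fun i => (i.1 : ℝ) ^ (-((p : ℝ) / 2 + 1))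

namespace LaplaceConditions

variable {M : Model p X} {π : Param p → ℝ} {θ : Param p} {θML : ∀ n, Sample X n → Param p}
  {H : Matrix (Fin p) (Fin p) ℝ} {K : Fin p → Fin p → Fin p → ℝ} {l : Filter (Σ n, Sample X n)}

lemma eventually_pos (h : LaplaceConditions M π θ θML H K l) : ∀ᶠ i in l, 0 < (i.1 : ℝ) :=
  (h.tendsto_fst.eventually (eventually_gt_atTop 0)).mono fun _ hi => Nat.cast_pos.2 hi

lemma inv_sqrt_pos (h : LaplaceConditions M π θ θML H K l) :
    ∀ᶠ i in l, 0 < (Real.sqrt i.1)⁻¹ :=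
  h.eventually_pos.mono fun _ hi => inv_pos.2 (Real.sqrt_pos.2 hi)

lemma tendsto_inv_sqrt (h : LaplaceConditions M π θ θML H K l) :
    Tendsto (fun i : Σ n, Sample X n => (Real.sqrt i.1)⁻¹) l (𝓝 0) :=
  (tendsto_inv_atTop_zero.comp (Real.tendsto_sqrt_atTop.comp tendsto_natCast_atTop_atTop)).comp
    h.tendsto_fst

lemma K_near (h : LaplaceConditions M π θ θML H K l) {ε : ℝ} (hε : 0 < ε) :
    ∃ δ : ℝ, 0 < δ ∧ Metric.ball θ δ ⊆ interior M.Θ ∧ ∀ᶠ i in l, ∀ ϑ ∈ Metric.ball θ δ,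
      ∀ r s t, |M.Kn i.1 i.2 ϑ r s t - K r s t| ≤ ε := by
  obtain ⟨δ₁, hδ₁, h1⟩ := h.equicontinuous (ε / 2) (half_pos hε)
  obtain ⟨δ₂, hδ₂, h2⟩ := Metric.isOpen_iff.1 isOpen_interior θ h.mem_interior
  have h3 : ∀ᶠ i in l, ∀ r s t, |M.Kn i.1 i.2 θ r s t - K r s t| ≤ ε / 2 := by
    refine eventually_all.2 fun r => eventually_all.2 fun s => eventually_all.2 fun t => ?_
    simpa using isLittleO_iff.1 (h.K_limit r s t) (half_pos hε)
  refine ⟨min δ₁ δ₂, lt_min hδ₁ hδ₂,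
    (Metric.ball_subset_ball (min_le_right _ _)).trans h2, ?_⟩
  filter_upwards [h1, h3] with i h1 h3 ϑ hϑ r s t
  have h4 := h1 ϑ (Metric.ball_subset_ball (min_le_left _ _) hϑ) r s t
  have h5 := abs_sub_le (M.Kn i.1 i.2 ϑ r s t) (M.Kn i.1 i.2 θ r s t) (K r s t)
  linarith [h3 r s t]

lemma K_tendsto (h : LaplaceConditions M π θ θML H K l) (r s t : Fin p) :
    Tendsto (fun i : Σ n, Sample X n => M.Kn i.1 i.2 θ r s t) l (𝓝 (K r s t)) :=
  tendsto_sub_nhds_zero_iff.1 ((isLittleO_one_iff ℝ).1 (h.K_limit r s t))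

lemma H_tendsto (h : LaplaceConditions M π θ θML H K l) (r s : Fin p) :
    Tendsto (fun i : Σ n, Sample X n => M.Hn i.1 i.2 θ r s) l (𝓝 (H r s)) :=
  tendsto_sub_nhds_zero_iff.1 ((h.H_limit r s).trans_tendsto h.tendsto_inv_sqrt)

/-- A limit of symmetric arrays is symmetric; `NeBot` supplies the uniqueness of limits. -/
lemma K_comm_left [l.NeBot] (h : LaplaceConditions M π θ θML H K l) (r s t : Fin p) :
    K r s t = K s r t := by
  refine tendsto_nhds_unique (h.K_tendsto r s t) ((h.K_tendsto s r t).congr fun i => ?_)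
  unfold Model.Kn
  rw [pderiv_pderiv_comm_left isOpen_interior (h.smooth i.1 i.2) h.mem_interior]

lemma K_comm_right [l.NeBot] (h : LaplaceConditions M π θ θML H K l) (r s t : Fin p) :
    K r s t = K r t s := by
  refine tendsto_nhds_unique (h.K_tendsto r s t) ((h.K_tendsto r t s).congr fun i => ?_)
  unfold Model.Kn
  rw [pderiv_pderiv_comm_right isOpen_interior (h.smooth i.1 i.2) h.mem_interior]

lemma Hn_isSymm (h : LaplaceConditions M π θ θML H K l) (n : ℕ) (x : Sample X n) :
    (M.Hn n x θ).IsSymm := by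
  ext r s
  simp only [Matrix.transpose_apply, Model.Hn, Matrix.of_apply]
  rw [pderiv_comm isOpen_interior ((h.smooth n x).of_le (by norm_num)) h.mem_interior]

lemma H_isSymm [l.NeBot] (h : LaplaceConditions M π θ θML H K l) : H.IsSymm := by
  ext r s
  refine tendsto_nhds_unique (h.H_tendsto s r) ((h.H_tendsto r s).congr fun i => ?_)
  exact (h.Hn_isSymm i.1 i.2).apply s r

/-- The derivatives of the entries of $H_n$ are entries of $-K_n$, which are bounded uniformly on a
fixed ball by `K_near`. -/
lemma Hn_near (h : LaplaceConditions M π θ θML H K l) :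
    ∃ C δ : ℝ, 0 ≤ C ∧ 0 < δ ∧ Metric.ball θ δ ⊆ interior M.Θ ∧ ∀ᶠ i in l, ∀ w : Param p,
      ‖w‖ < δ → ∀ r s, |M.Hn i.1 i.2 (θ + w) r s - M.Hn i.1 i.2 θ r s| ≤ C * ‖w‖ := by
  obtain ⟨δ, hδ, hsub, hK⟩ := h.K_near one_pos
  set C : ℝ := (∑ r, ∑ s, ∑ t, |K r s t|) + 1 with hC
  have hC0 : 0 ≤ C := by positivity
  have hKC : ∀ r s t, |K r s t| ≤ C - 1 := fun r s t => by
    rw [hC, add_sub_cancel_right]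
    refine (Finset.single_le_sum (f := fun t => |K r s t|) (fun _ _ => abs_nonneg _)
      (Finset.mem_univ t)).trans ?_
    refine (Finset.single_le_sum (f := fun s => ∑ t, |K r s t|) (fun _ _ => by positivity)
      (Finset.mem_univ s)).trans ?_
    exact Finset.single_le_sum (f := fun r => ∑ s, ∑ t, |K r s t|) (fun _ _ => by positivity)
      (Finset.mem_univ r)
  refine ⟨p * C, δ, by positivity, hδ, hsub, ?_⟩
  filter_upwards [hK, h.eventually_pos] with i hK hi w hw r s
  have hd : DifferentiableOn ℝ (pderiv r (pderiv s (M.ell i.1 i.2))) (Metric.ball θ δ) :=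
    ((contDiffOn_pderiv isOpen_interior (m := 1) (n := 2) (contDiffOn_pderiv isOpen_interior
      (m := 2) (n := 3) (h.smooth i.1 i.2) le_rfl s) le_rfl r).differentiableOn
        (by norm_num)).mono hsub
  have h1 := abs_sub_le_of_pderiv_le (C := i.1 * C) hd (fun y hy t => by
    have h2 := hK y hy t r s
    have h3 := abs_sub_abs_le_abs_sub (M.Kn i.1 i.2 y t r s) (K t r s)
    have h4 : |M.Kn i.1 i.2 y t r s| ≤ C := by linarith [hKC t r s]
    rw [Model.Kn, abs_mul, abs_inv, abs_of_pos hi, inv_mul_le_iff₀ hi] at h4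
    exact h4) hw
  have h5 : M.Hn i.1 i.2 (θ + w) r s - M.Hn i.1 i.2 θ r s =
      -((i.1 : ℝ)⁻¹ * (pderiv r (pderiv s (M.ell i.1 i.2)) (θ + w) -
        pderiv r (pderiv s (M.ell i.1 i.2)) θ)) := by
    simp only [Model.Hn, Matrix.of_apply]
    ring
  rw [h5, abs_neg, abs_mul, abs_inv, abs_of_pos hi, inv_mul_le_iff₀ hi]
  linarith

lemma θML_tendsto (h : LaplaceConditions M π θ θML H K l) :
    Tendsto (fun i : Σ n, Sample X n => θML i.1 i.2 - θ) l (𝓝 0) :=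
  h.rate.trans_tendsto h.tendsto_inv_sqrt

/-- $H_n(\hat\theta^{ML})$ is positive definite and, by `Hn_near` and consistency, has the same
limit as $H_n(\theta)$. Hence $H$ is positive semidefinite, and non-singularity makes it definite.
-/
lemma posDef_H [l.NeBot] (h : LaplaceConditions M π θ θML H K l) : H.PosDef := by
  obtain ⟨C, δ, hC, hδ, -, hH⟩ := h.Hn_near
  have hlim : ∀ r s, Tendsto (fun i : Σ n, Sample X n => M.Hn i.1 i.2 (θML i.1 i.2) r s) l
      (𝓝 (H r s)) := by
    intro r s
    have h1 : Tendsto (fun i : Σ n, Sample X n => M.Hn i.1 i.2 (θML i.1 i.2) r s -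
        M.Hn i.1 i.2 θ r s) l (𝓝 0) := by
      refine squeeze_zero_norm' ?_ (by simpa using (h.θML_tendsto.norm.const_mul C))
      filter_upwards [hH, h.θML_tendsto.norm.eventually (gt_mem_nhds (by simpa using hδ))] with
        i hH hi
      simpa using hH _ hi r s
    simpa using h1.add (h.H_tendsto r s)
  have hpsd : H.PosSemidef := by
    refine Matrix.PosSemidef.of_dotProduct_mulVec_nonneg ?_ fun x => ?_
    · rw [Matrix.IsHermitian, Matrix.conjTranspose_eq_transpose_of_trivial]
      exact h.H_isSymm
    · have h2 : Tendsto (fun i : Σ n, Sample X n =>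
          star x ⬝ᵥ (M.Hn i.1 i.2 (θML i.1 i.2)).mulVec x) l (𝓝 (star x ⬝ᵥ H.mulVec x)) := by
        simp only [dotProduct, Matrix.mulVec]
        exact tendsto_finsetSum _ fun r _ => (tendsto_finsetSum _ fun s _ =>
          (hlim r s).mul_const _).const_mul _
      refine ge_of_tendsto h2 (h.posDef.mono fun i hi => ?_)
      exact hi.posSemidef.dotProduct_mulVec_nonneg x
  exact hpsd.posDef_iff_isUnit.2 h.nonsingular

end LaplaceConditions

/-- The constant is the minimum of the quadratic form on the compact unit sphere, extended by
homogeneity. The sphere is empty only when $p=0$. -/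
lemma exists_coercive {H : Matrix (Fin p) (Fin p) ℝ} (hH : H.PosDef) :
    ∃ c : ℝ, 0 < c ∧ ∀ u : Param p, c * ‖u‖ ^ 2 ≤ u ⬝ᵥ H.mulVec u := by
  have hcont : Continuous fun u : Param p => u ⬝ᵥ H.mulVec u :=
    continuous_id.dotProduct (continuous_const.matrix_mulVec continuous_id)
  rcases (Metric.sphere (0 : Param p) 1).eq_empty_or_nonempty with he | hne
  · refine ⟨1, one_pos, fun u => ?_⟩
    have hu : u = 0 := by
      by_contra hu
      have : ‖u‖⁻¹ • u ∈ Metric.sphere (0 : Param p) 1 := by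
        rw [mem_sphere_zero_iff_norm, norm_smul, norm_inv, norm_norm,
          inv_mul_cancel₀ (norm_ne_zero_iff.2 hu)]
      rw [he] at this
      exact this
    simp [hu]
  · obtain ⟨v, hv, hmin⟩ := (isCompact_sphere (0 : Param p) 1).exists_isMinOn hne
      hcont.continuousOn
    have hv0 : v ≠ 0 := by
      rintro rfl
      simp at hv
    have hpos : 0 < v ⬝ᵥ H.mulVec v := by simpa using hH.dotProduct_mulVec_pos hv0
    refine ⟨v ⬝ᵥ H.mulVec v, hpos, fun u => ?_⟩
    rcases eq_or_ne u 0 with rfl | hu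
    · simp
    · have hn : ‖u‖ ≠ 0 := norm_ne_zero_iff.2 hu
      have h1 := isMinOn_iff.1 hmin (‖u‖⁻¹ • u) (by
        rw [mem_sphere_zero_iff_norm, norm_smul, norm_inv, norm_norm, inv_mul_cancel₀ hn])
      simp only [Matrix.mulVec_smul, dotProduct_smul, smul_dotProduct, smul_eq_mul] at h1
      calc _ ≤ (‖u‖⁻¹ * (‖u‖⁻¹ * u ⬝ᵥ H.mulVec u)) * ‖u‖ ^ 2 := by gcongr
        _ = _ := by field_simp

namespace LaplaceConditions

variable {M : Model p X} {π : Param p → ℝ} {θ : Param p} {θML : ∀ n, Sample X n → Param p}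
  {H : Matrix (Fin p) (Fin p) ℝ} {K : Fin p → Fin p → Fin p → ℝ} {l : Filter (Σ n, Sample X n)}

lemma coercive_Hn [l.NeBot] (h : LaplaceConditions M π θ θML H K l) :
    ∃ c : ℝ, 0 < c ∧ ∀ᶠ i in l, ∀ u, 2 * c * ‖u‖ ^ 2 ≤ u ⬝ᵥ (M.Hn i.1 i.2 θ).mulVec u := by
  obtain ⟨c, hc, hH⟩ := exists_coercive h.posDef_H
  -- The deviation of $H_n(\theta)$ from $H$ may cost $\frac c2\|u\|^2$; what remains is $\frac
  -- c2=2\cdot\frac c4$.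
  refine ⟨c / 4, by positivity, ?_⟩
  set η : ℝ := c / 2 / (p * p + 1) with hη
  have hη0 : 0 < η := by positivity
  have hηle : p * p * η ≤ c / 2 := by
    rw [hη, mul_div_assoc', div_le_iff₀ (by positivity)]
    nlinarith
  have h1 : ∀ᶠ i in l, ∀ r s, |M.Hn i.1 i.2 θ r s - H r s| ≤ η := by
    refine eventually_all.2 fun r => eventually_all.2 fun s => ?_
    exact ((Metric.tendsto_nhds.1 (h.H_tendsto r s) η hη0)).mono fun i hi => le_of_lt hi
  filter_upwards [h1] with i hi u
  have h2 : |u ⬝ᵥ (M.Hn i.1 i.2 θ - H).mulVec u| ≤ p * p * η * ‖u‖ ^ 2 := by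
    have h3 : ‖(M.Hn i.1 i.2 θ - H).mulVec u‖ ≤ p * η * ‖u‖ := by
      refine (pi_norm_le_iff_of_nonneg (by positivity)).2 fun r => ?_
      calc ‖(M.Hn i.1 i.2 θ - H).mulVec u r‖
          ≤ ∑ s, ‖(M.Hn i.1 i.2 θ - H) r s * u s‖ :=
            norm_sum_le Finset.univ fun s => (M.Hn i.1 i.2 θ - H) r s * u s
        _ ≤ ∑ _s : Fin p, η * ‖u‖ := by
            refine Finset.sum_le_sum fun s _ => ?_
            rw [norm_mul]
            exact mul_le_mul (hi r s) (norm_le_pi_norm u s) (norm_nonneg _) hη0.le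
        _ = _ := by simp [mul_assoc]
    calc _ ≤ p * ‖u‖ * ‖(M.Hn i.1 i.2 θ - H).mulVec u‖ := abs_dotProduct_le _ _
      _ ≤ p * ‖u‖ * (p * η * ‖u‖) := by gcongr
      _ = _ := by ring
  rw [Matrix.sub_mulVec, dotProduct_sub] at h2
  have h4 := neg_le_of_abs_le h2
  have h5 : p * p * η * ‖u‖ ^ 2 ≤ c / 2 * ‖u‖ ^ 2 := by gcongr
  linarith [hH u]

/-- The gradient of $\ell_n$ vanishes at $\hat\theta^{ML}$, at distance $O(n^{-1/2})$ from $\theta$,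
and its derivative $-nH_n$ is $O(n)$ on a fixed ball. So $\partial\ell_n(\theta)=O(n^{1/2})$. -/
lemma score_isBigO [l.NeBot] (h : LaplaceConditions M π θ θML H K l) :
    M.score θ =O[l] fun _ => (1 : ℝ) := by
  obtain ⟨C, δ, hC, hδ, hsub, hH⟩ := h.Hn_near
  obtain ⟨C₁, hC₁, hrate⟩ := h.rate.exists_pos
  -- A bound for $|H_n|$ on the ball: the size of $H$, a deviation of at most $1$ at $\theta$, and
  -- the variation over radius $\delta$.
  set C₂ : ℝ := (∑ r, ∑ s, |H r s|) + 1 + C * δ with hC₂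
  have hC₂0 : 0 ≤ C₂ := by positivity
  have hHC : ∀ r s, |H r s| ≤ C₂ - 1 - C * δ := fun r s => by
    rw [hC₂, add_sub_right_comm, add_sub_cancel_right, add_sub_cancel_right]
    refine (Finset.single_le_sum (f := fun s => |H r s|) (fun _ _ => abs_nonneg _)
      (Finset.mem_univ s)).trans ?_
    exact Finset.single_le_sum (f := fun r => ∑ s, |H r s|) (fun _ _ => by positivity)
      (Finset.mem_univ r)
  have h1 : ∀ᶠ i in l, ∀ r s, |M.Hn i.1 i.2 θ r s - H r s| ≤ 1 := by
    refine eventually_all.2 fun r => eventually_all.2 fun s => ?_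
    exact ((Metric.tendsto_nhds.1 (h.H_tendsto r s) 1 one_pos)).mono fun i hi => le_of_lt hi
  refine isBigO_pi.2 fun r => IsBigO.of_bound (p * C₂ * C₁) ?_
  filter_upwards [hH, h1, h.eventually_pos, h.likelihood_equation, hrate.bound,
    h.θML_tendsto.norm.eventually (gt_mem_nhds (by simpa using hδ))] with i hH h1 hi hlik hr hd
  have hdiff : DifferentiableOn ℝ (pderiv r (M.ell i.1 i.2)) (Metric.ball θ δ) :=
    ((contDiffOn_pderiv isOpen_interior (m := 2) (n := 3) (h.smooth i.1 i.2) le_rfl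
      r).differentiableOn (by norm_num)).mono hsub
  have h2 := abs_sub_le_of_pderiv_le (C := i.1 * C₂) hdiff (fun y hy s => by
    have hy' : ‖y - θ‖ < δ := by rwa [← dist_eq_norm]
    have h3 := hH (y - θ) hy' s r
    rw [add_sub_cancel] at h3
    have h4 : C * ‖y - θ‖ ≤ C * δ := by gcongr
    have h5 : |M.Hn i.1 i.2 y s r| ≤ C₂ := by
      have e1 := abs_sub_abs_le_abs_sub (M.Hn i.1 i.2 y s r) (M.Hn i.1 i.2 θ s r)
      have e2 := abs_sub_abs_le_abs_sub (M.Hn i.1 i.2 θ s r) (H s r)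
      linarith [h1 s r, hHC s r]
    rw [Model.Hn, Matrix.of_apply, abs_neg, abs_mul, abs_inv, abs_of_pos hi,
      inv_mul_le_iff₀ hi] at h5
    exact h5) hd
  rw [add_sub_cancel, hlik.2 r, zero_sub, abs_neg] at h2
  rw [norm_inv, Real.norm_of_nonneg (Real.sqrt_nonneg _)] at hr
  have hs : 0 < Real.sqrt i.1 := Real.sqrt_pos.2 hi
  rw [norm_one, mul_one, Model.score, norm_mul, norm_inv, Real.norm_of_nonneg hs.le,
    Real.norm_eq_abs, inv_mul_le_iff₀ hs]
  calc _ ≤ p * (i.1 * C₂) * (C₁ * (Real.sqrt i.1)⁻¹) := h2.trans (by gcongr)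
    _ = p * C₂ * C₁ * (i.1 * (Real.sqrt i.1)⁻¹) := by ring
    _ = p * C₂ * C₁ * Real.sqrt i.1 := by
        congr 1
        nth_rw 1 [← Real.mul_self_sqrt hi.le]
        field_simp
    _ = _ := by ring

lemma gaussianFamily [l.NeBot] (h : LaplaceConditions M π θ θML H K l) :
    ∃ A c : ℝ, GaussianFamily l (fun i => (Real.sqrt i.1)⁻¹) (M.score θ)
      (fun i => M.Hn i.1 i.2 θ) H A c := by
  obtain ⟨c, hc, hcoer⟩ := h.coercive_Hn
  obtain ⟨A, hA⟩ := h.score_isBigO.bound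
  refine ⟨p * A, c, h.inv_sqrt_pos, h.tendsto_inv_sqrt, hc, hA.mono fun i hi => ?_, hcoer,
    Eventually.of_forall fun i => h.Hn_isSymm i.1 i.2, h.H_limit, h.nonsingular⟩
  rw [norm_one, mul_one] at hi
  gcongr

end LaplaceConditions

end Likelihood

/-! ### Local expansion of the posterior weight and negligibility of its tail. -/

section Expansion

variable {p : ℕ} {X : ℕ → Type*} [∀ i, MeasurableSpace (X i)] {M : Model p X} {π : Param p → ℝ}
  {θ : Param p} {θML : ∀ n, Sample X n → Param p} {H : Matrix (Fin p) (Fin p) ℝ}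
  {K : Fin p → Fin p → Fin p → ℝ} {l : Filter (Σ n, Sample X n)}

lemma gradLog_eq (hd : DifferentiableAt ℝ π θ) (hπ : 0 < π θ) (v : Fin p) :
    gradLog π θ v = pderiv v π θ / π θ := by
  have h := (hd.hasFDerivAt.log hπ.ne').fderiv
  simp only [gradLog, pderiv, h]
  simp [div_eq_inv_mul]

lemma prior_expansion (hd : DifferentiableAt ℝ π θ) (hπ : 0 < π θ) {ε : ℝ} (hε : 0 < ε) :
    ∃ δ : ℝ, 0 < δ ∧ ∀ w : Param p, ‖w‖ < δ →
      |π (θ + w) / π θ - 1 - gradLog π θ ⬝ᵥ w| ≤ ε * ‖w‖ := by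
  have h1 := isLittleO_iff.1 (hasFDerivAt_iff_isLittleO_nhds_zero.1 hd.hasFDerivAt)
    (mul_pos hε hπ)
  obtain ⟨δ, hδ, h2⟩ := Metric.eventually_nhds_iff.1 h1
  refine ⟨δ, hδ, fun w hw => ?_⟩
  have h3 := h2 (y := w) (by simpa using hw)
  have h4 : π (θ + w) / π θ - 1 - gradLog π θ ⬝ᵥ w =
      (π (θ + w) - π θ - fderiv ℝ π θ w) / π θ := by
    have h5 : gradLog π θ ⬝ᵥ w = fderiv ℝ π θ w / π θ := by
      rw [fderiv_apply_eq_sum, dotProduct, Finset.sum_div]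
      exact Finset.sum_congr rfl fun r _ => by rw [gradLog_eq hd hπ]; ring
    rw [h5]
    field_simp
  rw [h4, abs_div, abs_of_pos hπ, div_le_iff₀ hπ]
  rw [Real.norm_eq_abs] at h3
  linarith

lemma sum_cubic_smul (k : Fin p → Fin p → Fin p → ℝ) (s : ℝ) (u : Param p) :
    cubic k (s • u) = s ^ 3 * cubic k u := by
  simp only [cubic, Finset.mul_sum, Pi.smul_apply, smul_eq_mul]
  exact Finset.sum_congr rfl fun _ _ => Finset.sum_congr rfl fun _ _ =>
    Finset.sum_congr rfl fun _ _ => by ring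

lemma cubic_const_mul (k : Fin p → Fin p → Fin p → ℝ) (a : ℝ) (u : Param p) :
    cubic (fun r s t => a * k r s t) u = a * cubic k u := by
  simp only [cubic, Finset.mul_sum, mul_assoc]

namespace LaplaceConditions

/-- Since $ns^2=1$, under $w=su$ the gradient term of $\ell_n$ becomes $z\cdot u$, the Hessian term
$-\frac12u^TH_nu$, and the cubic term, of size $ns^3=s$, becomes $sK[u,u,u]/6$. The prior ratio
supplies the last factor. -/
lemma weight_expansion (h : LaplaceConditions M π θ θML H K l) {ε : ℝ} (hε : 0 < ε) :
    ∃ δ : ℝ, 0 < δ ∧ ∀ᶠ i in l, ∀ u : Param p, (Real.sqrt i.1)⁻¹ * ‖u‖ < δ →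
      ∃ e e' : ℝ, |e| ≤ ε * ‖u‖ ^ 3 ∧ |e'| ≤ ε * ‖u‖ ∧
        M.weight π θ i.1 i.2 (θ + (Real.sqrt i.1)⁻¹ • u) =
          gaussKernel (M.score θ i) (M.Hn i.1 i.2 θ) u *
          Real.exp ((Real.sqrt i.1)⁻¹ * (cubic K u / 6 + e)) *
          (1 + (Real.sqrt i.1)⁻¹ * (gradLog π θ ⬝ᵥ u + e')) := by
  -- The denominator absorbs the factor $p^3$ of `abs_taylor_le`; the $1$ keeps it positive when
  -- $p=0$.
  obtain ⟨δ₁, hδ₁, hsub, hK⟩ := h.K_near (ε := ε / (p ^ 3 + 1)) (by positivity)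
  obtain ⟨δ₂, hδ₂, hprior⟩ := prior_expansion h.prior_differentiable h.prior_pos hε
  refine ⟨min δ₁ δ₂, lt_min hδ₁ hδ₂, ?_⟩
  filter_upwards [hK, h.eventually_pos, h.inv_sqrt_pos] with i hK hi hs u hu
  set s : ℝ := (Real.sqrt i.1)⁻¹ with hsdef
  have hns : (i.1 : ℝ) * s ^ 2 = 1 := by
    rw [hsdef, inv_pow, Real.sq_sqrt hi.le, mul_inv_cancel₀ hi.ne']
  set w : Param p := s • u with hw
  have hwn : ‖w‖ = s * ‖u‖ := by rw [hw, norm_smul, Real.norm_of_nonneg hs.le]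
  have hw1 : ‖w‖ < δ₁ := hwn ▸ hu.trans_le (min_le_left _ _)
  have hw2 : ‖w‖ < δ₂ := hwn ▸ hu.trans_le (min_le_right _ _)
  have hmem : θ + w ∈ interior M.Θ := hsub (by
    rw [Metric.mem_ball, dist_eq_norm, add_sub_cancel_left]
    exact hw1)
  set E : ℝ := M.ell i.1 i.2 (θ + w) - M.ell i.1 i.2 θ -
    (∑ r, w r * pderiv r (M.ell i.1 i.2) θ) -
    (∑ s, ∑ r, w s * w r * pderiv r (pderiv s (M.ell i.1 i.2)) θ) / 2 -
    cubic (fun r s t => i.1 * K r s t) w / 6 with hE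
  have hEle : |E| ≤ s * (ε * ‖u‖ ^ 3) := by
    have h1 := abs_taylor_le (k := fun r s t => i.1 * K r s t) (ε := i.1 * (ε / (p ^ 3 + 1)))
      ((h.smooth i.1 i.2).mono hsub) (fun y hy r s t => by
        have h2 := hK y hy r s t
        have h3 : pderiv r (pderiv s (pderiv t (M.ell i.1 i.2))) y - i.1 * K r s t =
            i.1 * (M.Kn i.1 i.2 y r s t - K r s t) := by
          rw [Model.Kn, mul_sub, mul_inv_cancel_left₀ hi.ne']
        rw [h3, abs_mul, abs_of_pos hi]
        gcongr) hw1
    refine h1.trans ?_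
    have h4 : p ^ 3 * (ε / (p ^ 3 + 1)) ≤ ε := by
      rw [mul_div_assoc', div_le_iff₀ (by positivity)]
      nlinarith
    calc (p : ℝ) ^ 3 * (i.1 * (ε / (p ^ 3 + 1))) * ‖w‖ ^ 3
        = (i.1 * s ^ 2) * s * (p ^ 3 * (ε / (p ^ 3 + 1))) * ‖u‖ ^ 3 := by
          rw [hwn]; ring
      _ ≤ (i.1 * s ^ 2) * s * ε * ‖u‖ ^ 3 := by gcongr
      _ = _ := by rw [hns]; ring
  have hell : M.ell i.1 i.2 (θ + w) - M.ell i.1 i.2 θ =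
      (M.score θ i ⬝ᵥ u - 1 / 2 * (u ⬝ᵥ (M.Hn i.1 i.2 θ).mulVec u)) +
        s * (cubic K u / 6 + E / s) := by
    have e1 : ∑ r, w r * pderiv r (M.ell i.1 i.2) θ = M.score θ i ⬝ᵥ u :=
      Finset.sum_congr rfl fun r _ => by
        simp only [hw, Model.score, Pi.smul_apply, smul_eq_mul, ← hsdef]
        ring
    have e2 : ∑ s, ∑ r, w s * w r * pderiv r (pderiv s (M.ell i.1 i.2)) θ =
        -(u ⬝ᵥ (M.Hn i.1 i.2 θ).mulVec u) := by
      simp only [dotProduct, Matrix.mulVec, Finset.mul_sum, ← Finset.sum_neg_distrib]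
      rw [Finset.sum_comm]
      refine Finset.sum_congr rfl fun r _ => Finset.sum_congr rfl fun t _ => ?_
      have h5 : (i.1 : ℝ)⁻¹ = s ^ 2 := (eq_inv_of_mul_eq_one_right hns).symm
      simp only [hw, Model.Hn, Matrix.of_apply, Pi.smul_apply, smul_eq_mul, h5]
      ring
    have e3 : cubic (fun r s t => i.1 * K r s t) w = s * cubic K u := by
      rw [cubic_const_mul, hw, sum_cubic_smul]
      calc _ = (i.1 * s ^ 2) * (s * cubic K u) := by ring
        _ = _ := by rw [hns, one_mul]
    rw [e1, e2, e3] at hE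
    rw [mul_add, mul_div_cancel₀ _ hs.ne']
    linarith
  refine ⟨E / s, (π (θ + w) / π θ - 1 - gradLog π θ ⬝ᵥ w) / s, ?_, ?_, ?_⟩
  · rw [abs_div, abs_of_pos hs, div_le_iff₀ hs]
    linarith
  · rw [abs_div, abs_of_pos hs, div_le_iff₀ hs]
    have := hprior w hw2
    rw [hwn] at this
    linarith
  · have hf1 := M.f_pos i.1 i.2 _ hmem
    have hf0 := M.f_pos i.1 i.2 _ h.mem_interior
    have h6 : M.f i.1 i.2 (θ + w) / M.f i.1 i.2 θ =
        Real.exp (M.ell i.1 i.2 (θ + w) - M.ell i.1 i.2 θ) := by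
      rw [Real.exp_sub, Model.ell, Model.ell, Real.exp_log hf1, Real.exp_log hf0]
    have h7 : gradLog π θ ⬝ᵥ w = s * (gradLog π θ ⬝ᵥ u) := by
      rw [hw, dotProduct_smul, smul_eq_mul]
    have h8 : 1 + s * (gradLog π θ ⬝ᵥ u + (π (θ + w) / π θ - 1 - gradLog π θ ⬝ᵥ w) / s) =
        π (θ + w) / π θ := by
      rw [h7, mul_add, mul_div_cancel₀ _ hs.ne']
      ring
    rw [h8, Model.weight, Set.indicator_of_mem (interior_subset hmem), mul_div_mul_comm, h6, hell,
      Real.exp_add, gaussKernel]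
    ring

/-- The localization order is $n^{-p/2-1}=s^{p+2}$; rescaling costs $s^{-(p+1)}$, which leaves
$o(s)$. -/
lemma isLittleO_far (h : LaplaceConditions M π θ θML H K l) {δ : ℝ} (hδ : 0 < δ) :
    (fun i : Σ n, Sample X n => ∫ u in {u : Param p | δ ≤ (Real.sqrt i.1)⁻¹ * ‖u‖},
      ‖u‖ * M.weight π θ i.1 i.2 (θ + (Real.sqrt i.1)⁻¹ • u)) =o[l]
      fun i => (Real.sqrt i.1)⁻¹ := by
  have h1 := (isBigO_refl (fun i : Σ n, Sample X n => (((Real.sqrt i.1)⁻¹) ^ (p + 1))⁻¹)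
    l).mul_isLittleO ((h.localized δ hδ).const_mul_left (π θ)⁻¹)
  refine EventuallyEq.trans_isLittleO ?_ (h1.trans_isBigO (IsBigO.of_bound 1 ?_))
  · filter_upwards [h.inv_sqrt_pos] with i hs
    exact Model.integral_far_weight i.1 i.2 hs
  · filter_upwards [h.eventually_pos, h.inv_sqrt_pos] with i hi hs
    rw [one_mul]
    refine le_of_eq (congrArg _ ?_)
    have h2 : (i.1 : ℝ) ^ (-((p : ℝ) / 2 + 1)) = ((Real.sqrt i.1)⁻¹) ^ (p + 2) := by
      rw [← Real.rpow_natCast, Real.sqrt_eq_rpow, ← Real.rpow_neg hi.le, ← Real.rpow_mul hi.le]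
      congr 1
      push_cast
      ring
    rw [h2, pow_succ _ (p + 1), inv_mul_cancel_left₀ (pow_pos hs _).ne']

end LaplaceConditions

end Expansion

/-! ### The remainder is $o_p(n^{-1})$. -/

section Remainder

variable {p : ℕ} {X : ℕ → Type*} [∀ i, MeasurableSpace (X i)] {M : Model p X} {π : Param p → ℝ}
  {θ : Param p} {θML : ∀ n, Sample X n → Param p} {H : Matrix (Fin p) (Fin p) ℝ}
  {K : Fin p → Fin p → Fin p → ℝ} {l : Filter (Σ n, Sample X n)}

/-- The halved sum for a rank-one `I` and for `J_{rs,t} = -B_{rs} y_t`. -/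
lemma halfSum_rank_one (H B : Matrix (Fin p) (Fin p) ℝ) (K : Fin p → Fin p → Fin p → ℝ)
    (hK₁ : ∀ r s t, K r s t = K s r t) (hK₂ : ∀ r s t, K r s t = K r t s) (x y : Param p) :
    halfSum H (fun r s => x r * x s) (fun r s t => -(B r s * y t)) K =
      (1 / 2 : ℝ) • contract K (fun r t => H⁻¹.mulVec x r * H⁻¹.mulVec x t + H⁻¹ r t) -
        B.mulVec (H⁻¹.mulVec y) := by
  ext v
  have e1 : ∑ r, ∑ s, H⁻¹ r s * K v r s = ∑ r, ∑ s, K r s v * H⁻¹ r s :=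
    Finset.sum_congr rfl fun r _ => Finset.sum_congr rfl fun s _ => by
      rw [hK₁ v r s, hK₂ r v s, mul_comm]
  have e2 : ∑ r, ∑ s, H⁻¹ r s * (2 * -(B v r * y s)) = -2 * B.mulVec (H⁻¹.mulVec y) v := by
    simp only [Matrix.mulVec, dotProduct, Finset.mul_sum]
    exact Finset.sum_congr rfl fun r _ => Finset.sum_congr rfl fun s _ => by ring
  have e3 : ∑ r, ∑ s, H⁻¹ r s * ∑ t, ∑ u, H⁻¹ t u * (x s * x u) * K r t v =
      ∑ r, ∑ t, K r t v * (H⁻¹.mulVec x r * H⁻¹.mulVec x t) := by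
    refine Finset.sum_congr rfl fun r _ => ?_
    simp only [Matrix.mulVec, dotProduct, Finset.mul_sum, Finset.sum_mul]
    rw [Finset.sum_comm]
    refine Finset.sum_congr rfl fun t _ => ?_
    rw [Finset.sum_comm]
    exact Finset.sum_congr rfl fun u _ => Finset.sum_congr rfl fun s _ => by ring
  simp only [halfSum, biasA, mul_add, Finset.sum_add_distrib, Pi.sub_apply, Pi.smul_apply,
    smul_eq_mul, contract]
  rw [e1, e2, e3]
  ring

namespace LaplaceConditions

/-- The bracket of the remainder in the rescaled variables. -/
lemma bracket_eq [l.NeBot] (h : LaplaceConditions M π θ θML H K l) {i : Σ n, Sample X n}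
    (hi : 0 < (i.1 : ℝ)) :
    (Real.sqrt i.1)⁻¹ • (gradLog π θ + (fun v => 2 * pderiv v (M.ell i.1 i.2) θ) +
      halfSum H (M.In i.1 i.2 θ) (M.Jn i.1 i.2 θ) K) =
    (2 : ℝ) • M.score θ i - (M.Hn i.1 i.2 θ).mulVec (H⁻¹.mulVec (M.score θ i)) +
      (Real.sqrt i.1)⁻¹ • linearTerm K (gradLog π θ) H (H⁻¹.mulVec (M.score θ i)) := by
  set s : ℝ := (Real.sqrt i.1)⁻¹ with hs
  have hn : (i.1 : ℝ)⁻¹ = s * s := by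
    rw [hs, ← mul_inv, Real.mul_self_sqrt hi.le]
  -- In $I_n$ the factor $n^{-1}$ is shared by the two scores; in $J_n$ it goes into $H_n$, leaving
  -- the unscaled gradient `y`.
  have hI : M.In i.1 i.2 θ = fun r t => M.score θ i r * M.score θ i t := by
    ext r t
    simp only [Model.In, Model.score, hn, ← hs]
    ring
  set y : Param p := fun t => pderiv t (M.ell i.1 i.2) θ with hy
  have hJ : M.Jn i.1 i.2 θ = fun r t u => -(M.Hn i.1 i.2 θ r t * y u) := by
    ext r t u
    simp only [Model.Jn, Model.Hn, Matrix.of_apply, hy]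
    ring
  have hz : M.score θ i = s • y := rfl
  have hg : (fun v => 2 * pderiv v (M.ell i.1 i.2) θ) = (2 : ℝ) • y := rfl
  rw [hI, hJ, hg, halfSum_rank_one _ _ _ h.K_comm_left h.K_comm_right, linearTerm]
  have hBy : (M.Hn i.1 i.2 θ).mulVec (H⁻¹.mulVec (M.score θ i)) =
      s • (M.Hn i.1 i.2 θ).mulVec (H⁻¹.mulVec y) := by
    rw [hz, Matrix.mulVec_smul, Matrix.mulVec_smul]
  rw [hBy]
  nth_rw 3 [hz]
  module

/-- The stochastic expansion of the posterior mean, with a remainder that is `o(n⁻¹)`. -/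
lemma isLittleO_remainder (h : LaplaceConditions M π θ θML H K l) :
    (fun i : Σ n, Sample X n => remainder M π θ H K i.1 i.2) =o[l] fun i => (i.1 : ℝ)⁻¹ := by
  -- The symmetry of $K$ and the positive definiteness of $H$ are obtained as limits and need a
  -- nontrivial filter; along `⊥` the claim is void.
  rcases l.eq_or_neBot with rfl | hne
  · exact isLittleO_iff.2 fun _ _ => eventually_bot
  obtain ⟨A, c, hG⟩ := h.gaussianFamily
  set s : (Σ n, Sample X n) → ℝ := fun i => (Real.sqrt i.1)⁻¹ with hs
  set U : (Σ n, Sample X n) → Param p → ℝ := fun i u =>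
    M.weight π θ i.1 i.2 (θ + s i • u) with hU
  have hlap : ∀ {q : Param p → ℝ}, PolyGrowth q → (∀ u, |q u| ≤ 1 + ‖u‖) →
      (fun i => (∫ u, q u * U i u) - ∫ u, q u * (1 + s i * correction K (gradLog π θ) u) *
        gaussKernel (M.score θ i) (M.Hn i.1 i.2 θ) u) =o[l] s := by
    intro q hq hq1
    refine laplace_scaled hG.s_pos hG.s_tendsto hG.c_pos hG.z_bound hG.coercive ?_ ?_ ?_
      (fun δ hδ => h.isLittleO_far hδ) (fun ε hε => h.weight_expansion hε) hq hq1
    · exact Eventually.of_forall fun i u =>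
        Model.weight_nonneg h.prior_nonneg h.mem_interior i.1 i.2 _
    · filter_upwards [h.proper, hG.s_pos] with i hp hs
      exact Integrable.comp_add_smul (hp.integrable_weight θ) θ hs
    · filter_upwards [h.proper, hG.s_pos] with i hp hs
      have h1 := (Integrable.comp_add_smul (hp.integrable_norm_sub_mul_weight θ) θ hs).const_mul
        (s i)⁻¹
      refine h1.congr (Eventually.of_forall fun u => ?_)
      simp only [add_sub_cancel_left, norm_smul, Real.norm_of_nonneg hs.le]
      rw [mul_assoc, inv_mul_cancel_left₀ hs.ne']
  obtain ⟨hDpos, hratio⟩ := hG.ratio_expansion h.K_comm_left h.K_comm_right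
    (ρ := gradLog π θ) (D := fun i => ∫ u, U i u) (N := fun i r => ∫ u, u r * U i u)
    (by simpa using hlap (PolyGrowth.const 1) (fun u => by simp))
    (fun r => hlap (PolyGrowth.coord r) (fun u => by
      have := norm_le_pi_norm u r
      rw [Real.norm_eq_abs] at this
      linarith))
  -- The error $o(s)$ in $Hb$ is multiplied by $H^{-1}$ and by the scale $s$, which gives
  -- $o(s^2)=o(n^{-1})$.
  have h1 := (isBigO_refl s l).smul_isLittleO (isLittleO_const_mulVec H⁻¹ hratio)
  refine EventuallyEq.trans_isLittleO ?_ (h1.trans_isBigO (IsBigO.of_bound 1 ?_))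
  · filter_upwards [h.eventually_pos, hG.s_pos, hDpos, h.proper] with i hi hs hD hp
    have hn : (i.1 : ℝ)⁻¹ = s i * s i := by
      simp only [s]
      rw [← mul_inv, Real.mul_self_sqrt hi.le]
    have h2 := h.bracket_eq hi
    rw [Matrix.mulVec_sub, hG.inv_mulVec_mulVec, ← h2, remainder, hp.bayes_sub hs hD, hn,
      Matrix.mulVec_smul, smul_sub]
    simp only [smul_smul]
    rfl
  · filter_upwards [h.eventually_pos] with i hi
    rw [one_mul, smul_eq_mul]
    simp only [s]
    rw [← mul_inv, Real.mul_self_sqrt hi.le]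

end LaplaceConditions

/-- The remainder of the stochastic expansion of the posterior mean is `o_p(n⁻¹)`. -/
theorem isLittleOp_remainder {I : Fin p → Fin p → ℝ} {J : Fin p → Fin p → Fin p → ℝ}
    (hθ : θ ∈ interior M.Θ) (h₁ : FirstConditions M π θ θML) (h₂ : SecondConditions M θ H I J K)
    (hreg : Regularity M π θ) :
    IsLittleOp (M.law θ) (fun n x => remainder M π θ H K n x) fun n => (n : ℝ)⁻¹ := by
  refine isLittleOp_of_isLittleO (fun n => by positivity) ?_
  -- Only the two $O_p$ conditions and equicontinuity require a restriction to large events; the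
  -- other stochastic conditions hold along `hpFilter` and pass to smaller filters.
  have hT : Tight (M.law θ) fun l => LaplaceConditions M π θ θML H K l := by
    have hB := Tight.forall (P := M.law θ) (κ := Fin p × Fin p)
      (Φ := fun k l => (fun i : Σ n, Sample X n => M.Hn i.1 i.2 θ k.1 k.2 - H k.1 k.2) =O[l]
        fun i => (Real.sqrt i.1)⁻¹)
      (fun k l l' hl h => h.mono hl) (fun k => (h₂.H_limit k.1 k.2).tight)
    have hC := tight_of_equicontinuous (P := M.law θ)
      (A := fun ε δ n x => ∀ ϑ ∈ Metric.ball θ δ, ∀ r s t,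
        |M.Kn n x ϑ r s t - M.Kn n x θ r s t| ≤ ε)
      (fun ε ε' δ n x hε h ϑ hϑ r s t => (h ϑ hϑ r s t).trans hε) (fun ε hε => by
        obtain ⟨δ, hδ, h⟩ := hreg.equicontinuous ε hε
        refine ⟨δ, hδ, ?_⟩
        simpa only [not_forall, not_le, exists_prop] using h)
    refine ((Tight.and (fun l l' hl h => ?_) (fun l l' hl h => ?_) h₁.rate.tight
      (Tight.and (fun l l' hl h k => ?_) (fun l l' hl h ε hε => ?_) hB hC))).mono
      fun l hl ⟨hr, hH, hK⟩ => ?_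
    · exact h.mono hl
    · refine ⟨fun k => (h.1 k).mono hl, fun ε hε => ?_⟩
      obtain ⟨δ, hδ, h'⟩ := h.2 ε hε
      exact ⟨δ, hδ, hl h'⟩
    · exact (h k).mono hl
    · obtain ⟨δ, hδ, h'⟩ := h ε hε
      exact ⟨δ, hδ, hl h'⟩
    exact
      { mem_interior := hθ
        tendsto_fst := (tendsto_fst_hpFilter _).mono_left hl
        smooth := h₁.ell_smooth
        likelihood_equation := hl h₁.likelihood_equation.eventually
        rate := hr
        posDef := hl h₁.posDef.eventually
        nonsingular := h₂.nonsingular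
        H_limit := fun r s => hH (r, s)
        K_limit := fun r s t => (h₂.K_limit r s t).isLittleO.mono hl
        equicontinuous := hK
        prior_differentiable :=
          h₁.prior_differentiable.differentiableAt (isOpen_interior.mem_nhds hθ)
        prior_nonneg := hreg.prior_nonneg
        prior_pos := hreg.prior_pos
        proper := hl (eventually_hpFilter_of_ae hreg.posterior_proper)
        localized := fun δ hδ => (hreg.localized δ hδ).isLittleO.mono hl }
  rw [isLittleO_iff]
  intro c hc
  exact (hT.mono fun l _ h => isLittleO_iff.1 h.isLittleO_remainder hc).eventually

end Remainder

/-! ### Expectations of the score and of the bracket. -/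

section Expectation

variable {p : ℕ} {X : ℕ → Type*} [∀ i, MeasurableSpace (X i)] {M : Model p X} {π : Param p → ℝ}
  {θ : Param p} {n : ℕ}

namespace Model

lemma isProbabilityMeasure_law (hθ : θ ∈ M.Θ) (n : ℕ) : IsProbabilityMeasure (M.law θ n) :=
  ⟨by rw [law, withDensity_apply _ MeasurableSet.univ, Measure.restrict_univ,
    M.lintegral_f n θ hθ]⟩

lemma integral_f {ϑ : Param p} (hϑ : ϑ ∈ M.Θ) (n : ℕ) : ∫ x, M.f n x ϑ ∂(M.ref n) = 1 := by
  rw [integral_eq_lintegral_of_nonneg_ae (Eventually.of_forall fun x => M.f_nonneg n x ϑ hϑ)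
    (M.measurable_f n ϑ hϑ).aestronglyMeasurable, M.lintegral_f n ϑ hϑ, ENNReal.toReal_one]

lemma differentiableAt_ell (hθ : θ ∈ interior M.Θ)
    (hsm : ∀ n x, ContDiffOn ℝ 3 (M.ell n x) (interior M.Θ)) (x : Sample X n) :
    DifferentiableAt ℝ (M.ell n x) θ :=
  ((hsm n x).differentiableOn (by norm_num)).differentiableAt (isOpen_interior.mem_nhds hθ)

lemma f_mul_pderiv_ell (hθ : θ ∈ interior M.Θ)
    (hsm : ∀ n x, ContDiffOn ℝ 3 (M.ell n x) (interior M.Θ)) (x : Sample X n) (r : Fin p) :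
    M.f n x θ * pderiv r (M.ell n x) θ = pderiv r (M.f n x) θ := by
  have h1 : M.f n x =ᶠ[𝓝 θ] fun ϑ => Real.exp (M.ell n x ϑ) := by
    filter_upwards [isOpen_interior.mem_nhds hθ] with ϑ hϑ
    rw [ell, Real.exp_log (M.f_pos n x ϑ hϑ)]
  rw [pderiv, pderiv, h1.fderiv_eq, (differentiableAt_ell hθ hsm x).hasFDerivAt.exp.fderiv,
    ← h1.eq_of_nhds]
  rfl

/-- The densities are measurable in $x$ for each fixed parameter value, so the derivative is
obtained as a limit of difference quotients along a sequence that stays inside $\Theta$. -/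
lemma measurable_pderiv_ell (hθ : θ ∈ interior M.Θ)
    (hsm : ∀ n x, ContDiffOn ℝ 3 (M.ell n x) (interior M.Θ)) (n : ℕ) (r : Fin p) :
    Measurable fun x : Sample X n => pderiv r (M.ell n x) θ := by
  have hell : ∀ ϑ ∈ M.Θ, Measurable fun x : Sample X n => M.ell n x ϑ := fun ϑ hϑ =>
    Real.measurable_log.comp (M.measurable_f n ϑ hϑ)
  obtain ⟨δ, hδ, hsub⟩ := Metric.isOpen_iff.1 isOpen_interior θ hθ
  set t : ℕ → ℝ := fun k => δ / 2 / ((k : ℝ) + 1) with ht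
  have ht0 : ∀ k, 0 < t k := fun k => by positivity
  have htle : ∀ k, t k ≤ δ / 2 := fun k => div_le_self (by positivity) (by
    have : (0 : ℝ) ≤ k := k.cast_nonneg
    linarith)
  have htlim : Tendsto t atTop (𝓝 0) := by
    have := (tendsto_one_div_add_atTop_nhds_zero_nat (𝕜 := ℝ)).const_mul (δ / 2)
    simpa [ht, div_eq_mul_inv] using this
  have hmem : ∀ k, θ + t k • (Pi.single r 1 : Param p) ∈ M.Θ := fun k => by
    refine interior_subset (hsub ?_)
    rw [Metric.mem_ball, dist_eq_norm, add_sub_cancel_left, norm_smul,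
      Real.norm_of_nonneg (ht0 k).le, Pi.norm_single, norm_one]
    linarith [htle k]
  refine measurable_of_tendsto_metrizable (f := fun k (x : Sample X n) =>
    (t k)⁻¹ * (M.ell n x (θ + t k • Pi.single r 1) - M.ell n x θ)) (fun k =>
      ((hell _ (hmem k)).sub (hell _ (interior_subset hθ))).const_mul _) ?_
  refine tendsto_pi_nhds.2 fun x => ?_
  have h1 := ((differentiableAt_ell hθ hsm x).hasFDerivAt.hasLineDerivAt
    (Pi.single r 1)).tendsto_slope_zero
  exact h1.comp (tendsto_nhdsWithin_iff.2 ⟨htlim, Eventually.of_forall fun k => (ht0 k).ne'⟩)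

/-- $nI_{n,rr}$ is the square of the derivative, which therefore lies in $L^2$ of a probability
measure. -/
lemma integrable_pderiv_ell (hθ : θ ∈ interior M.Θ)
    (hsm : ∀ n x, ContDiffOn ℝ 3 (M.ell n x) (interior M.Θ)) (hn : 0 < n) (r : Fin p)
    (hI : Integrable (fun x => M.In n x θ r r) (M.law θ n)) :
    Integrable (fun x => pderiv r (M.ell n x) θ) (M.law θ n) := by
  have := isProbabilityMeasure_law (M := M) (interior_subset hθ) n
  have hn' : (n : ℝ) ≠ 0 := by positivity
  have h2 : MemLp (fun x => pderiv r (M.ell n x) θ) 2 (M.law θ n) := by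
    rw [memLp_two_iff_integrable_sq (measurable_pderiv_ell hθ hsm n r).aestronglyMeasurable]
    refine (hI.const_mul (n : ℝ)).congr (Eventually.of_forall fun x => ?_)
    simp only [In]
    field_simp
  exact h2.integrable one_le_two

/-- $f_n\,\partial_r\ell_n=\partial_rf_n$, and by the interchange its integral is the derivative of
$\int f_n$, which is constantly $1$ near $\theta$. -/
lemma integral_pderiv_ell (hθ : θ ∈ interior M.Θ)
    (hsm : ∀ n x, ContDiffOn ℝ 3 (M.ell n x) (interior M.Θ)) (r : Fin p)
    (hex : ∫ x, pderiv r (M.f n x) θ ∂(M.ref n) =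
      pderiv r (fun ϑ => ∫ x, M.f n x ϑ ∂(M.ref n)) θ) :
    ∫ x, pderiv r (M.ell n x) θ ∂(M.law θ n) = 0 := by
  have hθ' := interior_subset hθ
  rw [law, integral_withDensity_eq_integral_toReal_smul
    (M.measurable_f n θ hθ').ennreal_ofReal (Eventually.of_forall fun x => ENNReal.ofReal_lt_top)]
  have h1 : ∀ x, (ENNReal.ofReal (M.f n x θ)).toReal • pderiv r (M.ell n x) θ =
      pderiv r (M.f n x) θ := fun x => by
    rw [ENNReal.toReal_ofReal (M.f_nonneg n x θ hθ'), smul_eq_mul, f_mul_pderiv_ell hθ hsm]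
  simp only [h1]
  have h2 : (fun ϑ => ∫ x, M.f n x ϑ ∂(M.ref n)) =ᶠ[𝓝 θ] fun _ => 1 := by
    filter_upwards [isOpen_interior.mem_nhds hθ] with ϑ hϑ
    exact integral_f (interior_subset hϑ) n
  rw [hex, pderiv, h2.fderiv_eq]
  simp

end Model

section HalfSum

variable {Ω : Type*} [MeasurableSpace Ω] {μ : Measure Ω} [IsFiniteMeasure μ]
  {H : Matrix (Fin p) (Fin p) ℝ} {K : Fin p → Fin p → Fin p → ℝ}
  {I : Ω → Fin p → Fin p → ℝ} {J : Ω → Fin p → Fin p → Fin p → ℝ}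

lemma integrable_biasA (hI : ∀ r s, Integrable (fun x => I x r s) μ)
    (hJ : ∀ r s t, Integrable (fun x => J x r s t) μ) (r s v : Fin p) :
    Integrable (fun x => biasA H (I x) (J x) K r s v) μ :=
  ((integrable_const _).add ((hJ v r s).const_mul 2)).add
    (integrable_finsetSum _ fun t _ => integrable_finsetSum _ fun u _ =>
      ((hI s u).const_mul (H⁻¹ t u)).mul_const (K r t v))

lemma integrable_halfSum (hI : ∀ r s, Integrable (fun x => I x r s) μ)
    (hJ : ∀ r s t, Integrable (fun x => J x r s t) μ) :
    Integrable (fun x => halfSum H (I x) (J x) K) μ :=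
  Integrable.of_eval fun v => (integrable_finsetSum _ fun r _ => integrable_finsetSum _ fun s _ =>
    (integrable_biasA hI hJ r s v).const_mul (H⁻¹ r s)).const_mul (1 / 2)

lemma integral_halfSum [IsProbabilityMeasure μ] (hI : ∀ r s, Integrable (fun x => I x r s) μ)
    (hJ : ∀ r s t, Integrable (fun x => J x r s t) μ) :
    ∫ x, halfSum H (I x) (J x) K ∂μ =
      halfSum H (fun r s => ∫ x, I x r s ∂μ) (fun r s t => ∫ x, J x r s t ∂μ) K := by
  ext v
  rw [eval_integral fun v => (integrable_halfSum hI hJ).eval v]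
  simp only [halfSum]
  rw [integral_const_mul, integral_finsetSum _ fun r _ => integrable_finsetSum _ fun s _ =>
    (integrable_biasA hI hJ r s v).const_mul (H⁻¹ r s)]
  congr 1
  refine Finset.sum_congr rfl fun r _ => ?_
  rw [integral_finsetSum _ fun s _ => (integrable_biasA hI hJ r s v).const_mul (H⁻¹ r s)]
  refine Finset.sum_congr rfl fun s _ => ?_
  rw [integral_const_mul]
  congr 1
  have h1 : ∀ t u, Integrable (fun x => H⁻¹ t u * I x s u * K r t v) μ := fun t u =>
    ((hI s u).const_mul (H⁻¹ t u)).mul_const (K r t v)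
  have h2 : Integrable (fun x => K v r s + 2 * J x v r s) μ :=
    (integrable_const _).add ((hJ v r s).const_mul 2)
  simp only [biasA]
  rw [integral_add h2 (integrable_finsetSum _ fun t _ => integrable_finsetSum _ fun u _ => h1 t u),
    integral_add (integrable_const _) ((hJ v r s).const_mul 2), integral_const_mul,
    integral_finsetSum _ fun t _ => integrable_finsetSum _ fun u _ => h1 t u]
  simp only [integral_finsetSum _ fun u _ => h1 _ u, integral_mul_const, integral_const_mul,
    integral_const, probReal_univ, one_smul]

lemma tendsto_halfSum {ι : Type*} {L : Filter ι} {I : ι → Fin p → Fin p → ℝ}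
    {J : ι → Fin p → Fin p → Fin p → ℝ} {I₀ : Fin p → Fin p → ℝ} {J₀ : Fin p → Fin p → Fin p → ℝ}
    (hI : ∀ r s, Tendsto (fun i => I i r s) L (𝓝 (I₀ r s)))
    (hJ : ∀ r s t, Tendsto (fun i => J i r s t) L (𝓝 (J₀ r s t))) :
    Tendsto (fun i => halfSum H (I i) (J i) K) L (𝓝 (halfSum H I₀ J₀ K)) := by
  refine tendsto_pi_nhds.2 fun v => Tendsto.const_mul _ (tendsto_finsetSum _ fun r _ =>
    tendsto_finsetSum _ fun s _ => Tendsto.const_mul _ ?_)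
  exact (((hJ v r s).const_mul 2).const_add _).add (tendsto_finsetSum _ fun t _ =>
    tendsto_finsetSum _ fun u _ => ((hI s u).const_mul _).mul_const _)

end HalfSum

/-- The expectation of the bracket of the remainder. -/
lemma integrable_bracket [IsProbabilityMeasure (M.law θ n)] {H : Matrix (Fin p) (Fin p) ℝ}
    {K : Fin p → Fin p → Fin p → ℝ} (hθ : θ ∈ interior M.Θ)
    (hsm : ∀ n x, ContDiffOn ℝ 3 (M.ell n x) (interior M.Θ)) (hn : 0 < n)
    (hex : ∀ r : Fin p, ∫ x, pderiv r (M.f n x) θ ∂(M.ref n) =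
      pderiv r (fun ϑ => ∫ x, M.f n x ϑ ∂(M.ref n)) θ)
    (hI : ∀ r s, Integrable (fun x => M.In n x θ r s) (M.law θ n))
    (hJ : ∀ r s t, Integrable (fun x => M.Jn n x θ r s t) (M.law θ n)) :
    Integrable (fun x => gradLog π θ + (fun v => 2 * pderiv v (M.ell n x) θ) +
      halfSum H (M.In n x θ) (M.Jn n x θ) K) (M.law θ n) ∧
    ∫ x, (gradLog π θ + (fun v => 2 * pderiv v (M.ell n x) θ) +
      halfSum H (M.In n x θ) (M.Jn n x θ) K) ∂(M.law θ n) = gradLog π θ +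
        halfSum H (fun r s => ∫ x, M.In n x θ r s ∂(M.law θ n))
          (fun r s t => ∫ x, M.Jn n x θ r s t ∂(M.law θ n)) K := by
  have hs : ∀ v, Integrable (fun x => 2 * pderiv v (M.ell n x) θ) (M.law θ n) :=
    fun v => (Model.integrable_pderiv_ell hθ hsm hn v (hI v v)).const_mul 2
  have hs' : Integrable (fun x v => 2 * pderiv v (M.ell n x) θ) (M.law θ n) :=
    Integrable.of_eval hs
  have hs'' : Integrable (fun x => gradLog π θ + fun v => 2 * pderiv v (M.ell n x) θ)
      (M.law θ n) := (integrable_const _).add hs'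
  have hhalf := integrable_halfSum (H := H) (K := K) hI hJ
  have hs0 : ∫ x, (fun v => 2 * pderiv v (M.ell n x) θ) ∂(M.law θ n) = 0 := by
    ext v
    rw [eval_integral hs, integral_const_mul, Model.integral_pderiv_ell hθ hsm v (hex v), mul_zero,
      Pi.zero_apply]
  refine ⟨hs''.add hhalf, ?_⟩
  rw [integral_add hs'' hhalf, integral_add (integrable_const _) hs', hs0, add_zero,
    integral_halfSum hI hJ, integral_const, probReal_univ, one_smul]

lemma integral_const_add_smul_mulVec {Ω : Type*} [MeasurableSpace Ω] {μ : Measure Ω}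
    [IsProbabilityMeasure μ] {R Y : Ω → Param p} (hR : Integrable R μ) (hY : Integrable Y μ)
    (A : Matrix (Fin p) (Fin p) ℝ) (a : ℝ) (θ : Param p) :
    Integrable (fun x => R x + (θ + a • A.mulVec (Y x))) μ ∧
      ∫ x, (R x + (θ + a • A.mulVec (Y x))) ∂μ =
        (∫ x, R x ∂μ) + (θ + a • A.mulVec (∫ x, Y x ∂μ)) := by
  have h1 := (Matrix.mulVecLin A).toContinuousLinearMap.integral_comp_comm hY
  have h2 : Integrable (fun x => A.mulVec (Y x)) μ :=
    (Matrix.mulVecLin A).toContinuousLinearMap.integrable_comp hY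
  simp only [LinearMap.coe_toContinuousLinearMap', Matrix.mulVecLin_apply] at h1
  have h3 : Integrable (fun x => a • A.mulVec (Y x)) μ := h2.smul a
  have h4 : Integrable (fun x => θ + a • A.mulVec (Y x)) μ := (integrable_const θ).add h3
  refine ⟨hR.add h4, ?_⟩
  rw [integral_add hR h4, integral_add (integrable_const θ) h3, integral_smul, h1, integral_const,
    probReal_univ, one_smul]

lemma bayes_eq (M : Model p X) (π : Param p → ℝ) (θ : Param p) (H : Matrix (Fin p) (Fin p) ℝ)
    (K : Fin p → Fin p → Fin p → ℝ) (n : ℕ) (x : Sample X n) :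
    M.bayes π n x = remainder M π θ H K n x + (θ + (n : ℝ)⁻¹ • H⁻¹.mulVec
      (gradLog π θ + (fun v => 2 * pderiv v (M.ell n x) θ) +
        halfSum H (M.In n x θ) (M.Jn n x θ) K)) := by
  rw [remainder]
  abel

end Expectation

end BayesBias

/-! ### The bias of the posterior mean. -/

theorem mainTheorem2 {p : ℕ} {X : ℕ → Type*} [∀ i, MeasurableSpace (X i)]
    (M : BayesBias.Model p X) (π : BayesBias.Param p → ℝ)
    (θ : BayesBias.Param p) (hθ : θ ∈ interior M.Θ)
    (θML : ∀ n, BayesBias.Sample X n → BayesBias.Param p)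
    (H : Matrix (Fin p) (Fin p) ℝ) (I : Fin p → Fin p → ℝ)
    (J K : Fin p → Fin p → Fin p → ℝ)
    (h₁ : BayesBias.FirstConditions M π θ θML)
    (h₂ : BayesBias.SecondConditions M θ H I J K)
    (hreg : BayesBias.Regularity M π θ)
    (hrem : BayesBias.RemainderExpectation M π θ H K) :
    (∀ᶠ n in atTop, Integrable (M.bayes π n) (M.law θ n)) ∧
    ((fun n : ℕ => BayesBias.bias M π θ n -
        (n : ℝ)⁻¹ • H⁻¹.mulVec (BayesBias.gradLog π θ + BayesBias.halfSum H I J K))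
      =o[atTop] fun n : ℕ => (n : ℝ)⁻¹) ∧
    (BayesBias.gradLog π θ = -BayesBias.halfSum H I J K →
      (fun n : ℕ => BayesBias.bias M π θ n) =o[atTop] fun n : ℕ => (n : ℝ)⁻¹) := by
  obtain ⟨hRint, hRlit⟩ := hrem (BayesBias.isLittleOp_remainder hθ h₁ h₂ hreg)
  have hprob : ∀ n, IsProbabilityMeasure (M.law θ n) :=
    BayesBias.Model.isProbabilityMeasure_law (interior_subset hθ)
  -- The estimator is the remainder plus an affine function of the bracket. Both are integrable for
  -- large $n$, and the score term drops out of the expectation.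
  have hbayes : ∀ᶠ n in atTop, Integrable (M.bayes π n) (M.law θ n) ∧
      BayesBias.bias M π θ n = (∫ x, BayesBias.remainder M π θ H K n x ∂(M.law θ n)) +
        (n : ℝ)⁻¹ • H⁻¹.mulVec (BayesBias.gradLog π θ +
          BayesBias.halfSum H (fun r s => ∫ x, M.In n x θ r s ∂(M.law θ n))
            (fun r s t => ∫ x, M.Jn n x θ r s t ∂(M.law θ n)) K) := by
    filter_upwards [hRint, eventually_gt_atTop 0, hreg.interchange,
      eventually_all.2 fun r => eventually_all.2 fun s => h₂.I_integrable r s,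
      eventually_all.2 fun r => eventually_all.2 fun s => eventually_all.2 fun t =>
        h₂.J_integrable r s t] with n hR hn hex hI hJ
    have hY := BayesBias.integrable_bracket (π := π) (H := H) (K := K) hθ h₁.ell_smooth hn hex hI hJ
    have h3 := BayesBias.integral_const_add_smul_mulVec hR hY.1 H⁻¹ (n : ℝ)⁻¹ θ
    simp only [← BayesBias.bayes_eq, hY.2] at h3
    refine ⟨h3.1, ?_⟩
    rw [BayesBias.bias, h3.2]
    abel
  have hmain : (fun n : ℕ => BayesBias.bias M π θ n -
      (n : ℝ)⁻¹ • H⁻¹.mulVec (BayesBias.gradLog π θ + BayesBias.halfSum H I J K))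
      =o[atTop] fun n : ℕ => (n : ℝ)⁻¹ := by
    -- Replacing $E I_n$, $E J_n$ by $I$, $J$ costs $o(1)$ inside a term with prefactor $n^{-1}$.
    have h5 := BayesBias.isLittleO_const_mulVec H⁻¹ ((isLittleO_one_iff ℝ).2
      (tendsto_sub_nhds_zero_iff.2 (BayesBias.tendsto_halfSum (H := H) (K := K) h₂.I_limit
        h₂.J_limit)))
    have h6 := (isBigO_refl (fun n : ℕ => (n : ℝ)⁻¹) atTop).smul_isLittleO h5
    simp only [smul_eq_mul, mul_one] at h6
    refine EventuallyEq.trans_isLittleO ?_ (hRlit.add h6)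
    filter_upwards [hbayes] with n hn
    rw [hn.2, Matrix.mulVec_sub, Matrix.mulVec_add, Matrix.mulVec_add]
    module
  refine ⟨hbayes.mono fun n hn => hn.1, hmain, fun h0 => ?_⟩
  simpa [h0] using hmain
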